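/- **Setting.** For a filtration $X^0\subseteq\cdots\subseteq X^N\subseteq X$ of simplicial complexes, let $X^i_d$ be the set of $d$-simplices ($d+1$ vertices) of $X^i$, $\tilde X^0_d=X^0_d$ and $\tilde X^i_d=X^i_d\setminus X^{i-1}_d$. A simplex $\sigma\in\tilde X^i_d$ is *internal* if there are two distinct simplices $\sigma',\sigma''\in\tilde X^i_d\setminus\{\sigma\}$ and two distinct $(d+1)$-simplices $\tau'\supseteq\sigma\cup\sigma'$, $\tau''\supseteq\sigma\cup\sigma''$ of $X$. The set $\hat X^i_d$ of *essential* simplices is $\tilde X^i_d$ without the internal ones. The filtration together with an orientation of the $d$-simplices is a *uniform oriented $d$-filtration* (for given vertex weights; a simplex has the product of the weights of its vertices) if 1. any two distinct simplices of $\hat X^i_d$ that share a $(d-1)$-face induce opposite orientations on it; 2. for $i\ne j$, if $\sigma\in\hat X^i_d$ and $\sigma'\in\hat X^j_d$ share a coface $\tau\in X_{d+1}$, they induce opposite orientations on $\tau$, and all faces of $\tau$ that lie in $X^N_d$ lie in $\tilde X^i_d\cup\tilde X^j_d$; 3. all simplices of $\tilde X^i_d$ have the same weight; 4. for all $i,j$,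 the number of faces in $\hat X^i_d$ is the same for all $\tau\in X_{d+1}$ whose faces that lie in $X^N_d$ all lie in $\tilde X^i_d\cup\tilde X^j_d$, with at least one in each of the two sets. *Thickening.* The generalized octahedron $K=\{1,2\}*\{3,4\}*\cdots*\{2P-1,2P\}$ is *glued* to a copy $K'$ (written $K\to K'$) by its thickening $L$: the simplices are $\{u_1,\dots,u_a,v_1',\dots,v_b'\}$ with $u_1<\cdots<u_a\le v_1<\cdots<v_b$ and $\{u_1,\dots,u_a,v_1,\dots,v_b\}\in K$. For $1\le k\le P$ the *$k$-th slab* consists of the simplices with an unprimed vertex in each of the first $P-k$ positions, both copies $u,u'$ of a vertex in position $P-k+1$, and a primed vertex in each of the last $k-1$ positions. The *$k$-th layer* $L^k$ is the set of simplices obtained from these by removing one unprimed vertex. Its *principal* part $\hat L^k$ is obtained by removing the unprimed vertex of the doubled position, so that $\hat L^P$ is the set of maximal simplices of $K'$. *Gadget complex.* The qubit graph $\mathcal G_n$ has the vertices $1_i^a,2_i^a,3_i^a,4_i^a$ ($1\le i\le n$, $a\in\{0,1\}$). In each block $i$ there are the two squares with the edges $13,14,23,24$ ($a=0$ and $a=1$)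 and the edge $4_i^04_i^1$. Vertices of different blocks are always adjacent. $\mathcal G_{\rm disj}$ is $\mathcal G_n$ without the edges $4_i^04_i^1$. Let $H=\sum_{g=1}^t h_g$, where $h_g$ acts on a nonempty set $I_g$ of $m_g$ qubits and is the projector onto $|x\rangle$, or onto $\frac1{\sqrt2}(|x\rangle-|y\rangle)$, for some $x\ne y\in\{0,1\}^{I_g}$. Let $K^x$ be the octahedron in $\mathcal G_n$ with the positions $\{1_i^{x_i},2_i^{x_i}\},\{3_i^{x_i},4_i^{x_i}\}$, $i\in I_g$ (in increasing order of $i$). For $|x\rangle-|y\rangle$, take new octahedra $K'^x,K'^y,K''$, glued as $K^x\to K'^x\leftarrow K''\to K'^y\leftarrow K^y$. Also add a vertex $4_i^c$ for each $i\in I_g$. Inside block $i$ it is adjacent to $4_i^{x_i},4_i'^x,4_i'',4_i'^y,4_i^{y_i}$. Outside block $i$ it is adjacent to every qubit vertex and every vertex of the same gadget. For $|x\rangle$, take a new octahedron $K'^x$ glued as $K^x\to K'^x$, and a central vertex $v^c$ adjacent to all of $K'^x$. All new vertices are adjacent to all qubit vertices of the blocks outside $I_g$, and new vertices of different terms are not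 adjacent. The result is the full gadget graph $\hat{\mathcal G}_n(H)$. Vertices of $\mathcal G_n$ have weight $1$, all others weight $\lambda$. **Proposition.** Let $n\ge1$, let $H$ be as above, let $\lambda>0$, $d=2n-1$ and $X=\mathrm{Cl}(\hat{\mathcal G}_n(H))$. Let $X^0=\mathrm{Cl}(\mathcal G_{\rm disj})$. For $g=1,\dots,t$ in turn, with $m=m_g$, add the following sets one after the other, each joined with $\mathrm{Cl}_{2n-2m-1}$ of the disjoint qubit graph on the blocks outside $I_g$: * if $h_g$ projects onto $|x\rangle-|y\rangle$: for $k=1,\dots,2m$ the union of the $k$-th layers of $K^x\to K'^x$ and $K^y\to K'^y$; for $k=2m-1,\dots,2$ the union of the $k$-th layers of $K''\to K'^x$ and $K''\to K'^y$; then the first layer of $K''\to K'^x$; then the first layer of $K''\to K'^y$; then the maximal simplices of $K''$; * if $h_g$ projects onto $|x\rangle$: for $k=1,\dots,2m$ the $k$-th layer of $K^x\to K'^x$, for $k=2m$ together with the simplices $\{v^c\}\cup(\kappa\setminus\{u\})$, $\kappa$ a maximal simplex of $K'^x$ and $u\in\kappa$. Let $X^s$ be the complex obtained from $X^0$ by adding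 the first $s$ sets and all their nonempty subsets, and let $N$ be the total number of sets. Then $N\le 5nt$, and there is an orientation of the $(2n-1)$-simplices of $X$ which makes $X^0\subseteq\cdots\subseteq X^N\subseteq X$ a uniform oriented $(2n-1)$-filtration and which on $\mathrm{Cl}_{2n-1}(\mathcal G_n)$ is $(-1)^{\sum_i v_i}[v_1\cdots v_{2n}]$ for $v_1<\cdots<v_{2n}$ (the vertices ordered by block, then by $a$, then by the labels $1,\dots,4$; $\sum_i v_i$ is the sum of the labels). Moreover $\hat X^0_d=X^0_d$, and for $s\ge1$ the set $\tilde X^s_d$ is exactly the $s$-th added set, and $\hat X^s_d$ is the set of its members that come from the principal parts (respectively from the maximal simplices of $K''$). Likewise, for every $P\ge1$ the unweighted thickening $L$ of $K=\{1,2\}*\cdots*\{2P-1,2P\}$ has, for $d=P-1$, a uniform oriented $d$-filtration of length $P$. It starts from the unprimed copy of $K$, oriented by $(-1)^{\sum_i v_i}[v_1\cdots v_P]$ for $v_1<\cdots<v_P$, and adds $L^1,\dots,L^P$ (with all their nonempty subsets) in turn. Here $\hat X^0_d=X^0_d$, $\tilde X^k_d=L^k$ and $\hat X^k_d=\hat L^k$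 for $1\le k\le P$. -/

import Mathlib

open Finset

noncomputable section

/-! ### Orientable filtrations of simplicial complexes -/

/-- The `d`-simplices of `K`: its faces with `d + 1` vertices. -/
def simplicesOfDim {V : Type*} (K : PreAbstractSimplicialComplex V) (d : ℕ) : Set (Finset V) :=
  {σ | σ ∈ K ∧ σ.card = d + 1}

/-- The `d`-simplices added at step `i` of the filtration `F 0 ⊆ F 1 ⊆ …`. -/
def addedSimplices {V : Type*} (F : ℕ → PreAbstractSimplicialComplex V) (d : ℕ) :
    ℕ → Set (Finset V)
  | 0 => simplicesOfDim (F 0) d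
  | i + 1 => simplicesOfDim (F (i + 1)) d \ simplicesOfDim (F i) d

/-- `σ` is internal in the set `S` of `d`-simplices of `X`: among the `(d+1)`-simplices of `X` that
contain `σ` there are two distinct ones that are cofaces of two distinct further members
`σ'`, `σ''` of `S`, respectively. -/
def IsInternalSimplex {V : Type*} (X : PreAbstractSimplicialComplex V) (d : ℕ)
    (S : Set (Finset V)) (σ : Finset V) : Prop :=
  ∃ σ' ∈ S, ∃ σ'' ∈ S, σ' ≠ σ ∧ σ'' ≠ σ ∧ σ' ≠ σ'' ∧
    ∃ τ' ∈ simplicesOfDim X (d + 1), ∃ τ'' ∈ simplicesOfDim X (d + 1), τ' ≠ τ'' ∧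
      σ ⊆ τ' ∧ σ ⊆ τ'' ∧ σ' ⊆ τ' ∧ σ'' ⊆ τ''

/-- The essential `d`-simplices of step `i`: those added at step `i` that are not internal. -/
def essentialSimplices {V : Type*} (X : PreAbstractSimplicialComplex V)
    (F : ℕ → PreAbstractSimplicialComplex V) (d i : ℕ) : Set (Finset V) :=
  {σ | σ ∈ addedSimplices F d i ∧ ¬ IsInternalSimplex X d (addedSimplices F d i) σ}

/-- An orientation of simplices is recorded by signs `o`: the simplex `σ = {v₀ < v₁ < ⋯}` carries
the orientation `o σ • [v₀ v₁ ⋯]`. This is the sign of the orientation that `σ` induces on its face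
`σ \ {v}`. -/
def inducedOnFace {V : Type*} [LinearOrder V] (o : Finset V → ℤˣ) (σ : Finset V) (v : V) : ℤˣ :=
  (-1) ^ (σ.filter (fun u => u < v)).card * o σ

/-- The sign of the orientation of `τ` that induces the given orientation on the face `τ \ {v}`,
i.e. the orientation that the face `τ \ {v}` induces on its coface `τ`. -/
def inducedOnCoface {V : Type*} [LinearOrder V] (o : Finset V → ℤˣ) (τ : Finset V) (v : V) : ℤˣ :=
  (-1) ^ (τ.filter (fun u => u < v)).card * o (τ.erase v)

/-- Every `d`-face of `τ` that belongs to the filtration at all (the last stage `F N` may be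
smaller than `X`) was added at step `i` or at step `j`. -/
def FacesSplit {V : Type*} [DecidableEq V] (F : ℕ → PreAbstractSimplicialComplex V)
    (d N i j : ℕ) (τ : Finset V) : Prop :=
  ∀ u ∈ τ, τ.erase u ∈ simplicesOfDim (F N) d →
    τ.erase u ∈ addedSimplices F d i ∪ addedSimplices F d j

/-- The filtration `F 0 ⊆ ⋯ ⊆ F N ⊆ X` and the orientation `o` of the `d`-simplices form an
oriented `d`-filtration of `X`. -/
structure IsOrientedFiltration {V : Type*} [LinearOrder V] (X : PreAbstractSimplicialComplex V)
    (d N : ℕ) (F : ℕ → PreAbstractSimplicialComplex V) (o : Finset V → ℤˣ) : Prop where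
  mono : ∀ i < N, F i ≤ F (i + 1)
  le_complex : F N ≤ X
  down : ∀ i ≤ N, ∀ σ ∈ essentialSimplices X F d i, ∀ σ' ∈ essentialSimplices X F d i, σ ≠ σ' →
    ∀ v ∈ σ, ∀ v' ∈ σ', σ.erase v = σ'.erase v' →
      inducedOnFace o σ v = - inducedOnFace o σ' v'
  up : ∀ i ≤ N, ∀ j ≤ N, i ≠ j → ∀ τ ∈ simplicesOfDim X (d + 1), ∀ v ∈ τ, ∀ v' ∈ τ,
    τ.erase v ∈ essentialSimplices X F d i → τ.erase v' ∈ essentialSimplices X F d j →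
      inducedOnCoface o τ v = - inducedOnCoface o τ v' ∧ FacesSplit F d N i j τ

/-- The `(d+1)`-simplices of `X` whose faces are split between the steps `i` and `j`. -/
def connectingSimplices {V : Type*} [DecidableEq V] (X : PreAbstractSimplicialComplex V)
    (F : ℕ → PreAbstractSimplicialComplex V) (d N i j : ℕ) : Set (Finset V) :=
  {τ | τ ∈ simplicesOfDim X (d + 1) ∧ FacesSplit F d N i j τ ∧
    (∃ u ∈ τ, τ.erase u ∈ addedSimplices F d i) ∧ (∃ u ∈ τ, τ.erase u ∈ addedSimplices F d j)}

/-- A uniform oriented `d`-filtration of the complex `X` with vertex weights `w`; the weight of a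
simplex is the product of the weights of its vertices. -/
structure IsUniformOrientedFiltration {V : Type*} [LinearOrder V]
    (X : PreAbstractSimplicialComplex V) (w : V → ℝ) (d N : ℕ)
    (F : ℕ → PreAbstractSimplicialComplex V) (o : Finset V → ℤˣ) : Prop
    extends IsOrientedFiltration X d N F o where
  weight : ∀ i ≤ N, ∃ W : ℝ, ∀ σ ∈ addedSimplices F d i, ∏ v ∈ σ, w v = W
  degree : ∀ i ≤ N, ∀ j ≤ N, ∃ f : ℕ, ∀ τ ∈ connectingSimplices X F d N i j,
    {σ | σ ∈ essentialSimplices X F d i ∧ ∃ u ∈ τ, σ = τ.erase u}.ncard = f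

/-! ### Complexes -/

/-- The clique complex of the part of the graph `G` that is induced on `W`. -/
def cliqueComplexOn {V : Type*} (G : SimpleGraph V) (W : Set V) :
    PreAbstractSimplicialComplex V where
  faces := {s | s.Nonempty ∧ (s : Set V) ⊆ W ∧ G.IsClique (s : Set V)}
  isRelLowerSet_faces := fun _ hs =>
    ⟨hs.1, fun _ hts ht => ⟨ht, (Finset.coe_subset.2 hts).trans hs.2.1,
      hs.2.2.subset (Finset.coe_subset.2 hts)⟩⟩

/-- The clique complex of a graph. -/
def cliqueComplex {V : Type*} (G : SimpleGraph V) : PreAbstractSimplicialComplex V :=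
  cliqueComplexOn G Set.univ

/-- The complex of all nonempty subsets of members of `S`. -/
def generatedComplex {V : Type*} (S : Set (Finset V)) : PreAbstractSimplicialComplex V where
  faces := {s | s.Nonempty ∧ ∃ τ ∈ S, s ⊆ τ}
  isRelLowerSet_faces := fun _ hs =>
    ⟨hs.1, fun _ hts ht => ⟨ht, hs.2.imp fun _ h => ⟨h.1, hts.trans h.2⟩⟩⟩

/-- The top-dimensional simplices that are added in one step, together with the distinguished ones
among them (one vertex per position, no doubled position). -/
structure Layer (V : Type*) where
  simplices : Set (Finset V)
  principal : Set (Finset V)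

/-- Union of two layers. -/
def Layer.union {V : Type*} (A B : Layer V) : Layer V :=
  ⟨A.simplices ∪ B.simplices, A.principal ∪ B.principal⟩

/-- Join of a layer with a set of simplices on other vertices. -/
def Layer.join {V : Type*} [DecidableEq V] (A : Layer V) (R : Set (Finset V)) : Layer V :=
  ⟨{σ | ∃ α ∈ A.simplices, ∃ ρ ∈ R, σ = α ∪ ρ}, {σ | ∃ α ∈ A.principal, ∃ ρ ∈ R, σ = α ∪ ρ}⟩

/-- The filtration that starts from `K` and at step `s` adds the `s`-th layer of the list. -/
def layerFiltration {V : Type*} (K : PreAbstractSimplicialComplex V) (Ls : List (Layer V))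
    (s : ℕ) : PreAbstractSimplicialComplex V :=
  K ⊔ generatedComplex {τ | ∃ A ∈ Ls.take s, τ ∈ A.simplices}

/-! ### Layers of the thickening of a generalized octahedron

The generalized octahedron on a finite linearly ordered set `ι` of positions has the two vertices
`(p, false)`, `(p, true)` at every position `p`, and its simplices have at most one vertex at each
position. Below, `lo p b` and `hi p b` are the vertices of the lower (unprimed) and of the upper
(primed) copy of it in the thickening. -/

/-- The number of positions before `p`. -/
def posRank {ι : Type*} [Fintype ι] [LinearOrder ι] (p : ι) : ℕ :=
  (Finset.univ.filter (fun q => q < p)).card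

/-- A top-dimensional simplex of the `k`-th slab: with `P` positions, the first `P - k` of them
carry a lower vertex, the last `k - 1` an upper vertex, and the one in between carries both copies
of the same vertex; `f` selects the vertices. -/
def slabSimplex {V ι : Type*} [DecidableEq V] [Fintype ι] [LinearOrder ι] (lo hi : ι → Bool → V)
    (k : ℕ) (f : ι → Bool) : Finset V :=
  (Finset.univ.filter (fun p => posRank p + k ≤ Fintype.card ι)).image (fun p => lo p (f p)) ∪
  (Finset.univ.filter (fun p => Fintype.card ι ≤ posRank p + k)).image (fun p => hi p (f p))

/-- The `k`-th layer: simplices obtained by removing one lower vertex from a simplex of the `k`-th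
slab. Principal are those where the lower vertex of the doubled position was removed. -/
def thickLayer {V ι : Type*} [DecidableEq V] [Fintype ι] [LinearOrder ι] (lo hi : ι → Bool → V)
    (k : ℕ) : Layer V :=
  ⟨{σ | ∃ (f : ι → Bool) (p : ι), posRank p + k ≤ Fintype.card ι ∧
      σ = (slabSimplex lo hi k f).erase (lo p (f p))},
   {σ | ∃ (f : ι → Bool) (p : ι), posRank p + k = Fintype.card ι ∧
      σ = (slabSimplex lo hi k f).erase (lo p (f p))}⟩

/-- The top-dimensional simplices of one copy of the generalized octahedron. -/
def octahedronLayer {V ι : Type*} [DecidableEq V] [Fintype ι] (c : ι → Bool → V) : Layer V :=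
  ⟨{σ | ∃ f : ι → Bool, σ = Finset.univ.image (fun p => c p (f p))},
   {σ | ∃ f : ι → Bool, σ = Finset.univ.image (fun p => c p (f p))}⟩

/-- The simplices that contain the apex `a` and, at all positions except one, a vertex of the given
copy of the generalized octahedron. None of them is principal. -/
def coneLayer {V ι : Type*} [DecidableEq V] [Fintype ι] (c : ι → Bool → V) (a : V) : Layer V :=
  ⟨{σ | ∃ (f : ι → Bool) (p : ι),
      σ = insert a ((Finset.univ.image (fun q => c q (f q))).erase (c p (f p)))}, ∅⟩

/-! ### A single gluing -/

/-- The generalized octahedron `{1,2} * {3,4} * ⋯ * {2p-1,2p}`; the vertex `(i, b)` has the label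
`2i + 1` (for `b = false`) or `2i + 2` (for `b = true`), where `i = 0, …, p - 1`. -/
def octahedron (p : ℕ) : PreAbstractSimplicialComplex (Fin p ×ₗ Bool) where
  faces := {s | s.Nonempty ∧ ∀ u ∈ s, ∀ v ∈ s, (ofLex u).1 = (ofLex v).1 → u = v}
  isRelLowerSet_faces := fun _ hs =>
    ⟨hs.1, fun _ hts ht => ⟨ht, fun u hu v hv => hs.2 u (hts hu) v (hts hv)⟩⟩

/-- The thickening of a complex with ordered vertices: vertices `(u, false)` and `(u, true)`, and
simplices `[(u₁,0)…(u_a,0)(v₁,1)…(v_b,1)]` with `u₁ < ⋯ < u_a ≤ v₁ < ⋯ < v_b` and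
`{u₁,…,u_a,v₁,…,v_b}` a simplex of `K`. -/
def thickening {W : Type*} [LinearOrder W] (K : PreAbstractSimplicialComplex W) :
    PreAbstractSimplicialComplex (W ×ₗ Bool) where
  faces := {s | s.image (fun z => (ofLex z).1) ∈ K ∧
    ∀ u v : W, toLex (u, false) ∈ s → toLex (v, true) ∈ s → u ≤ v}
  isRelLowerSet_faces := fun _ hs =>
    ⟨Finset.image_nonempty.1 (K.isRelLowerSet_faces hs.1).1, fun _ hts ht =>
      ⟨(K.isRelLowerSet_faces hs.1).2 (Finset.image_subset_image hts)
        (Finset.image_nonempty.2 ht), fun u v hu hv => hs.2 u v (hts hu) (hts hv)⟩⟩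

/-- The copy `c` (`false`: unprimed, `true`: primed) of the octahedron in its thickening. -/
def octahedronCopy (p : ℕ) (c : Bool) (i : Fin p) (b : Bool) : (Fin p ×ₗ Bool) ×ₗ Bool :=
  toLex (toLex (i, b), c)

/-- The layers `1, …, p` of the thickening. -/
def gluingLayers (p : ℕ) : List (Layer ((Fin p ×ₗ Bool) ×ₗ Bool)) :=
  (List.range' 1 p).map
    (fun k => thickLayer (octahedronCopy p false) (octahedronCopy p true) k)

/-- The filtration of the thickening, starting from the unprimed octahedron. -/
def gluingFiltration (p : ℕ) (s : ℕ) :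
    PreAbstractSimplicialComplex ((Fin p ×ₗ Bool) ×ₗ Bool) :=
  layerFiltration ((octahedron p).map (fun u => toLex (u, false))) (gluingLayers p) s

/-- The label of a vertex of the thickening, without the prime. -/
def octahedronLabel {p : ℕ} (z : (Fin p ×ₗ Bool) ×ₗ Bool) : ℕ :=
  2 * ((ofLex (ofLex z).1).1 : ℕ) + 1 + (if (ofLex (ofLex z).1).2 then 1 else 0)

/-! ### Hamiltonian terms and the gadget graph -/

/-- A term of the Hamiltonian on `n` qubits, acting on a nonempty set `I` of qubits: the projector
onto the basis state `|x⟩` of these qubits (`fill`), or onto `|x⟩ - |y⟩`, up to normalization, for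
two different basis states of these qubits (`glue`). Only the bits of `x`, `y` on `I` matter. -/
inductive Term (n : ℕ) : Type
  | fill (I : Finset (Fin n)) (hI : I.Nonempty) (x : Fin n → Bool) : Term n
  | glue (I : Finset (Fin n)) (x y : Fin n → Bool) (hxy : ∃ i ∈ I, x i ≠ y i) : Term n

/-- The qubits on which a term acts. -/
def Term.supp {n : ℕ} : Term n → Finset (Fin n)
  | .fill I _ _ => I
  | .glue I _ _ _ => I

/-- The bit string `x`. -/
def Term.x {n : ℕ} : Term n → Fin n → Bool
  | .fill _ _ x => x
  | .glue _ x _ _ => x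

/-- The bit string `y` (equal to `x` for a term `fill`, where it is not used). -/
def Term.y {n : ℕ} : Term n → Fin n → Bool
  | .fill _ _ x => x
  | .glue _ _ y _ => y

/-- Is the term a projector onto `|x⟩ - |y⟩`? -/
def Term.IsGlue {n : ℕ} : Term n → Prop
  | .fill _ _ _ => False
  | .glue _ _ _ _ => True

/-- Vertices of the gadget graph of `H = ∑ g, H g`. The labels `1, 2, 3, 4` are represented by
`l = 0, 1, 2, 3`. -/
inductive Vertex {n t : ℕ} (H : Fin t → Term n) : Type
  /-- the vertex `lᵢᵃ` of the qubit graph -/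
  | qubit (i : Fin n) (a : Bool) (l : Fin 4) : Vertex H
  /-- the vertex `lᵢ''` of the middle octahedron `K''` of the term `g` -/
  | mid (g : Fin t) (hg : (H g).IsGlue) (i : (H g).supp) (l : Fin 4) : Vertex H
  /-- the vertex `lᵢ'ˣ` of the copy `K'ˣ` for the term `g` -/
  | copyX (g : Fin t) (i : (H g).supp) (l : Fin 4) : Vertex H
  /-- the vertex `lᵢ'ʸ` of the copy `K'ʸ` for the term `g` -/
  | copyY (g : Fin t) (hg : (H g).IsGlue) (i : (H g).supp) (l : Fin 4) : Vertex H
  /-- the central vertex `4ᵢᶜ` of block `i` of a gluing gadget -/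
  | axis (g : Fin t) (hg : (H g).IsGlue) (i : (H g).supp) : Vertex H
  /-- the central vertex of a filling gadget -/
  | apex (g : Fin t) (hg : ¬ (H g).IsGlue) : Vertex H

/-- Sorting key of the vertices: block, kind of vertex, label, term. -/
def Vertex.key {n t : ℕ} {H : Fin t → Term n} : Vertex H → ℕ ×ₗ ℕ ×ₗ ℕ ×ₗ ℕ
  | .qubit i a l => toLex ((i : ℕ), toLex (if a then 1 else 0, toLex ((l : ℕ), 0)))
  | .mid g _ i l => toLex (((i : Fin n) : ℕ), toLex (2, toLex ((l : ℕ), (g : ℕ))))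
  | .copyX g i l => toLex (((i : Fin n) : ℕ), toLex (3, toLex ((l : ℕ), (g : ℕ))))
  | .copyY g _ i l => toLex (((i : Fin n) : ℕ), toLex (4, toLex ((l : ℕ), (g : ℕ))))
  | .axis g _ i => toLex (((i : Fin n) : ℕ), toLex (5, toLex (0, (g : ℕ))))
  | .apex g _ => toLex (n, toLex (6, toLex (0, (g : ℕ))))

theorem Vertex.key_injective {n t : ℕ} {H : Fin t → Term n} :
    Function.Injective (Vertex.key (H := H)) := by
  intro u v h
  cases u <;> cases v <;>
    simp only [Vertex.key, toLex_inj, Prod.mk.injEq, Fin.val_inj] at h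
  case qubit.qubit i a l j b l' =>
    obtain ⟨rfl, h1, rfl, -⟩ := h
    cases a <;> cases b <;> simp_all
  case mid.mid g _ i l g' _ i' l' =>
    obtain ⟨h1, -, rfl, rfl⟩ := h
    obtain rfl := Subtype.ext h1
    rfl
  case copyX.copyX g i l g' i' l' =>
    obtain ⟨h1, -, rfl, rfl⟩ := h
    obtain rfl := Subtype.ext h1
    rfl
  case copyY.copyY g _ i l g' _ i' l' =>
    obtain ⟨h1, -, rfl, rfl⟩ := h
    obtain rfl := Subtype.ext h1
    rfl
  case axis.axis g _ i g' _ i' =>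
    obtain ⟨h1, -, -, rfl⟩ := h
    obtain rfl := Subtype.ext h1
    rfl
  case apex.apex g _ g' _ =>
    obtain ⟨-, -, -, rfl⟩ := h
    rfl
  all_goals exfalso; grind

/-- The vertices are ordered by their keys; on the qubit graph this is
`1₁⁰ < 2₁⁰ < 3₁⁰ < 4₁⁰ < 1₁¹ < 2₁¹ < 3₁¹ < 4₁¹ < 1₂⁰ < ⋯`. -/
instance instLinearOrderVertex {n t : ℕ} (H : Fin t → Term n) : LinearOrder (Vertex H) :=
  LinearOrder.lift' Vertex.key Vertex.key_injective

/-- The edges `13`, `14`, `23`, `24` of the square (`l = 0, 1, 2, 3` stands for `1, 2, 3, 4`). -/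
def squareAdj (l l' : Fin 4) : Prop := ¬ (l < 2 ↔ l' < 2)

/-- Edges of a generalized octahedron with the vertices `lᵢ`, given as pairs `(i, l)`. -/
def octAdj {n : ℕ} (u v : Fin n × Fin 4) : Prop := u.1 ≠ v.1 ∨ squareAdj u.2 v.2

/-- Edges between the vertex `u` of the lower and the vertex `v` of the upper octahedron in the
thickening: `u = v`, or `uv` is an edge and `u < v`. -/
def thickAdj {n : ℕ} (u v : Fin n × Fin 4) : Prop :=
  u = v ∨ (octAdj u v ∧ toLex u < toLex v)

/-- Edges of the qubit graph with the edges `4ᵢ⁰4ᵢ¹` removed. -/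
def disjRel {n t : ℕ} {H : Fin t → Term n} : Vertex H → Vertex H → Prop
  | .qubit i a l, .qubit j b l' => i ≠ j ∨ (a = b ∧ squareAdj l l')
  | _, _ => False

/-- Edges of the gadget graph, each in one direction at least. -/
def gadgetRel {n t : ℕ} {H : Fin t → Term n} : Vertex H → Vertex H → Prop
  -- the qubit graph
  | .qubit i a l, .qubit j b l' =>
      i ≠ j ∨ (a = b ∧ squareAdj l l') ∨ (a ≠ b ∧ l = 3 ∧ l' = 3)
  -- the copies, glued to the octahedra in the qubit graph and joined with the other blocks
  | .qubit j a l, .copyX g i l' =>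
      j ∈ (H g).supp → (a = (H g).x j ∧ thickAdj (j, l) ((i : Fin n), l'))
  | .qubit j a l, .copyY g _ i l' =>
      j ∈ (H g).supp → (a = (H g).y j ∧ thickAdj (j, l) ((i : Fin n), l'))
  | .qubit j _ _, .mid g _ _ _ => j ∉ (H g).supp
  -- the three octahedra of one gadget
  | .copyX g i l, .copyX g' i' l' => g = g' ∧ octAdj ((i : Fin n), l) ((i' : Fin n), l')
  | .copyY g _ i l, .copyY g' _ i' l' => g = g' ∧ octAdj ((i : Fin n), l) ((i' : Fin n), l')
  | .mid g _ i l, .mid g' _ i' l' => g = g' ∧ octAdj ((i : Fin n), l) ((i' : Fin n), l')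
  -- the middle octahedron, glued to the two copies
  | .mid g _ i l, .copyX g' i' l' => g = g' ∧ thickAdj ((i : Fin n), l) ((i' : Fin n), l')
  | .mid g _ i l, .copyY g' _ i' l' => g = g' ∧ thickAdj ((i : Fin n), l) ((i' : Fin n), l')
  -- a vertex `4ᵢᶜ`: inside the block `i` it sees the five vertices with label `4` of the gadget;
  -- outside the block it sees whatever one of these sees, that is every vertex
  | .qubit j a l, .axis g _ i =>
      j ≠ (i : Fin n) ∨ (l = 3 ∧ (a = (H g).x j ∨ a = (H g).y j))
  | .copyX g i' l, .axis g' _ i => g = g' ∧ ((i' : Fin n) ≠ (i : Fin n) ∨ l = 3)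
  | .copyY g _ i' l, .axis g' _ i => g = g' ∧ ((i' : Fin n) ≠ (i : Fin n) ∨ l = 3)
  | .mid g _ i' l, .axis g' _ i => g = g' ∧ ((i' : Fin n) ≠ (i : Fin n) ∨ l = 3)
  | .axis g _ i', .axis g' _ i => g = g' ∧ (i' : Fin n) ≠ (i : Fin n)
  -- the central vertex of a filling gadget
  | .qubit j _ _, .apex g _ => j ∉ (H g).supp
  | .copyX g _ _, .apex g' _ => g = g'
  | _, _ => False

/-- The vertices of the qubit graph. -/
def qubitVertices {n t : ℕ} (H : Fin t → Term n) : Set (Vertex H) :=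
  {v | ∃ i a l, v = .qubit i a l}

/-- The qubit graph without the edges `4ᵢ⁰4ᵢ¹` (gadget vertices are isolated). -/
def disjGraph {n t : ℕ} (H : Fin t → Term n) : SimpleGraph (Vertex H) :=
  SimpleGraph.fromRel disjRel

/-- The full gadget graph. -/
def gadgetGraph {n t : ℕ} (H : Fin t → Term n) : SimpleGraph (Vertex H) :=
  SimpleGraph.fromRel gadgetRel

/-- The clique complex of the disjoint qubit graph. -/
def disjComplex {n t : ℕ} (H : Fin t → Term n) : PreAbstractSimplicialComplex (Vertex H) :=
  cliqueComplexOn (disjGraph H) (qubitVertices H)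

/-- The clique complex of the qubit graph. -/
def qubitComplex {n t : ℕ} (H : Fin t → Term n) : PreAbstractSimplicialComplex (Vertex H) :=
  cliqueComplexOn (gadgetGraph H) (qubitVertices H)

/-- The clique complex of the full gadget graph. -/
def gadgetComplex {n t : ℕ} (H : Fin t → Term n) : PreAbstractSimplicialComplex (Vertex H) :=
  cliqueComplex (gadgetGraph H)

/-- Weight `1` on the vertices of the qubit graph and `lam` on all others. -/
def vertexWeight {n t : ℕ} {H : Fin t → Term n} (lam : ℝ) : Vertex H → ℝ
  | .qubit _ _ _ => 1
  | _ => lam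

/-- The label (`1`, `2`, `3` or `4`) of a vertex of the qubit graph. -/
def qubitLabel {n t : ℕ} {H : Fin t → Term n} : Vertex H → ℕ
  | .qubit _ _ l => (l : ℕ) + 1
  | _ => 0

/-! ### The filtration of the gadget complex -/

/-- The positions of the octahedra of the term `g`: for each block `i` on which it acts the
positions `{1ᵢ, 2ᵢ}` and `{3ᵢ, 4ᵢ}`, in this order. -/
abbrev GadgetPos {n t : ℕ} (H : Fin t → Term n) (g : Fin t) : Type := (H g).supp ×ₗ Bool

/-- The label in the position `{1, 2}` (`h = false`) or `{3, 4}` (`h = true`) selected by `b`. -/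
def posLabel (h b : Bool) : Fin 4 :=
  match h, b with
  | false, false => 0
  | false, true => 1
  | true, false => 2
  | true, true => 3

/-- The octahedron `Kˣ` in the qubit graph. -/
def octX {n t : ℕ} (H : Fin t → Term n) (g : Fin t) (p : GadgetPos H g) (b : Bool) : Vertex H :=
  .qubit (ofLex p).1 ((H g).x (ofLex p).1) (posLabel (ofLex p).2 b)

/-- The octahedron `Kʸ` in the qubit graph. -/
def octY {n t : ℕ} (H : Fin t → Term n) (g : Fin t) (p : GadgetPos H g) (b : Bool) : Vertex H :=
  .qubit (ofLex p).1 ((H g).y (ofLex p).1) (posLabel (ofLex p).2 b)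

/-- The octahedron `K'ˣ`. -/
def octCopyX {n t : ℕ} (H : Fin t → Term n) (g : Fin t) (p : GadgetPos H g) (b : Bool) :
    Vertex H :=
  .copyX g (ofLex p).1 (posLabel (ofLex p).2 b)

/-- The octahedron `K'ʸ`. -/
def octCopyY {n t : ℕ} (H : Fin t → Term n) (g : Fin t) (hg : (H g).IsGlue) (p : GadgetPos H g)
    (b : Bool) : Vertex H :=
  .copyY g hg (ofLex p).1 (posLabel (ofLex p).2 b)

/-- The octahedron `K''`. -/
def octMid {n t : ℕ} (H : Fin t → Term n) (g : Fin t) (hg : (H g).IsGlue) (p : GadgetPos H g)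
    (b : Bool) : Vertex H :=
  .mid g hg (ofLex p).1 (posLabel (ofLex p).2 b)

/-- The top-dimensional simplices of the clique complex of the disjoint qubit graph on the
`n - m` blocks outside `I`, `m = |I|`; they have `2 (n - m)` vertices (for `m = n` there is only
the empty one). -/
def restSimplices {n t : ℕ} (H : Fin t → Term n) (I : Finset (Fin n)) : Set (Finset (Vertex H)) :=
  {ρ | ρ.card = 2 * (n - I.card) ∧ (disjGraph H).IsClique (ρ : Set (Vertex H)) ∧
    ∀ v ∈ ρ, ∃ i ∉ I, ∃ a l, v = .qubit i a l}

open Classical in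
/-- The layers of the gadget of the term `g`, which acts on `m` qubits, in the order in which they
are added and before the join with the remaining blocks.

For `|x⟩ - |y⟩`: the layers `1, …, 2m` of the gluings `Kˣ → K'ˣ` and `Kʸ → K'ʸ`, in parallel; then
the layers `2m - 1, …, 2` of the gluings `K'' → K'ˣ` and `K'' → K'ʸ`, in parallel; then the first
layer of `K'' → K'ˣ`, the first layer of `K'' → K'ʸ`, and `K''`.

For `|x⟩`: the layers `1, …, 2m` of the gluing `Kˣ → K'ˣ`, where the last one comes with the
simplices that touch the central vertex. -/
def termLayers {n t : ℕ} (H : Fin t → Term n) (g : Fin t) : List (Layer (Vertex H)) :=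
  if hg : (H g).IsGlue then
    (List.range' 1 (2 * (H g).supp.card)).map
      (fun k => (thickLayer (octX H g) (octCopyX H g) k).union
        (thickLayer (octY H g) (octCopyY H g hg) k)) ++
    (List.range' 2 (2 * (H g).supp.card - 2)).reverse.map
      (fun k => (thickLayer (octMid H g hg) (octCopyX H g) k).union
        (thickLayer (octMid H g hg) (octCopyY H g hg) k)) ++
    [thickLayer (octMid H g hg) (octCopyX H g) 1,
     thickLayer (octMid H g hg) (octCopyY H g hg) 1,
     octahedronLayer (octMid H g hg)]
  else
    (List.range' 1 (2 * (H g).supp.card - 1)).map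
      (fun k => thickLayer (octX H g) (octCopyX H g) k) ++
    [(thickLayer (octX H g) (octCopyX H g) (2 * (H g).supp.card)).union
      (coneLayer (octCopyX H g) (.apex g hg))]

/-- The layers of all gadgets, one gadget after the other, joined with the disjoint qubit graph of
the remaining blocks. -/
def gadgetLayers {n t : ℕ} (H : Fin t → Term n) : List (Layer (Vertex H)) :=
  (List.finRange t).flatMap
    (fun g => (termLayers H g).map (fun A => A.join (restSimplices H (H g).supp)))

/-- The filtration of the gadget complex, starting from the disjoint qubit graph. -/
def gadgetFiltration {n t : ℕ} (H : Fin t → Term n) (s : ℕ) :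
    PreAbstractSimplicialComplex (Vertex H) :=
  layerFiltration (disjComplex H) (gadgetLayers H) s

end

/-!
The two parts of the theorem have one proof. All vertices but the central ones `4ᵢᶜ` and `vᶜ` are
distributed over linearly ordered positions (`1ᵢ, 2ᵢ` form one position of block `i`, `3ᵢ, 4ᵢ` the
next one), and each of them belongs to a copy of an octahedron, its *kind*; a copy has two vertices
at each of its positions. The orientation is `(-1)^(sum of the labels)` for all simplices, with
`lᵢ', lᵢ'', …` labelled like `lᵢ`. `PositionedGraph` records the properties of adjacency that
matter, above all these:

* adjacent vertices are ordered like their positions;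
* two adjacent vertices at the same position have the same label, and one of them is lower, the
  other one upper (primed);
* two vertices of the same kind at the same position have labels of different parity;
* a lower vertex adjacent to an upper one of the same gluing is not at a later position.

A *transversal* clique has exactly one vertex at each position, and a *slab* simplex is a clique
that has two vertices at exactly one position. These two have the same label and are neighbours in
the order of the slab simplex, so the two facets that miss one of them induce opposite orientations
on it (`IsSlab.inducedOnCoface_eq_neg`). Exchanging a vertex of a transversal clique with another
one of the same kind changes the parity of the label sum but not the place of the vertex, so the two
simplices induce opposite orientations on their common face (`IsLayering.inducedOnFace_eq_neg`).

`IsLayering` is the remaining combinatorial input: the layers are disjoint, their principal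
simplices are precisely the transversal cliques, an exchange stays within a layer exactly when it
preserves the kind, and every other member of a layer either misses a lower vertex of a slab simplex
or touches the central vertex of a filling gadget. From this follow:

* A member of a layer that misses a lower vertex `u` of a slab simplex `τ` is internal, because `τ`
  and the slab simplex with the other vertex of the kind and position of `u` are cofaces of it and
  have different principal facets in its layer (`IsLayering.isInternalSimplex`).
* A principal simplex is not internal: apart from a cone over it in a filling gadget, a coface
  leading to another member of its layer adds the lower partner of its first upper vertex, and only
  one vertex can be this partner (`IsLayering.not_isInternalSimplex`).
* A clique with one vertex more than there are positions that contains a member of a layer is a slab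
  simplex or contains a central vertex (`IsLayering.exists_isSlab`). So a coface connecting two
  layers is a slab simplex, whose two principal facets belong to these layers
  (`IsLayering.connecting`), and the numbers of essential facets are constant
  (`IsLayering.degree_self` is the case of a single layer).

`IsLayering.isUniformOrientedFiltration` draws the conclusion. It remains to see that the thickening
of an octahedron and the gadget complex are layered (`exists_orientation_gluing`,
`isLayering_gadget`). In both cases the principal simplices of the `k`-th layer of a gluing are
given by `mixSimplex`, with upper vertices at the last `k` positions. In the gadget complex, a
transversal clique that leaves the qubit graph meets the gadget of exactly one term, and there one
pair of octahedra glued to each other (`exists_gluingPair_of_isGood`). The edges `4ᵢ⁰4ᵢ¹` and the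
central vertices `4ᵢᶜ` do not interfere: a coface of a member of a layer contains no edge `4ᵢ⁰4ᵢ¹`
(`bit_eq_of_mem_coface`), and one with a vertex `4ᵢᶜ` has a single facet in the filtration
(`coface_of_axis_mem`). The layers are told apart by the numbers of their vertices in the gadget and
in the copies `K'ˣ`, `K'ʸ` (`pairwise_termLayers`).
-/

/-! ### Graphs with positions -/

/-- A graph whose vertices are distributed over linearly ordered positions, like the thickening of a
generalized octahedron. Only the *regular* vertices matter. Each of them belongs to a copy of the
octahedron, its `kind`, which is either an upper (primed) or a lower one; at each position a copy
has two vertices, with labels of different parity. For an upper vertex `b`, `dom b` is the set of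
the positions to which the octahedron of `b` extends. -/
structure PositionedGraph (V Pos κ : Type*) [LinearOrder V] [LinearOrder Pos] where
  reg : V → Prop
  adj : V → V → Prop
  pos : V → Pos
  kind : V → κ
  label : V → ℕ
  upper : V → Prop
  dom : V → Set Pos
  lt_of_pos_lt : ∀ {v w}, adj v w → pos v < pos w → v < w
  label_eq : ∀ {v w}, adj v w → pos v = pos w → v ≠ w → label v = label w
  upper_iff_not : ∀ {v w}, adj v w → pos v = pos w → v ≠ w → (upper v ↔ ¬ upper w)
  upper_congr : ∀ {v w}, kind v = kind w → (upper v ↔ upper w)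
  odd_label : ∀ {v w}, reg v → reg w → pos v = pos w → kind v = kind w → v ≠ w →
    Odd (label v + label w)
  pos_mem_dom : ∀ {b}, upper b → pos b ∈ dom b
  dom_eq : ∀ {b b'}, adj b b' → upper b → upper b' → dom b = dom b'
  pos_le : ∀ {a b}, adj a b → ¬ upper a → upper b → pos a ∈ dom b → pos a ≤ pos b
  kind_eq : ∀ {a b w w'}, ¬ upper a → upper b → ¬ upper w → ¬ upper w' → pos w = pos w' →
    pos a ∈ dom b → pos w ∈ dom b → adj w a → adj w' a → adj w b → adj w' b → kind w = kind w'

namespace PositionedGraph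

variable {V Pos κ : Type*} [LinearOrder V] [LinearOrder Pos] (M : PositionedGraph V Pos κ)

/-- A clique of regular vertices. -/
def IsGood (τ : Finset V) : Prop :=
  (∀ v ∈ τ, M.reg v) ∧ ∀ v ∈ τ, ∀ w ∈ τ, v ≠ w → M.adj v w

/-- A clique with exactly one vertex at each position. -/
structure IsTransversal [Fintype Pos] (σ : Finset V) : Prop where
  good : M.IsGood σ
  card : σ.card = Fintype.card Pos
  inj : Set.InjOn M.pos σ

/-- A simplex of a slab: a clique that has exactly one vertex at each position, except for one
position, where it has the two adjacent vertices `a` (lower) and `b` (upper). -/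
structure IsSlab [Fintype Pos] (τ : Finset V) (a b : V) : Prop where
  good : M.IsGood τ
  card : τ.card = Fintype.card Pos + 1
  left_mem : a ∈ τ
  right_mem : b ∈ τ
  pos_eq : M.pos a = M.pos b
  lower : ¬ M.upper a
  upper : M.upper b
  inj : Set.InjOn M.pos (τ.erase a)

/-- A non-principal member of a layer that has only regular vertices: it misses a lower vertex `u`
of a slab simplex at a position that is not doubled, and `u` can be exchanged with a vertex `u'`. -/
def IsLowerFace [Fintype Pos] (A : Layer V) (σ : Finset V) : Prop :=
  ∃ τ a b u u', M.IsSlab τ a b ∧ τ.erase a ∈ A.principal ∧ u ∈ τ ∧ u ≠ a ∧ ¬ M.upper u ∧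
    M.pos u ∈ M.dom b ∧ σ = τ.erase u ∧
    u' ∉ τ ∧ M.IsGood (insert u' (τ.erase u)) ∧ M.pos u' = M.pos u ∧ M.kind u' = M.kind u

/-- `c` is an irregular vertex of a simplex of the layer `A`. -/
def IsCap (A : Layer V) (c : V) : Prop :=
  ¬ M.reg c ∧ ∃ σ ∈ A.simplices, c ∈ σ

/-- The properties of a list of layers that make it a uniform oriented filtration of `X`: the
principal simplices of all layers are the cliques with one vertex at each position, and exchanging
a vertex of such a clique with another one at the same position stays within the layer if and only
if it preserves the kind. -/
structure IsLayering [Fintype Pos] (X : PreAbstractSimplicialComplex V)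
    (Lay : List (Layer V)) : Prop where
  good_mem : ∀ {τ}, τ.Nonempty → M.IsGood τ → τ ∈ X
  principal_subset : ∀ {A}, A ∈ Lay → A.principal ⊆ A.simplices
  card_eq : ∀ {A}, A ∈ Lay → ∀ {σ}, σ ∈ A.simplices → σ.card = Fintype.card Pos
  mem_complex : ∀ {A}, A ∈ Lay → ∀ {σ}, σ ∈ A.simplices → σ ∈ X
  disj : Lay.Pairwise (fun A B => Disjoint A.simplices B.simplices)
  transversal : ∀ {A}, A ∈ Lay → ∀ {σ}, σ ∈ A.principal → M.IsTransversal σ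
  exists_layer : ∀ {σ}, M.IsTransversal σ → ∃ A ∈ Lay, σ ∈ A.principal
  kind_of_exchange : ∀ {A}, A ∈ Lay → ∀ {σ σ' v v'}, σ ∈ A.principal → σ' ∈ A.principal →
    v ∈ σ → v' ∈ σ' → M.pos v = M.pos v' → σ.erase v = σ'.erase v' → M.kind v = M.kind v'
  exchange : ∀ {A}, A ∈ Lay → ∀ {σ σ' v v'}, σ ∈ A.principal → M.IsTransversal σ' →
    v ∈ σ → v' ∈ σ' → M.pos v = M.pos v' → σ.erase v = σ'.erase v' → M.kind v = M.kind v' →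
    σ' ∈ A.principal
  nonprincipal : ∀ {A}, A ∈ Lay → ∀ {σ}, σ ∈ A.simplices → σ ∉ A.principal →
    M.IsLowerFace A σ ∨ (¬ M.IsGood σ ∧ IsInternalSimplex X (Fintype.card Pos - 1) A.simplices σ)
  not_good_of_cap : ∀ {A}, A ∈ Lay → ∀ {c}, M.IsCap A c → ∀ {σ}, σ ∈ A.simplices →
    σ ∉ A.principal → ¬ M.IsGood σ
  cap_unique : ∀ {A}, A ∈ Lay → ∀ {c c'}, M.IsCap A c → M.IsCap A c' → c = c'
  coface_not_good : ∀ {τ}, τ ∈ X → τ.card = Fintype.card Pos + 1 → ¬ M.IsGood τ →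
    ∀ {A}, A ∈ Lay → ∀ {σ}, σ ∈ A.simplices → σ ⊆ τ →
    (σ ∉ A.principal ∧ (∀ c, ¬ M.IsCap A c) ∧
      ∀ A' ∈ Lay, ∀ σ' ∈ A'.simplices, σ' ⊆ τ → σ' = σ) ∨
    (∃ c ∈ τ, M.IsCap A c ∧ τ.erase c ∈ A.principal ∧
      ∀ A' ∈ Lay, ∀ σ' ∈ A'.simplices, σ' ⊆ τ → σ' ∈ A.simplices)

variable {M}

theorem IsGood.subset {σ τ : Finset V} (h : M.IsGood τ) (hs : σ ⊆ τ) : M.IsGood σ :=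
  ⟨fun v hv => h.1 v (hs hv), fun v hv w hw => h.2 v (hs hv) w (hs hw)⟩

/-- Adjacent vertices are ordered like their positions. -/
theorem IsGood.lt_iff {τ : Finset V} (h : M.IsGood τ) {v w : V} (hv : v ∈ τ) (hw : w ∈ τ)
    (hp : M.pos v ≠ M.pos w) : v < w ↔ M.pos v < M.pos w := by
  have hne : v ≠ w := fun e => hp (by rw [e])
  rcases lt_or_gt_of_ne hp with h1 | h1
  · exact ⟨fun _ => h1, fun _ => M.lt_of_pos_lt (h.2 v hv w hw hne) h1⟩
  · have := M.lt_of_pos_lt (h.2 w hw v hv hne.symm) h1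
    exact ⟨fun h2 => absurd h2 this.asymm, fun h2 => absurd h2 h1.asymm⟩

variable [Fintype Pos]

theorem IsTransversal.exists_pos {σ : Finset V} (h : M.IsTransversal σ) (p : Pos) :
    ∃ v ∈ σ, M.pos v = p := by
  classical
  have : σ.image M.pos = univ := by
    rw [← Finset.card_eq_iff_eq_univ, Finset.card_image_of_injOn h.inj, h.card]
  have hp : p ∈ σ.image M.pos := by rw [this]; exact mem_univ _
  simpa using hp

theorem IsSlab.ne {τ : Finset V} {a b : V} (h : M.IsSlab τ a b) : a ≠ b :=
  fun e => h.lower (e ▸ h.upper)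

theorem IsSlab.eq_or_of_pos_eq {τ : Finset V} {a b v w : V} (h : M.IsSlab τ a b) (hv : v ∈ τ)
    (hw : w ∈ τ) (hp : M.pos v = M.pos w) : v = w ∨ (v = a ∧ w = b) ∨ (v = b ∧ w = a) := by
  have key : ∀ x ∈ τ, x ≠ a → ∀ y ∈ τ, y ≠ a → M.pos x = M.pos y → x = y :=
    fun x hx hxa y hy hya e => h.inj (by simp [hx, hxa]) (by simp [hy, hya]) e
  have hb := h.right_mem
  have hne := h.ne.symm
  by_cases hva : v = a
  · by_cases hwa : w = a
    · left; rw [hva, hwa]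
    · right; left
      exact ⟨hva, key w hw hwa b hb hne (by rw [← hp, hva, h.pos_eq])⟩
  · by_cases hwa : w = a
    · right; right
      exact ⟨key v hv hva b hb hne (by rw [hp, hwa, h.pos_eq]), hwa⟩
    · left; exact key v hv hva w hw hwa hp

theorem IsSlab.transversal_left {τ : Finset V} {a b : V} (h : M.IsSlab τ a b) :
    M.IsTransversal (τ.erase a) :=
  ⟨h.good.subset (erase_subset _ _), by rw [card_erase_of_mem h.left_mem, h.card]; rfl, h.inj⟩

theorem IsSlab.transversal_right {τ : Finset V} {a b : V} (h : M.IsSlab τ a b) :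
    M.IsTransversal (τ.erase b) := by
  refine ⟨h.good.subset (erase_subset _ _), by rw [card_erase_of_mem h.right_mem, h.card]; rfl, ?_⟩
  intro v hv w hw e
  simp only [coe_erase, Set.mem_sdiff, mem_coe, Set.mem_singleton_iff] at hv hw
  rcases h.eq_or_of_pos_eq hv.1 hw.1 e with h1 | ⟨-, h1⟩ | ⟨h1, -⟩
  · exact h1
  · exact absurd h1 hw.2
  · exact absurd h1 hv.2

theorem IsSlab.exists_pos {τ : Finset V} {a b : V} (h : M.IsSlab τ a b) (p : Pos) :
    ∃ v ∈ τ, M.pos v = p := by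
  obtain ⟨v, hv, e⟩ := h.transversal_left.exists_pos p
  exact ⟨v, mem_of_mem_erase hv, e⟩

/-- Two adjacent vertices at the same position, one in a transversal clique, form a slab. -/
theorem exists_isSlab_of_transversal {σ τ : Finset V} (hτ : M.IsGood τ)
    (hc : τ.card = Fintype.card Pos + 1) (hσ : M.IsTransversal σ) (hs : σ ⊆ τ) :
    ∃ a b, M.IsSlab τ a b ∧ (σ = τ.erase a ∨ σ = τ.erase b) := by
  obtain ⟨w, hwσ, rfl⟩ : ∃ w ∉ σ, insert w σ = τ := by
    have : (τ \ σ).card = 1 := by rw [card_sdiff_of_subset hs, hc, hσ.card]; omega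
    obtain ⟨w, hw⟩ := card_eq_one.1 this
    have h1 : w ∈ τ \ σ := by rw [hw]; exact mem_singleton_self _
    refine ⟨w, (mem_sdiff.1 h1).2, ?_⟩
    rw [← sdiff_union_of_subset hs, hw]; rfl
  obtain ⟨v, hv, hp⟩ := hσ.exists_pos (M.pos w)
  have hne : v ≠ w := fun e => hwσ (e ▸ hv)
  have hadj := hτ.2 v (mem_insert_of_mem hv) w (mem_insert_self _ _) hne
  have hup := M.upper_iff_not hadj hp hne
  have e1 : (insert w σ).erase w = σ := erase_insert hwσ
  by_cases hu : M.upper w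
  · have hvu : ¬ M.upper v := fun h => hup.1 h hu
    refine ⟨v, w, ⟨hτ, hc, mem_insert_of_mem hv, mem_insert_self _ _, hp, hvu, hu, ?_⟩,
      Or.inr e1.symm⟩
    intro x hx y hy e
    simp only [coe_erase, coe_insert, Set.mem_sdiff, Set.mem_insert_iff, mem_coe,
      Set.mem_singleton_iff] at hx hy
    obtain ⟨rfl | hx, hx2⟩ := hx <;> obtain ⟨rfl | hy, hy2⟩ := hy
    · rfl
    · exact absurd (hσ.inj hy hv (by rw [← e, hp])) hy2
    · exact absurd (hσ.inj hx hv (by rw [e, hp])) hx2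
    · exact hσ.inj hx hy e
  · refine ⟨w, v, ⟨hτ, hc, mem_insert_self _ _, mem_insert_of_mem hv, hp.symm, hu, hup.2 hu, ?_⟩,
      Or.inl e1.symm⟩
    rw [e1]; exact hσ.inj

variable {X : PreAbstractSimplicialComplex V} {Lay : List (Layer V)}

/-! ### Cofaces of members of a layering -/

/-- A clique of regular vertices that contains a member of a layer as a facet is a slab simplex:
a second doubled position, or a third vertex at the doubled one, contradicts the way in which lower
and upper vertices are adjacent. -/
theorem IsLayering.exists_isSlab (L : M.IsLayering X Lay) {τ : Finset V} (hτ : M.IsGood τ)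
    (hc : τ.card = Fintype.card Pos + 1) {A : Layer V} (hA : A ∈ Lay) {σ : Finset V}
    (hσ : σ ∈ A.simplices) (hs : σ ⊆ τ) : ∃ a b, M.IsSlab τ a b := by
  by_cases hp : σ ∈ A.principal
  · obtain ⟨a, b, h, -⟩ := exists_isSlab_of_transversal hτ hc (L.transversal hA hp) hs
    exact ⟨a, b, h⟩
  rcases L.nonprincipal hA hσ hp with
    ⟨τ₀, a, b, u, -, h0, -, hu, hua, hul, hud, rfl, -⟩ | ⟨h, -⟩
  swap
  · exact absurd (hτ.subset hs) h
  have hub : u ≠ b := fun e => hul (e ▸ h0.upper)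
  obtain ⟨w, hwσ, rfl⟩ : ∃ w ∉ τ₀.erase u, insert w (τ₀.erase u) = τ := by
    have : (τ \ τ₀.erase u).card = 1 := by
      rw [card_sdiff_of_subset hs, hc, card_erase_of_mem hu, h0.card]; omega
    obtain ⟨w, hw⟩ := card_eq_one.1 this
    have h1 : w ∈ τ \ τ₀.erase u := by rw [hw]; exact mem_singleton_self _
    refine ⟨w, (mem_sdiff.1 h1).2, ?_⟩
    rw [← sdiff_union_of_subset hs, hw]; rfl
  have ha : a ∈ insert w (τ₀.erase u) := by simp [h0.left_mem, hua.symm]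
  have hb : b ∈ insert w (τ₀.erase u) := by simp [h0.right_mem, hub.symm]
  have hw : w ∈ insert w (τ₀.erase u) := mem_insert_self _ _
  have hwa : w ≠ a := by rintro rfl; exact hwσ (by simp [h0.left_mem, hua.symm])
  have hwb : w ≠ b := by rintro rfl; exact hwσ (by simp [h0.right_mem, hub.symm])
  have hpu : M.pos u ≠ M.pos a := by
    intro e
    rcases h0.eq_or_of_pos_eq hu h0.left_mem e with h | ⟨h, -⟩ | ⟨h, -⟩
    exacts [hua h, hua h, hub h]
  by_cases hwu : M.pos w = M.pos u
  · refine ⟨a, b, hτ, hc, ha, hb, h0.pos_eq, h0.lower, h0.upper, ?_⟩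
    have key : ∀ x ∈ τ₀.erase u, x ≠ a → M.pos x ≠ M.pos w := by
      intro x hx hxa e
      exact (mem_erase.1 hx).1 (h0.inj (by simp [(mem_erase.1 hx).2, hxa]) (by simp [hu, hua])
        (by rw [e, hwu]))
    intro x hx y hy e
    simp only [coe_erase, coe_insert, Set.mem_sdiff, Set.mem_insert_iff,
      Set.mem_singleton_iff] at hx hy
    obtain ⟨rfl | hx, hx2⟩ := hx <;> obtain ⟨rfl | hy, hy2⟩ := hy
    · rfl
    · exact absurd e.symm (key y (by simpa [and_comm] using hy) hy2)
    · exact absurd e (key x (by simpa [and_comm] using hx) hx2)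
    · exact h0.inj (by simp_all) (by simp_all) e
  exfalso
  by_cases hwpa : M.pos w = M.pos a
  · have h1 := M.upper_iff_not (hτ.2 w hw a ha hwa) hwpa hwa
    have h2 := M.upper_iff_not (hτ.2 w hw b hb hwb) (hwpa.trans h0.pos_eq) hwb
    exact h2.1 (h1.2 h0.lower) h0.upper
  obtain ⟨v, hv0, hvp⟩ := h0.exists_pos (M.pos w)
  have hvu : v ≠ u := by rintro rfl; exact hwu hvp.symm
  have hva : v ≠ a := by rintro rfl; exact hwpa hvp.symm
  have hvb : v ≠ b := by rintro rfl; exact hwpa (by rw [h0.pos_eq, hvp])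
  have hv : v ∈ insert w (τ₀.erase u) := by simp [hv0, hvu]
  have hvw : v ≠ w := by rintro rfl; exact hwσ (by simp [hv0, hvu])
  -- an upper vertex `s` and a lower vertex `z` at a second position
  have key : ∀ s ∈ insert w (τ₀.erase u), ∀ z ∈ insert w (τ₀.erase u), s ≠ a → s ≠ b → z ≠ b →
      M.pos s = M.pos z → M.pos s ≠ M.pos a → M.upper s → ¬ M.upper z → False := by
    intro s hs z hz hsa hsb hzb hp hpa hsu hzu
    have hd : M.dom s = M.dom b := M.dom_eq (hτ.2 s hs b hb hsb) hsu h0.upper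
    have h1 := M.pos_le (hτ.2 z hz b hb hzb) hzu h0.upper (by
      rw [← hp, ← hd]; exact M.pos_mem_dom hsu)
    have h2 := M.pos_le (hτ.2 a ha s hs hsa.symm) h0.lower hsu (by
      rw [hd, h0.pos_eq]; exact M.pos_mem_dom h0.upper)
    exact hpa (le_antisymm (by rw [hp, h0.pos_eq]; exact h1) h2)
  have hup := M.upper_iff_not (hτ.2 v hv w hw hvw) hvp hvw
  by_cases hwup : M.upper w
  · exact key w hw v hv hwa hwb hvb hvp.symm hwpa hwup (fun h => hup.1 h hwup)
  · exact key v hv w hw hva hvb hwb hvp (by rw [hvp]; exact hwpa) (hup.2 hwup) hwup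

/-- The facets of a slab simplex that belong to a layer: the two principal ones, and those that miss
a lower vertex, which belong to the layer of the upper principal facet. -/
theorem IsLayering.face_cases (L : M.IsLayering X Lay) {τ : Finset V} {a b : V}
    (h : M.IsSlab τ a b) {A : Layer V} (hA : A ∈ Lay) {σ : Finset V}
    (hσ : σ ∈ A.simplices) (hs : σ ⊆ τ) :
    (σ ∈ A.principal ∧ (σ = τ.erase a ∨ σ = τ.erase b)) ∨
    (σ ∉ A.principal ∧ τ.erase a ∈ A.principal ∧
      ∃ u ∈ τ, u ≠ a ∧ ¬ M.upper u ∧ M.pos u ∈ M.dom b ∧ σ = τ.erase u) := by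
  obtain ⟨w, hw, rfl⟩ : ∃ w ∈ τ, σ = τ.erase w := by
    have : (τ \ σ).card = 1 := by
      rw [card_sdiff_of_subset hs, h.card, L.card_eq hA hσ]; omega
    obtain ⟨w, hw⟩ := card_eq_one.1 this
    have h1 : w ∈ τ \ σ := by rw [hw]; exact mem_singleton_self _
    refine ⟨w, (mem_sdiff.1 h1).1, ?_⟩
    rw [erase_eq, ← hw, Finset.sdiff_sdiff_eq_self hs]
  by_cases hp : τ.erase w ∈ A.principal
  · left
    refine ⟨hp, ?_⟩
    have hinj := (L.transversal hA hp).inj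
    by_cases hwa : w = a
    · left; rw [hwa]
    by_cases hwb : w = b
    · right; rw [hwb]
    exact absurd (hinj (by simp [h.left_mem, Ne.symm hwa]) (by simp [h.right_mem, Ne.symm hwb])
      h.pos_eq) h.ne
  right
  refine ⟨hp, ?_⟩
  rcases L.nonprincipal hA hσ hp with
    ⟨τ₀, a₀, b₀, u, -, h0, hpa, hu, hua, hul, hud, he, -⟩ | ⟨h1, -⟩
  swap
  · exact absurd (h.good.subset hs) h1
  have hub : u ≠ b₀ := fun e => hul (e ▸ h0.upper)
  have ha0 : a₀ ∈ τ.erase w := by rw [he]; simp [h0.left_mem, hua.symm]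
  have hb0 : b₀ ∈ τ.erase w := by rw [he]; simp [h0.right_mem, hub.symm]
  have hab : a₀ = a ∧ b₀ = b := by
    rcases h.eq_or_of_pos_eq (mem_of_mem_erase ha0) (mem_of_mem_erase hb0) h0.pos_eq with
      e | e | ⟨e, -⟩
    · exact absurd e h0.ne
    · exact e
    · exact absurd (e ▸ h.upper) h0.lower
  obtain ⟨rfl, rfl⟩ := hab
  have hwa : w ≠ a₀ := fun e => (mem_erase.1 ha0).1 e.symm
  have hwb : w ≠ b₀ := fun e => (mem_erase.1 hb0).1 e.symm
  have hpu0 : M.pos u ≠ M.pos a₀ := by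
    intro e
    rcases h0.eq_or_of_pos_eq hu h0.left_mem e with h | ⟨h, -⟩ | ⟨h, -⟩
    exacts [hua h, hua h, hub h]
  have hpwu : M.pos w = M.pos u := by
    obtain ⟨x, hx, hxp⟩ := h.exists_pos (M.pos u)
    by_cases hxw : x = w
    · rw [← hxw, hxp]
    have hx0 : x ∈ τ₀.erase u := by rw [← he]; simp [hx, hxw]
    rcases h0.eq_or_of_pos_eq (mem_of_mem_erase hx0) hu hxp with e | ⟨-, e⟩ | ⟨-, e⟩
    exacts [absurd e (mem_erase.1 hx0).1, absurd e hub, absurd e hua]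
  have hadj : ∀ x ∈ τ, x ≠ w → M.adj w x := fun x hx hxw => h.good.2 w hw x hx hxw.symm
  have hwl : ¬ M.upper w := by
    intro hwu
    have hd : M.dom w = M.dom b₀ := M.dom_eq (hadj _ h.right_mem hwb.symm) hwu h0.upper
    have h1 := M.pos_le (h.good.2 _ h.left_mem w hw hwa.symm) h0.lower hwu (by
      rw [hd, h0.pos_eq]; exact M.pos_mem_dom h0.upper)
    have h2 := M.pos_le (h0.good.2 u hu b₀ h0.right_mem hub) hul h0.upper hud
    exact hpu0 (le_antisymm (by rw [h0.pos_eq]; exact h2) (by rw [← hpwu]; exact h1))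
  refine ⟨?_, w, hw, hwa, hwl, by rw [hpwu]; exact hud, rfl⟩
  have hkind : M.kind u = M.kind w :=
    M.kind_eq h0.lower h0.upper hul hwl hpwu.symm
      (by rw [h0.pos_eq]; exact M.pos_mem_dom h0.upper) hud
      (h0.good.2 u hu _ h0.left_mem hua) (hadj _ h.left_mem hwa.symm)
      (h0.good.2 u hu _ h0.right_mem hub) (hadj _ h.right_mem hwb.symm)
  refine L.exchange hA hpa h.transversal_left (v := u) (v' := w) (by simp [hu, hua])
    (by simp [hw, hwa]) hpwu.symm ?_ hkind
  rw [erase_right_comm, ← he, erase_right_comm]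

/-- The two principal facets of a slab simplex belong to different layers. -/
theorem IsLayering.not_mem_principal (L : M.IsLayering X Lay) {τ : Finset V} {a b : V}
    (h : M.IsSlab τ a b) {A : Layer V} (hA : A ∈ Lay) (ha : τ.erase a ∈ A.principal) :
    τ.erase b ∉ A.principal := by
  intro hb
  have hk := L.kind_of_exchange hA ha hb (v := b) (v' := a)
    (by simp [h.right_mem, h.ne.symm]) (by simp [h.left_mem, h.ne]) h.pos_eq.symm
    (erase_right_comm)
  exact h.lower ((M.upper_congr hk).1 h.upper)

theorem erase_eq_of_subset {σ τ : Finset V} {c : V} (hs : σ ⊆ τ) (hc : c ∉ σ)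
    (hcard : τ.card ≤ σ.card + 1) (hcτ : c ∈ τ) : σ = τ.erase c :=
  eq_of_subset_of_card_le (fun _ hx => mem_erase.2 ⟨fun e => hc (e ▸ hx), hs hx⟩)
    (by rw [card_erase_of_mem hcτ]; omega)

/-- A coface through which another member of the layer of a principal simplex is reached adds either
the cap of the layer, or the lower partner of the first upper vertex. -/
theorem IsLayering.coface_cases (L : M.IsLayering X Lay) {A : Layer V} (hA : A ∈ Lay)
    {σ σ' τ : Finset V} (hσ : σ ∈ A.principal) (hσ' : σ' ∈ A.simplices) (hne : σ' ≠ σ)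
    (hX : τ ∈ X) (hc : τ.card = Fintype.card Pos + 1) (hs : σ ⊆ τ) (hs' : σ' ⊆ τ) :
    (∃ c, M.IsCap A c ∧ τ = insert c σ) ∨
    (σ' ∉ A.principal ∧ M.IsGood σ' ∧ ∃ a b, ∃ u ∈ σ, M.IsSlab τ a b ∧ a ∉ σ ∧ τ = insert a σ ∧
      ¬ M.upper u) := by
  have hσS := L.principal_subset hA hσ
  by_cases hg : M.IsGood τ
  · right
    obtain ⟨a, b, h⟩ := L.exists_isSlab hg hc hA hσS hs
    have h1 : σ = τ.erase a ∨ σ = τ.erase b := by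
      rcases L.face_cases h hA hσS hs with ⟨-, h1⟩ | ⟨h1, -⟩
      exacts [h1, absurd hσ h1]
    have h2 : σ' ∉ A.principal := by
      intro hp
      rcases L.face_cases h hA hσ' hs' with ⟨-, h2⟩ | ⟨h2, -⟩
      · rcases h1 with rfl | rfl <;> rcases h2 with rfl | rfl
        exacts [hne rfl, L.not_mem_principal h hA hσ hp, L.not_mem_principal h hA hp hσ, hne rfl]
      · exact h2 hp
    rcases L.face_cases h hA hσ' hs' with ⟨h3, -⟩ | ⟨-, hp, u, hu, hua, hul, -, rfl⟩
    · exact absurd h3 h2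
    rcases h1 with rfl | rfl
    · exact ⟨h2, hg.subset hs', a, b, u, by simp [hu, hua], h, by simp,
        (insert_erase h.left_mem).symm, hul⟩
    · exact absurd hσ (L.not_mem_principal h hA hp)
  · left
    rcases L.coface_not_good hX hc hg hA hσS hs with ⟨h, -⟩ | ⟨c, hcτ, hcap, -, -⟩
    · exact absurd hσ h
    have hcσ : c ∉ σ := fun h => hcap.1 ((L.transversal hA hσ).good.1 c h)
    refine ⟨c, hcap, ?_⟩
    rw [erase_eq_of_subset hs hcσ (by rw [hc, L.card_eq hA hσS]) hcτ, insert_erase hcτ]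

/-- A principal simplex is not internal: only one coface leads to another member of its layer. Two
slab simplices that do so add two vertices `a`, `a'` next to the same upper vertex `b`. Their labels
are equal to that of `b`, while the presence of a third lower vertex forces them to have the same
kind, so `a = a'`. -/
theorem IsLayering.not_isInternalSimplex (L : M.IsLayering X Lay) {d : ℕ}
    (hd : Fintype.card Pos = d + 1) {A : Layer V} (hA : A ∈ Lay) {σ : Finset V}
    (hσ : σ ∈ A.principal) : ¬ IsInternalSimplex X d A.simplices σ := by
  rintro ⟨σ₁, h1, σ₂, h2, n1, n2, -, τ₁, ⟨x1, c1⟩, τ₂, ⟨x2, c2⟩, nτ, s1, s2, s1', s2'⟩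
  have k1 := L.coface_cases hA hσ h1 n1 x1 (by omega) s1 s1'
  have k2 := L.coface_cases hA hσ h2 n2 x2 (by omega) s2 s2'
  rcases k1 with ⟨c, hc, e1⟩ | ⟨p1, g1, a, b, u, hu, hs, haσ, e1, hul⟩ <;>
    rcases k2 with ⟨c', hc', e2⟩ | ⟨p2, g2, a', b', u', hu', hs', haσ', e2, hul'⟩
  · exact nτ (by rw [e1, e2, L.cap_unique hA hc hc'])
  · exact L.not_good_of_cap hA hc h2 p2 g2
  · exact L.not_good_of_cap hA hc' h1 p1 g1
  have hbσ : b ∈ σ := by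
    have := hs.right_mem
    rw [e1] at this
    exact (mem_insert.1 this).resolve_left hs.ne.symm
  have hbσ' : b' ∈ σ := by
    have := hs'.right_mem
    rw [e2] at this
    exact (mem_insert.1 this).resolve_left hs'.ne.symm
  have hdom : M.dom b = M.dom b' := by
    by_cases hbb : b = b'
    · rw [hbb]
    · exact M.dom_eq (hs.good.2 b hs.right_mem b' (s1 hbσ') hbb) hs.upper hs'.upper
  have hpa : M.pos a ∈ M.dom b := by rw [hs.pos_eq]; exact M.pos_mem_dom hs.upper
  have hpa' : M.pos a' ∈ M.dom b' := by rw [hs'.pos_eq]; exact M.pos_mem_dom hs'.upper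
  have hle : M.pos a ≤ M.pos b' := M.pos_le
    (hs.good.2 a hs.left_mem b' (s1 hbσ') (fun e => haσ (e ▸ hbσ'))) hs.lower hs'.upper
    (hdom ▸ hpa)
  have hle' : M.pos a' ≤ M.pos b := M.pos_le
    (hs'.good.2 a' hs'.left_mem b (s2 hbσ) (fun e => haσ' (e ▸ hbσ))) hs'.lower hs.upper
    (hdom ▸ hpa')
  have hp : M.pos a = M.pos a' :=
    le_antisymm (by rw [hs'.pos_eq]; exact hle) (by rw [hs.pos_eq]; exact hle')
  have hbb : b = b' := (L.transversal hA hσ).inj hbσ hbσ' (by rw [← hs.pos_eq, hp, hs'.pos_eq])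
  subst hbb
  apply nτ
  rw [e1, e2]
  congr 1
  by_contra hne
  have hab : M.adj a b := hs.good.2 a hs.left_mem b hs.right_mem hs.ne
  have hab' : M.adj a' b := hs'.good.2 a' hs'.left_mem b hs'.right_mem hs'.ne
  -- the simplex reached through `a` misses a lower vertex `v` of `σ`, which fixes the kind
  obtain ⟨v, hv, hva, hvl, hvd⟩ : ∃ v ∈ σ, v ≠ a ∧ ¬ M.upper v ∧ M.pos v ∈ M.dom b := by
    rcases L.face_cases hs hA h1 s1' with ⟨h3, -⟩ | ⟨-, -, v, hv, hva, hvl, hvd, -⟩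
    · exact absurd h3 p1
    · refine ⟨v, ?_, hva, hvl, hvd⟩
      rw [e1] at hv
      exact (mem_insert.1 hv).resolve_left hva
  have hk : M.kind a = M.kind a' := M.kind_eq hvl hs.upper hs.lower hs'.lower hp hvd hpa
    (hs.good.2 a hs.left_mem v (s1 hv) hva.symm)
    (hs'.good.2 a' hs'.left_mem v (s2 hv) (fun e => haσ' (e ▸ hv))) hab hab'
  have hodd := M.odd_label (hs.good.1 a hs.left_mem) (hs'.good.1 a' hs'.left_mem) hp hk hne
  rw [M.label_eq hab hs.pos_eq hs.ne, M.label_eq hab' hs'.pos_eq hs'.ne, ← two_mul] at hodd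
  exact absurd (even_two_mul _) (Nat.not_even_iff_odd.2 hodd)

/-- If `σ` misses the lower vertex `u` of a slab simplex `τ`, then `τ` and the slab simplex with
`u'` in place of `u` are cofaces of `σ`, and they have different principal facets in its layer. -/
theorem IsLayering.isInternalSimplex (L : M.IsLayering X Lay) {d : ℕ}
    (hd : Fintype.card Pos = d + 1) {A : Layer V} (hA : A ∈ Lay) {σ : Finset V}
    (hσ : σ ∈ A.simplices) (hp : σ ∉ A.principal) : IsInternalSimplex X d A.simplices σ := by
  rcases L.nonprincipal hA hσ hp with
    ⟨τ, a, b, u, u', h, hpa, hu, hua, hul, -, rfl, hu', hg, hup, huk⟩ | ⟨-, h⟩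
  swap
  · rwa [hd] at h
  have ha' : u' ≠ a := fun e => hu' (e ▸ h.left_mem)
  have huu : u' ≠ u := fun e => hu' (e ▸ hu)
  have e1 : (insert u' (τ.erase u)).erase a = insert u' ((τ.erase a).erase u) := by
    rw [erase_insert_of_ne ha', erase_right_comm]
  have hT : M.IsTransversal (insert u' ((τ.erase a).erase u)) := by
    refine ⟨?_, ?_, ?_⟩
    · rw [← e1]; exact hg.subset (erase_subset _ _)
    · rw [card_insert_of_notMem (by simp [hu']), card_erase_of_mem (by simp [hu, hua]),
        card_erase_of_mem h.left_mem, h.card]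
      omega
    · have key : ∀ x ∈ (τ.erase a).erase u, M.pos x ≠ M.pos u' := by
        intro x hx e
        exact (mem_erase.1 hx).1 (h.inj (mem_of_mem_erase hx) (by simp [hu, hua])
          (by rw [e, hup]))
      intro x hx y hy e
      rcases mem_insert.1 (mem_coe.1 hx) with hx' | hx' <;>
        rcases mem_insert.1 (mem_coe.1 hy) with hy' | hy'
      · rw [hx', hy']
      · exact absurd (by rw [← e, hx']) (key y hy')
      · exact absurd (by rw [e, hy']) (key x hx')
      · exact h.inj (mem_of_mem_erase hx') (mem_of_mem_erase hy') e
  have hpb : insert u' ((τ.erase a).erase u) ∈ A.principal :=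
    L.exchange hA hpa hT (v := u) (v' := u') (by simp [hu, hua]) (mem_insert_self _ _) hup.symm
      (by rw [erase_insert (by simp [hu'])]) huk.symm
  refine ⟨_, L.principal_subset hA hpa, _, L.principal_subset hA hpb, fun e => ?_, fun e => ?_,
    fun e => ?_, τ, ⟨L.good_mem ⟨a, h.left_mem⟩ h.good, by rw [h.card, hd]⟩,
    insert u' (τ.erase u), ⟨L.good_mem ⟨u', mem_insert_self _ _⟩ hg, ?_⟩, fun e => ?_,
    erase_subset _ _, subset_insert _ _, erase_subset _ _, ?_⟩
  · have : u ∈ τ.erase a := by simp [hu, hua]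
    rw [e] at this; simp at this
  · have : u' ∈ τ.erase u := by rw [← e]; exact mem_insert_self _ _
    exact hu' (mem_of_mem_erase this)
  · have : u' ∈ τ.erase a := by rw [e]; exact mem_insert_self _ _
    exact hu' (mem_of_mem_erase this)
  · rw [card_insert_of_notMem (by simp [hu']), card_erase_of_mem hu, h.card, hd]; omega
  · exact hu' (by rw [e]; exact mem_insert_self _ _)
  · rw [← e1]; exact erase_subset _ _

/-! ### The orientation by labels -/

/-- The orientation of a simplex by the sum of its labels. -/
def labelSign (M : PositionedGraph V Pos κ) (σ : Finset V) : ℤˣ := (-1) ^ (∑ v ∈ σ, M.label v)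

/-- In a transversal clique, the vertices before `v` are those at smaller positions. -/
theorem IsTransversal.filter_lt {σ : Finset V} (h : M.IsTransversal σ) {v : V} (hv : v ∈ σ) :
    σ.filter (· < v) = (σ.erase v).filter (fun u => M.pos u < M.pos v) := by
  ext w
  simp only [mem_filter, mem_erase]
  constructor
  · rintro ⟨hw, hlt⟩
    have hp : M.pos w ≠ M.pos v := fun e => hlt.ne (h.inj hw hv e)
    exact ⟨⟨hlt.ne, hw⟩, (h.good.lt_iff hw hv hp).1 hlt⟩
  · rintro ⟨⟨hne, hw⟩, hlt⟩
    exact ⟨hw, (h.good.lt_iff hw hv hlt.ne).2 hlt⟩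

theorem neg_one_pow_eq_neg_of_odd {a b : ℕ} (h : Odd (a + b)) :
    ((-1) ^ a : ℤˣ) = -(-1) ^ b := by
  rcases Nat.even_or_odd a with ha | ha
  · have hb : Odd b := by
      rcases Nat.even_or_odd b with hb | hb
      · exact absurd (ha.add hb) (Nat.not_even_iff_odd.2 h)
      · exact hb
    rw [ha.neg_one_pow, hb.neg_one_pow, neg_neg]
  · have hb : Even b := by
      rcases Nat.even_or_odd b with hb | hb
      · exact hb
      · exact absurd (ha.add_odd hb) (Nat.not_even_iff_odd.2 h)
    rw [ha.neg_one_pow, hb.neg_one_pow]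

/-- The vertices `v` and `v'` have the same place in the order, and labels of different parity. -/
theorem IsLayering.inducedOnFace_eq_neg (L : M.IsLayering X Lay) {A : Layer V} (hA : A ∈ Lay)
    {σ σ' : Finset V} (hσ : σ ∈ A.principal) (hσ' : σ' ∈ A.principal) (hne : σ ≠ σ') {v v' : V}
    (hv : v ∈ σ) (hv' : v' ∈ σ') (he : σ.erase v = σ'.erase v') :
    inducedOnFace M.labelSign σ v = - inducedOnFace M.labelSign σ' v' := by
  have h := L.transversal hA hσ
  have h' := L.transversal hA hσ'
  have hp : M.pos v = M.pos v' := by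
    obtain ⟨w, hw, e⟩ := h'.exists_pos (M.pos v)
    by_cases hwv : w = v'
    · rw [← hwv, e]
    have hw' : w ∈ σ.erase v := by rw [he]; simp [hw, hwv]
    exact absurd (h.inj (mem_of_mem_erase hw') hv e) (mem_erase.1 hw').1
  have hk := L.kind_of_exchange hA hσ hσ' hv hv' hp he
  have hvv : v ≠ v' := by
    rintro rfl
    exact hne (by rw [← insert_erase hv, he, insert_erase hv'])
  have hodd := M.odd_label (h.good.1 v hv) (h'.good.1 v' hv') hp hk hvv
  unfold inducedOnFace labelSign
  rw [h.filter_lt hv, h'.filter_lt hv', he, hp, ← add_sum_erase _ _ hv, ← add_sum_erase _ _ hv',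
    he, pow_add _ (M.label v), pow_add _ (M.label v'), neg_one_pow_eq_neg_of_odd hodd]
  simp

/-- The vertices `a` and `b` have the same label, and neighbouring places in the order. -/
theorem IsSlab.inducedOnCoface_eq_neg {τ : Finset V} {a b : V} (h : M.IsSlab τ a b) :
    inducedOnCoface M.labelSign τ a = - inducedOnCoface M.labelSign τ b := by
  have hab := h.ne
  have hadj := h.good.2 a h.left_mem b h.right_mem hab
  have hsum : M.labelSign (τ.erase a) = M.labelSign (τ.erase b) := by
    unfold labelSign
    have e1 := add_sum_erase τ M.label h.left_mem
    have e2 := add_sum_erase τ M.label h.right_mem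
    rw [M.label_eq hadj h.pos_eq hab] at e1
    congr 1; omega
  unfold inducedOnCoface
  rw [hsum, ← neg_mul]
  congr 1
  -- `a` and `b` are consecutive in the order of the vertices
  have key : ∀ x y, x ∈ τ → y ∈ τ → M.pos x = M.pos y →
      (∀ w ∈ τ, M.pos w = M.pos x → w = x ∨ w = y) → x < y →
      (τ.filter (· < y)).card = (τ.filter (· < x)).card + 1 := by
    intro x y hx hy hp hw hlt
    have : τ.filter (· < y) = insert x (τ.filter (· < x)) := by
      ext w
      simp only [mem_filter, mem_insert]
      by_cases hwp : M.pos w = M.pos x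
      · constructor
        · rintro ⟨h1, h2⟩
          rcases hw w h1 hwp with rfl | rfl
          · exact Or.inl rfl
          · exact absurd h2 (lt_irrefl _)
        · rintro (rfl | ⟨h1, h2⟩)
          exacts [⟨hx, hlt⟩, ⟨h1, h2.trans hlt⟩]
      · have hwx : w ≠ x := fun e => hwp (by rw [e])
        simp only [hwx, false_or]
        refine and_congr_right fun h1 => ?_
        rw [h.good.lt_iff h1 hy (by rwa [← hp]), h.good.lt_iff h1 hx hwp, hp]
    rw [this, card_insert_of_notMem (by simp)]
  have hw : ∀ w ∈ τ, M.pos w = M.pos a → w = a ∨ w = b := by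
    intro w hw hp
    rcases h.eq_or_of_pos_eq hw h.left_mem hp with e | ⟨e, -⟩ | ⟨e, -⟩
    exacts [Or.inl e, Or.inl e, Or.inr e]
  apply neg_one_pow_eq_neg_of_odd
  rcases lt_or_gt_of_ne hab with hlt | hlt
  · rw [key a b h.left_mem h.right_mem h.pos_eq hw hlt]
    exact ⟨(τ.filter (· < a)).card, by ring⟩
  · rw [key b a h.right_mem h.left_mem h.pos_eq.symm
      (fun w hw1 hp => (hw w hw1 (hp.trans h.pos_eq.symm)).symm) hlt]
    exact ⟨(τ.filter (· < b)).card, by ring⟩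

end PositionedGraph

/-! ### Uniform oriented filtrations from layerings -/

theorem layerFiltration_zero {V : Type*} (K : PreAbstractSimplicialComplex V)
    (Ls : List (Layer V)) : layerFiltration K Ls 0 = K := by
  refine le_antisymm (sup_le le_rfl ?_) le_sup_left
  rintro σ ⟨-, τ, ⟨A, hA, -⟩, -⟩
  simp at hA

namespace PositionedGraph
variable {V Pos κ : Type*} [LinearOrder V] [LinearOrder Pos] {M : PositionedGraph V Pos κ}
  [Fintype Pos] {X : PreAbstractSimplicialComplex V}

/-- The list of layers of a filtration, with the `d`-simplices of the initial complex `K` as the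
first one; all of them are principal. -/
def allLayers (K : PreAbstractSimplicialComplex V) (d : ℕ) (Ls : List (Layer V)) :
    List (Layer V) :=
  ⟨simplicesOfDim K d, simplicesOfDim K d⟩ :: Ls

variable {K : PreAbstractSimplicialComplex V} {Ls : List (Layer V)} {d : ℕ}

theorem IsLayering.mem_simplicesOfDim_layerFiltration (L : M.IsLayering X (allLayers K d Ls))
    (hd : Fintype.card Pos = d + 1) {s : ℕ} {σ : Finset V} :
    σ ∈ simplicesOfDim (layerFiltration K Ls s) d ↔
      ∃ A ∈ (allLayers K d Ls).take (s + 1), σ ∈ A.simplices := by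
  have hmem : σ ∈ layerFiltration K Ls s ↔
      σ ∈ K ∨ (σ.Nonempty ∧ ∃ τ ∈ {τ | ∃ A ∈ Ls.take s, τ ∈ A.simplices}, σ ⊆ τ) := Iff.rfl
  simp only [allLayers, List.take_succ_cons, List.mem_cons, exists_eq_or_imp]
  constructor
  · rintro ⟨h1, h2⟩
    rcases hmem.1 h1 with h | ⟨-, τ, ⟨A, hA, hτ⟩, hs⟩
    · exact Or.inl ⟨h, h2⟩
    · right
      refine ⟨A, hA, ?_⟩
      have hc := L.card_eq (List.mem_cons_of_mem _ (List.mem_of_mem_take hA)) hτ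
      rwa [eq_of_subset_of_card_le hs (by rw [hc, h2, hd])]
  · rintro (⟨h1, h2⟩ | ⟨A, hA, hσ⟩)
    · exact ⟨hmem.2 (Or.inl h1), h2⟩
    · have hc := L.card_eq (List.mem_cons_of_mem _ (List.mem_of_mem_take hA)) hσ
      rw [hd] at hc
      exact ⟨hmem.2 (Or.inr ⟨card_pos.1 (by omega), σ, ⟨A, hA, hσ⟩, Subset.rfl⟩), hc⟩

/-- A simplex belongs to at most one layer. -/
theorem IsLayering.index_unique {Lay : List (Layer V)} (L : M.IsLayering X Lay) {i j : ℕ}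
    {A B : Layer V} (hi : Lay[i]? = some A) (hj : Lay[j]? = some B) {σ : Finset V}
    (hA : σ ∈ A.simplices) (hB : σ ∈ B.simplices) : i = j := by
  obtain ⟨hi', rfl⟩ := List.getElem?_eq_some_iff.1 hi
  obtain ⟨hj', rfl⟩ := List.getElem?_eq_some_iff.1 hj
  have hd := List.pairwise_iff_getElem.1 L.disj
  by_contra hne
  rcases lt_or_gt_of_ne hne with h | h
  · exact Set.disjoint_left.1 (hd i j hi' hj' h) hA hB
  · exact Set.disjoint_left.1 (hd j i hj' hi' h) hB hA

theorem IsLayering.addedSimplices_eq (L : M.IsLayering X (allLayers K d Ls))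
    (hd : Fintype.card Pos = d + 1) {i : ℕ} {A : Layer V}
    (hi : (allLayers K d Ls)[i]? = some A) :
    addedSimplices (layerFiltration K Ls) d i = A.simplices := by
  have take_mem : ∀ {s : ℕ} {B : Layer V}, B ∈ (allLayers K d Ls).take s →
      ∃ j < s, (allLayers K d Ls)[j]? = some B := by
    intro s B hB
    obtain ⟨j, hj, e⟩ := List.mem_take_iff_getElem.1 hB
    exact ⟨j, by omega, by rw [List.getElem?_eq_getElem (by omega), e]⟩
  have mem_take : ∀ {s j : ℕ} {B : Layer V}, (allLayers K d Ls)[j]? = some B → j < s →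
      B ∈ (allLayers K d Ls).take s := by
    intro s j B hB hjs
    obtain ⟨hj, e⟩ := List.getElem?_eq_some_iff.1 hB
    exact List.mem_take_iff_getElem.2 ⟨j, by omega, e⟩
  ext σ
  cases i with
  | zero =>
    change σ ∈ simplicesOfDim (layerFiltration K Ls 0) d ↔ _
    rw [L.mem_simplicesOfDim_layerFiltration hd]
    constructor
    · rintro ⟨B, hB, hσ⟩
      obtain ⟨j, hj, e⟩ := take_mem hB
      obtain rfl : j = 0 := by omega
      rw [hi] at e
      exact Option.some.inj e ▸ hσ
    · exact fun hσ => ⟨A, mem_take hi (by omega), hσ⟩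
  | succ i =>
    change _ ∧ _ ↔ _
    rw [L.mem_simplicesOfDim_layerFiltration hd, L.mem_simplicesOfDim_layerFiltration hd]
    constructor
    · rintro ⟨⟨B, hB, hσ⟩, hn⟩
      obtain ⟨j, hj, e⟩ := take_mem hB
      obtain rfl : j = i + 1 := by
        by_contra hne
        exact hn ⟨B, mem_take e (by omega), hσ⟩
      rw [hi] at e
      exact Option.some.inj e ▸ hσ
    · intro hσ
      refine ⟨⟨A, mem_take hi (by omega), hσ⟩, ?_⟩
      rintro ⟨B, hB, hσB⟩
      obtain ⟨j, hj, e⟩ := take_mem hB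
      have := L.index_unique hi e hσ hσB
      omega

theorem IsLayering.essentialSimplices_eq (L : M.IsLayering X (allLayers K d Ls))
    (hd : Fintype.card Pos = d + 1) {i : ℕ} {A : Layer V}
    (hi : (allLayers K d Ls)[i]? = some A) :
    essentialSimplices X (layerFiltration K Ls) d i = A.principal := by
  have hA := List.mem_of_getElem? hi
  ext σ
  unfold essentialSimplices
  rw [L.addedSimplices_eq hd hi]
  constructor
  · rintro ⟨h1, h2⟩
    by_contra hp
    exact h2 (L.isInternalSimplex hd hA h1 hp)
  · exact fun h => ⟨L.principal_subset hA h, L.not_isInternalSimplex hd hA h⟩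

/-- A coface that meets two layers is a slab simplex, and these are the layers of its two principal
facets. -/
theorem IsLayering.connecting (L : M.IsLayering X (allLayers K d Ls))
    (hd : Fintype.card Pos = d + 1) {i j : ℕ} (hij : i ≠ j) {A B : Layer V}
    (hi : (allLayers K d Ls)[i]? = some A) (hj : (allLayers K d Ls)[j]? = some B)
    {τ σ σ' : Finset V} (hτ : τ ∈ simplicesOfDim X (d + 1)) (hσ : σ ∈ A.simplices)
    (hs : σ ⊆ τ) (hσ' : σ' ∈ B.simplices) (hs' : σ' ⊆ τ) :
    ∃ a b, M.IsSlab τ a b ∧ ((τ.erase a ∈ A.principal ∧ τ.erase b ∈ B.principal) ∨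
      (τ.erase a ∈ B.principal ∧ τ.erase b ∈ A.principal)) := by
  have hA := List.mem_of_getElem? hi
  have hB := List.mem_of_getElem? hj
  have hc : τ.card = Fintype.card Pos + 1 := by rw [hτ.2, hd]
  by_cases hg : M.IsGood τ
  · obtain ⟨a, b, h⟩ := L.exists_isSlab hg hc hA hσ hs
    refine ⟨a, b, h, ?_⟩
    have key : ∀ {k : ℕ} {C : Layer V}, (allLayers K d Ls)[k]? = some C → ∀ {ρ : Finset V},
        ρ ∈ C.simplices → ρ ⊆ τ → τ.erase a ∈ C.principal ∨ τ.erase b ∈ C.principal := by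
      intro k C hk ρ hρ hρs
      rcases L.face_cases h (List.mem_of_getElem? hk) hρ hρs with ⟨h1, rfl | rfl⟩ | ⟨-, h1, -⟩
      exacts [Or.inl h1, Or.inr h1, Or.inl h1]
    have uniq : ∀ {ρ : Finset V}, ρ ∈ A.principal → ρ ∉ B.principal := fun h1 h2 =>
      hij (L.index_unique hi hj (L.principal_subset hA h1) (L.principal_subset hB h2))
    rcases key hi hσ hs with h1 | h1 <;> rcases key hj hσ' hs' with h2 | h2
    · exact absurd h2 (uniq h1)
    · exact Or.inl ⟨h1, h2⟩
    · exact Or.inr ⟨h2, h1⟩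
    · exact absurd h2 (uniq h1)
  · exfalso
    rcases L.coface_not_good hτ.1 hc hg hA hσ hs with ⟨-, -, h⟩ | ⟨c, -, -, -, h⟩
    · obtain rfl := h B hB σ' hσ' hs'
      exact hij (L.index_unique hi hj hσ hσ')
    · exact hij (L.index_unique hi hj (h B hB σ' hσ' hs') hσ')

/-- The other facets of a slab simplex that occur in the filtration belong to the layer of one of
the two principal facets. -/
theorem IsLayering.facesSplit (L : M.IsLayering X (allLayers K d Ls))
    (hd : Fintype.card Pos = d + 1) {i j : ℕ} {A B : Layer V}
    (hi : (allLayers K d Ls)[i]? = some A) (hj : (allLayers K d Ls)[j]? = some B)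
    {τ : Finset V} {a b : V} (h : M.IsSlab τ a b)
    (hab : (τ.erase a ∈ A.principal ∧ τ.erase b ∈ B.principal) ∨
      (τ.erase a ∈ B.principal ∧ τ.erase b ∈ A.principal)) :
    FacesSplit (layerFiltration K Ls) d Ls.length i j τ := by
  have hA := List.mem_of_getElem? hi
  have hB := List.mem_of_getElem? hj
  intro u hu hF
  rw [L.addedSimplices_eq hd hi, L.addedSimplices_eq hd hj]
  obtain ⟨C, hC, hσ⟩ := (L.mem_simplicesOfDim_layerFiltration hd).1 hF
  have hC' := List.mem_of_mem_take hC
  obtain ⟨k, hk⟩ := List.getElem?_of_mem hC'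
  have same : ∀ {l : ℕ} {D : Layer V}, (allLayers K d Ls)[l]? = some D → ∀ {ρ : Finset V},
      ρ ∈ C.simplices → ρ ∈ D.simplices → τ.erase u ∈ D.simplices := by
    intro l D hl ρ h1 h2
    have e := L.index_unique hk hl h1 h2
    subst e
    rw [hk] at hl
    exact Option.some.inj hl ▸ hσ
  have pA := L.principal_subset hA
  have pB := L.principal_subset hB
  have pC := L.principal_subset hC'
  have hac : τ.erase a ∈ C.principal ∨ τ.erase b ∈ C.principal := by
    rcases L.face_cases h hC' hσ (erase_subset _ _) with ⟨h1, e | e⟩ | ⟨-, h1, -⟩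
    · left; rwa [← e]
    · right; rwa [← e]
    · exact Or.inl h1
  rcases hab with ⟨h1, h2⟩ | ⟨h1, h2⟩ <;> rcases hac with h3 | h3
  · exact Or.inl (same hi (pC h3) (pA h1))
  · exact Or.inr (same hj (pC h3) (pB h2))
  · exact Or.inr (same hj (pC h3) (pB h1))
  · exact Or.inl (same hi (pC h3) (pA h2))

theorem ncard_facets_eq_one {S : Set (Finset V)} {τ ρ : Finset V} (hρ : ρ ∈ S)
    (hρτ : ∃ u ∈ τ, ρ = τ.erase u) (h : ∀ u ∈ τ, τ.erase u ∈ S → τ.erase u = ρ) :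
    {σ | σ ∈ S ∧ ∃ u ∈ τ, σ = τ.erase u}.ncard = 1 := by
  rw [Set.ncard_eq_one]
  refine ⟨ρ, Set.eq_singleton_iff_unique_mem.2 ⟨⟨hρ, hρτ⟩, ?_⟩⟩
  rintro _ ⟨h1, u, hu, rfl⟩
  exact h u hu h1

/-- Only the layer with a cap has cofaces all of whose facets in the filtration belong to it. -/
theorem IsLayering.degree_self (L : M.IsLayering X (allLayers K d Ls))
    (hd : Fintype.card Pos = d + 1) {i : ℕ} {A : Layer V}
    (hi : (allLayers K d Ls)[i]? = some A) :
    ∃ f : ℕ, ∀ τ ∈ connectingSimplices X (layerFiltration K Ls) d Ls.length i i,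
      {σ | σ ∈ A.principal ∧ ∃ u ∈ τ, σ = τ.erase u}.ncard = f := by
  have hA := List.mem_of_getElem? hi
  have slab : ∀ τ a b, M.IsSlab τ a b → (τ.erase a ∈ A.principal ∨ τ.erase b ∈ A.principal) →
      τ ∉ connectingSimplices X (layerFiltration K Ls) d Ls.length i i := by
    rintro τ a b h hp ⟨-, hf, -⟩
    have key : ∀ u ∈ τ, M.IsTransversal (τ.erase u) → τ.erase u ∈ A.principal := by
      intro u hu hT
      obtain ⟨B, hB, hp⟩ := L.exists_layer hT
      have hBS := L.principal_subset hB hp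
      have := hf u hu ((L.mem_simplicesOfDim_layerFiltration hd).2
        ⟨B, by rwa [List.take_of_length_le (by simp [allLayers])], hBS⟩)
      rw [Set.union_self, L.addedSimplices_eq hd hi] at this
      obtain ⟨k, hk⟩ := List.getElem?_of_mem hB
      have e := L.index_unique hi hk this hBS
      subst e
      rw [hi] at hk
      exact Option.some.inj hk ▸ hp
    exact L.not_mem_principal h hA (key a h.left_mem h.transversal_left)
      (key b h.right_mem h.transversal_right)
  by_cases hcap : ∃ c, M.IsCap A c
  · obtain ⟨c, hc⟩ := hcap
    refine ⟨1, fun τ hτ => ?_⟩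
    obtain ⟨⟨hX, hcard⟩, -, ⟨u, hu, hσ⟩, -⟩ := id hτ
    rw [L.addedSimplices_eq hd hi] at hσ
    by_cases hg : M.IsGood τ
    · exfalso
      obtain ⟨a, b, h⟩ := L.exists_isSlab hg (by omega) hA hσ (erase_subset _ _)
      refine slab τ a b h ?_ hτ
      rcases L.face_cases h hA hσ (erase_subset _ _) with ⟨h1, e | e⟩ | ⟨h1, h2, -⟩
      · left; rwa [← e]
      · right; rwa [← e]
      · exact Or.inl h2
    · rcases L.coface_not_good hX (by omega) hg hA hσ (erase_subset _ _) with
        ⟨-, h, -⟩ | ⟨c', hc'τ, hc', hp, -⟩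
      · exact absurd hc (h c)
      · refine ncard_facets_eq_one hp ⟨c', hc'τ, rfl⟩ fun u hu h1 => ?_
        congr 1
        by_contra hne
        exact hc'.1 ((L.transversal hA h1).good.1 c' (by simp [hc'τ, Ne.symm hne]))
  · refine ⟨0, fun τ hτ => ?_⟩
    have hempty : {σ | σ ∈ A.principal ∧ ∃ u ∈ τ, σ = τ.erase u} = ∅ := by
      rw [Set.eq_empty_iff_forall_notMem]
      rintro _ ⟨h1, u, hu, rfl⟩
      obtain ⟨⟨hX, hcard⟩, -⟩ := id hτ
      by_cases hg : M.IsGood τ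
      · obtain ⟨a, b, h, e⟩ := exists_isSlab_of_transversal hg (by omega) (L.transversal hA h1)
          (erase_subset _ _)
        refine slab τ a b h ?_ hτ
        rcases e with e | e
        · left; rwa [← e]
        · right; rwa [← e]
      · rcases L.coface_not_good hX (by omega) hg hA (L.principal_subset hA h1)
          (erase_subset _ _) with ⟨h, -⟩ | ⟨c', -, hc', -⟩
        · exact h h1
        · exact hcap ⟨c', hc'⟩
    rw [hempty, Set.ncard_empty]

/-- A layering gives a uniform oriented filtration. -/
theorem IsLayering.isUniformOrientedFiltration (L : M.IsLayering X (allLayers K d Ls))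
    (hd : Fintype.card Pos = d + 1) (hK : K ≤ X) {w : V → ℝ}
    (hw : ∀ A ∈ allLayers K d Ls, ∃ W : ℝ, ∀ σ ∈ A.simplices, ∏ v ∈ σ, w v = W) :
    IsUniformOrientedFiltration X w d Ls.length (layerFiltration K Ls) M.labelSign := by
  have get : ∀ i ≤ Ls.length, ∃ A, (allLayers K d Ls)[i]? = some A := fun i hi =>
    ⟨_, List.getElem?_eq_getElem (by simp only [allLayers, List.length_cons]; omega)⟩
  refine ⟨⟨?_, ?_, ?_, ?_⟩, ?_, ?_⟩
  · intro i _
    refine sup_le_sup le_rfl ?_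
    rintro σ ⟨h1, τ, ⟨A, hA, hτ⟩, h2⟩
    exact ⟨h1, τ, ⟨A, (List.take_subset_take_left Ls (Nat.le_succ i)) hA, hτ⟩, h2⟩
  · refine sup_le hK ?_
    rintro σ ⟨h1, τ, ⟨A, hA, hτ⟩, h2⟩
    exact (X.isRelLowerSet_faces (L.mem_complex
      (List.mem_cons_of_mem _ (List.mem_of_mem_take hA)) hτ)).2 h2 h1
  · intro i hi σ hσ σ' hσ' hne v hv v' hv' he
    obtain ⟨A, hA⟩ := get i hi
    rw [L.essentialSimplices_eq hd hA] at hσ hσ'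
    exact L.inducedOnFace_eq_neg (List.mem_of_getElem? hA) hσ hσ' hne hv hv' he
  · intro i hi j hj hij τ hτ v hv v' hv' h1 h2
    obtain ⟨A, hA⟩ := get i hi
    obtain ⟨B, hB⟩ := get j hj
    rw [L.essentialSimplices_eq hd hA] at h1
    rw [L.essentialSimplices_eq hd hB] at h2
    have hA' := List.mem_of_getElem? hA
    have hB' := List.mem_of_getElem? hB
    obtain ⟨a, b, h, hab⟩ := L.connecting hd hij hA hB hτ (L.principal_subset hA' h1)
      (erase_subset _ _) (L.principal_subset hB' h2) (erase_subset _ _)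
    refine ⟨?_, L.facesSplit hd hA hB h hab⟩
    have key : ∀ u ∈ τ, M.IsTransversal (τ.erase u) → u = a ∨ u = b := by
      intro u hu hT
      by_contra! hne
      exact h.ne (hT.inj (by simp [h.left_mem, hne.1.symm]) (by simp [h.right_mem, hne.2.symm])
        h.pos_eq)
    have uniq : v ≠ v' := by
      rintro rfl
      exact hij (L.index_unique hA hB (L.principal_subset hA' h1) (L.principal_subset hB' h2))
    rcases key v hv (L.transversal hA' h1) with rfl | rfl <;>
      rcases key v' hv' (L.transversal hB' h2) with rfl | rfl
    · exact absurd rfl uniq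
    · exact h.inducedOnCoface_eq_neg
    · rw [h.inducedOnCoface_eq_neg, neg_neg]
    · exact absurd rfl uniq
  · intro i hi
    obtain ⟨A, hA⟩ := get i hi
    rw [L.addedSimplices_eq hd hA]
    exact hw A (List.mem_of_getElem? hA)
  · intro i hi j hj
    obtain ⟨A, hA⟩ := get i hi
    rw [L.essentialSimplices_eq hd hA]
    by_cases hij : i = j
    · subst hij
      exact L.degree_self hd hA
    obtain ⟨B, hB⟩ := get j hj
    refine ⟨1, ?_⟩
    rintro τ ⟨hτ, -, ⟨u, hu, h1⟩, ⟨u', hu', h2⟩⟩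
    rw [L.addedSimplices_eq hd hA] at h1
    rw [L.addedSimplices_eq hd hB] at h2
    have hA' := List.mem_of_getElem? hA
    have hB' := List.mem_of_getElem? hB
    obtain ⟨a, b, h, hab⟩ := L.connecting hd hij hA hB hτ h1
      (erase_subset _ _) h2 (erase_subset _ _)
    have key : ∀ u ∈ τ, τ.erase u ∈ A.principal → τ.erase u = τ.erase a ∨
        τ.erase u = τ.erase b := by
      intro u hu hp
      rcases L.face_cases h hA' (L.principal_subset hA' hp) (erase_subset _ _) with ⟨-, e⟩ | ⟨e, -⟩
      exacts [e, absurd hp e]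
    rcases hab with ⟨p1, -⟩ | ⟨-, p1⟩
    · refine ncard_facets_eq_one p1 ⟨a, h.left_mem, rfl⟩ fun u hu hp => ?_
      rcases key u hu hp with e | e
      · exact e
      · exact absurd (e ▸ hp) (L.not_mem_principal h hA' p1)
    · refine ncard_facets_eq_one p1 ⟨b, h.right_mem, rfl⟩ fun u hu hp => ?_
      rcases key u hu hp with e | e
      · exact absurd p1 (L.not_mem_principal h hA' (e ▸ hp))
      · exact e

theorem IsLayering.essentialSimplices_zero (L : M.IsLayering X (allLayers K d Ls))
    (hd : Fintype.card Pos = d + 1) :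
    essentialSimplices X (layerFiltration K Ls) d 0 = simplicesOfDim K d :=
  L.essentialSimplices_eq hd (A := ⟨simplicesOfDim K d, simplicesOfDim K d⟩) rfl

theorem IsLayering.simplices_succ (L : M.IsLayering X (allLayers K d Ls))
    (hd : Fintype.card Pos = d + 1) (s : ℕ) (hs : s < Ls.length) :
    addedSimplices (layerFiltration K Ls) d (s + 1) = (Ls[s]).simplices ∧
      essentialSimplices X (layerFiltration K Ls) d (s + 1) = (Ls[s]).principal := by
  have h : (allLayers K d Ls)[s + 1]? = some Ls[s] := List.getElem?_eq_getElem hs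
  exact ⟨L.addedSimplices_eq hd h, L.essentialSimplices_eq hd h⟩

end PositionedGraph

/-! ### Combinatorics of the layers of a gluing -/

section Rank

variable {ι : Type*} [Fintype ι] [LinearOrder ι]

theorem posRank_lt_card (p : ι) : posRank p < Fintype.card ι :=
  card_lt_univ_of_notMem (x := p) (by simp)

theorem posRank_strictMono : StrictMono (posRank (ι := ι)) := by
  intro p q h
  refine card_lt_card (ssubset_iff_of_subset ?_ |>.2 ⟨p, by simpa using h, by simp⟩)
  intro x hx
  simp only [mem_filter, mem_univ, true_and] at hx ⊢
  exact hx.trans h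

theorem exists_posRank_eq {r : ℕ} (h : r < Fintype.card ι) : ∃ p : ι, posRank p = r := by
  have : univ.image (posRank (ι := ι)) = range (Fintype.card ι) := by
    apply eq_of_subset_of_card_le
    · intro x hx
      obtain ⟨p, -, rfl⟩ := mem_image.1 hx
      exact mem_range.2 (posRank_lt_card p)
    · rw [card_range, card_image_of_injective _ posRank_strictMono.injective, card_univ]
  have hr : r ∈ univ.image (posRank (ι := ι)) := by rw [this]; exact mem_range.2 h
  simpa using hr

theorem mem_iff_card_le_of_isUpperSet {U : Finset ι} (hU : ∀ p ∈ U, ∀ q, p ≤ q → q ∈ U) (p : ι) :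
    p ∈ U ↔ Fintype.card ι ≤ posRank p + U.card := by
  have hc := card_compl_add_card U
  constructor
  · intro hp
    have : Uᶜ ⊆ univ.filter (· < p) := by
      intro q hq
      simp only [mem_compl, mem_filter, mem_univ, true_and] at hq ⊢
      exact lt_of_not_ge fun h => hq (hU p hp q h)
    have := card_le_card this
    unfold posRank
    omega
  · intro h
    by_contra hp
    have : insert p (univ.filter (· < p)) ⊆ Uᶜ := by
      intro q hq
      simp only [mem_compl, mem_insert, mem_filter, mem_univ, true_and] at hq ⊢
      intro hqU
      exact hp (hU q hqU p (by rcases hq with rfl | hq; exacts [le_rfl, hq.le]))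
    have := card_le_card this
    rw [card_insert_of_notMem (by simp)] at this
    unfold posRank at h
    omega

variable {V : Type*} [DecidableEq V] (lo hi : ι → Bool → V)

/-- The vertex of a principal simplex of the `k`-th layer at the position `p`. -/
def mixVertex (k : ℕ) (f : ι → Bool) (p : ι) : V :=
  if posRank p + k < Fintype.card ι then lo p (f p) else hi p (f p)

/-- The principal simplex of the `k`-th layer with the vertices selected by `f`: upper vertices at
the last `k` positions and lower ones at the others. -/
def mixSimplex (k : ℕ) (f : ι → Bool) : Finset V :=
  univ.image (mixVertex lo hi k f)

variable {lo hi}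

theorem slabSimplex_eq_insert {k : ℕ} {f : ι → Bool} {q : ι}
    (hq : posRank q + k = Fintype.card ι) :
    slabSimplex lo hi k f = insert (lo q (f q)) (mixSimplex lo hi k f) := by
  ext x
  simp only [slabSimplex, mixSimplex, mixVertex, mem_union, mem_image, mem_filter, mem_univ,
    true_and, mem_insert]
  constructor
  · rintro (⟨p, hp, rfl⟩ | ⟨p, hp, rfl⟩)
    · rcases hp.lt_or_eq with h | h
      · exact Or.inr ⟨p, if_pos h⟩
      · obtain rfl : p = q := posRank_strictMono.injective (by omega)
        exact Or.inl rfl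
    · exact Or.inr ⟨p, if_neg (by omega)⟩
  · rintro (rfl | ⟨p, rfl⟩)
    · exact Or.inl ⟨q, hq.le, rfl⟩
    · split_ifs with h
      · exact Or.inl ⟨p, h.le, rfl⟩
      · exact Or.inr ⟨p, by omega, rfl⟩

theorem mixSimplex_zero (f : ι → Bool) :
    mixSimplex lo hi 0 f = univ.image (fun p => lo p (f p)) := by
  unfold mixSimplex mixVertex
  congr 1
  funext p
  exact if_pos (posRank_lt_card p)

theorem mixSimplex_card (f : ι → Bool) :
    mixSimplex lo hi (Fintype.card ι) f = univ.image (fun p => hi p (f p)) := by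
  unfold mixSimplex mixVertex
  congr 1
  funext p
  exact if_neg (by omega)

theorem lo_mem_slabSimplex {k : ℕ} {f : ι → Bool} {p : ι} (hp : posRank p + k ≤ Fintype.card ι) :
    lo p (f p) ∈ slabSimplex lo hi k f :=
  mem_union_left _ (mem_image_of_mem _ (by simpa using hp))

theorem card_filter_le_posRank_add {k : ℕ} (hk : k ≤ Fintype.card ι) :
    (univ.filter (fun p : ι => Fintype.card ι ≤ posRank p + k)).card = k := by
  rw [← card_image_of_injective _ (posRank_strictMono (ι := ι)).injective]
  have : (univ.filter (fun p : ι => Fintype.card ι ≤ posRank p + k)).image posRank =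
      Finset.Ico (Fintype.card ι - k) (Fintype.card ι) := by
    ext r
    simp only [mem_image, mem_filter, mem_univ, true_and, Finset.mem_Ico]
    constructor
    · rintro ⟨p, hp, rfl⟩
      exact ⟨by omega, posRank_lt_card p⟩
    · rintro ⟨h1, h2⟩
      obtain ⟨p, rfl⟩ := exists_posRank_eq h2
      exact ⟨p, by omega, rfl⟩
  rw [this, Nat.card_Ico]
  omega

/-- The members of the `k`-th layer have `k` upper vertices. -/
theorem card_filter_thickLayer {Q : V → Prop} [DecidablePred Q] (hlo : ∀ p b, ¬ Q (lo p b))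
    (hhi : ∀ p b, Q (hi p b)) (hinj : ∀ {p p' b b'}, hi p b = hi p' b' → p = p') {k : ℕ}
    (hk : k ≤ Fintype.card ι) {σ : Finset V} (hσ : σ ∈ (thickLayer lo hi k).simplices) :
    (σ.filter Q).card = k := by
  obtain ⟨f, r, -, rfl⟩ := hσ
  have : ((slabSimplex lo hi k f).erase (lo r (f r))).filter Q =
      (univ.filter (fun p : ι => Fintype.card ι ≤ posRank p + k)).image (fun p => hi p (f p)) := by
    ext x
    simp only [slabSimplex, mem_filter, mem_erase, mem_union, mem_image, mem_univ, true_and]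
    constructor
    · rintro ⟨⟨-, ⟨p, -, rfl⟩ | h⟩, hQ⟩
      exacts [absurd hQ (hlo _ _), h]
    · rintro ⟨p, hp, rfl⟩
      exact ⟨⟨fun e => hlo r (f r) (e ▸ hhi p (f p)), Or.inr ⟨p, hp, rfl⟩⟩, hhi _ _⟩
  rw [this, card_image_of_injective _ (fun p p' h => hinj h), card_filter_le_posRank_add hk]

theorem card_of_mem_thickLayer {Q : V → Prop} [DecidablePred Q] (hlo : ∀ p b, ¬ Q (lo p b))
    (hhi : ∀ p b, Q (hi p b)) (hinj : ∀ {p p' b b'}, hi p b = hi p' b' → p = p')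
    (hinj' : ∀ {p p' b b'}, lo p b = lo p' b' → p = p') {k : ℕ} (hk : 0 < k)
    (hk' : k ≤ Fintype.card ι) {σ : Finset V} (hσ : σ ∈ (thickLayer lo hi k).simplices) :
    σ.card = Fintype.card ι := by
  obtain ⟨f, r, hr, rfl⟩ := hσ
  obtain ⟨q, hq⟩ := exists_posRank_eq (ι := ι) (r := Fintype.card ι - k) (by omega)
  rw [card_erase_of_mem (lo_mem_slabSimplex hr), slabSimplex_eq_insert (q := q) (by omega),
    card_insert_of_notMem, mixSimplex, card_image_of_injective, card_univ]
  · omega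
  · intro p p' h
    unfold mixVertex at h
    split_ifs at h
    exacts [hinj' h, absurd (h ▸ hhi _ _) (hlo p (f p)), absurd (h ▸ hhi _ _) (hlo p' (f p')),
      hinj h]
  · intro h
    obtain ⟨p, -, h⟩ := mem_image.1 h
    unfold mixVertex at h
    split_ifs at h
    · have := hinj' h
      subst this
      omega
    · exact hlo q (f q) (h ▸ hhi _ _)

end Rank

namespace PositionedGraph

variable {V Pos κ : Type*} [LinearOrder V] [LinearOrder Pos]
  {ι : Type*} [LinearOrder ι]

/-- The two octahedra `lo`, `hi`, with the positions embedded by `e`, are glued to each other in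
`M`. -/
structure IsGluing (M : PositionedGraph V Pos κ) (lo hi : ι → Bool → V) (e : ι → Pos) : Prop where
  mono : StrictMono e
  pos_lo : ∀ p b, M.pos (lo p b) = e p
  pos_hi : ∀ p b, M.pos (hi p b) = e p
  lower : ∀ p b, ¬ M.upper (lo p b)
  upper : ∀ p b, M.upper (hi p b)
  dom : ∀ p b, M.dom (hi p b) = Set.range e
  reg_lo : ∀ p b, M.reg (lo p b)
  reg_hi : ∀ p b, M.reg (hi p b)
  adj_lo : ∀ {p p'} b b', p ≠ p' → M.adj (lo p b) (lo p' b')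
  adj_hi : ∀ {p p'} b b', p ≠ p' → M.adj (hi p b) (hi p' b')
  adj : ∀ {p p'} b b', p < p' → M.adj (lo p b) (hi p' b') ∧ M.adj (hi p' b') (lo p b)
  adj_self : ∀ p b, M.adj (lo p b) (hi p b) ∧ M.adj (hi p b) (lo p b)
  kind_lo : ∀ {p b v}, M.reg v → (M.pos v = e p ∧ M.kind v = M.kind (lo p b) ↔ ∃ b', v = lo p b')
  kind_hi : ∀ {p b v}, M.reg v → (M.pos v = e p ∧ M.kind v = M.kind (hi p b) ↔ ∃ b', v = hi p b')
  lo_ne : ∀ p, lo p false ≠ lo p true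

/-- `ρ` is a transversal clique of the positions outside the gluing, and it can be joined with the
two octahedra. -/
structure IsRest (M : PositionedGraph V Pos κ) (lo hi : ι → Bool → V) (e : ι → Pos)
    (ρ : Finset V) : Prop where
  good : M.IsGood ρ
  inj : Set.InjOn M.pos ρ
  pos : ∀ v ∈ ρ, M.pos v ∉ Set.range e
  adj_lo : ∀ v ∈ ρ, ∀ p b, M.adj v (lo p b) ∧ M.adj (lo p b) v
  adj_hi : ∀ v ∈ ρ, ∀ p b, M.adj v (hi p b) ∧ M.adj (hi p b) v

variable {M : PositionedGraph V Pos κ} {lo hi : ι → Bool → V} {e : ι → Pos} {ρ : Finset V}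

theorem IsGood.insert_vertex {τ : Finset V} (h : M.IsGood τ) {x : V} (hx : M.reg x)
    (hadj : ∀ v ∈ τ, v ≠ x → M.adj x v ∧ M.adj v x) : M.IsGood (insert x τ) := by
  refine ⟨fun v hv => ?_, fun v hv w hw hne => ?_⟩
  · rcases mem_insert.1 hv with rfl | hv
    exacts [hx, h.1 v hv]
  · rcases mem_insert.1 hv with hv' | hv' <;> rcases mem_insert.1 hw with hw' | hw'
    · exact absurd (hv'.trans hw'.symm) hne
    · subst hv'; exact (hadj w hw' hne.symm).1
    · subst hw'; exact (hadj v hv' hne).2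
    · exact h.2 v hv' w hw' hne

namespace IsGluing

theorem inj (G : M.IsGluing lo hi e) : Function.Injective e :=
  G.mono.injective

theorem lo_injective (G : M.IsGluing lo hi e) {p : ι} {b b' : Bool} (h : lo p b = lo p b') :
    b = b' := by
  cases b <;> cases b'
  exacts [rfl, absurd h (G.lo_ne p), absurd h.symm (G.lo_ne p), rfl]

variable [Fintype ι]

theorem pos_mixVertex (G : M.IsGluing lo hi e) (k : ℕ) (f : ι → Bool) (p : ι) :
    M.pos (mixVertex lo hi k f p) = e p := by
  unfold mixVertex
  split_ifs
  exacts [G.pos_lo _ _, G.pos_hi _ _]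

theorem reg_mixVertex (G : M.IsGluing lo hi e) (k : ℕ) (f : ι → Bool) (p : ι) :
    M.reg (mixVertex lo hi k f p) := by
  unfold mixVertex
  split_ifs
  exacts [G.reg_lo _ _, G.reg_hi _ _]

theorem adj_mixVertex (G : M.IsGluing lo hi e) (k : ℕ) (f : ι → Bool) {p p' : ι} (h : p ≠ p') :
    M.adj (mixVertex lo hi k f p) (mixVertex lo hi k f p') := by
  unfold mixVertex
  split_ifs with h1 h2 h2
  · exact G.adj_lo _ _ h
  · exact (G.adj _ _ (posRank_strictMono.lt_iff_lt.1 (by omega))).1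
  · exact (G.adj _ _ (posRank_strictMono.lt_iff_lt.1 (by omega))).2
  · exact G.adj_hi _ _ h

theorem lo_notMem_mix (G : M.IsGluing lo hi e) {k : ℕ} {f : ι → Bool} {q : ι}
    (hq : posRank q + k = Fintype.card ι)
    (b : Bool) : lo q b ∉ mixSimplex lo hi k f := by
  intro h
  obtain ⟨p, -, hp⟩ := mem_image.1 h
  have : p = q := G.inj (by rw [← G.pos_mixVertex k f p, hp, G.pos_lo])
  subst this
  unfold mixVertex at hp
  rw [if_neg (by omega)] at hp
  exact G.lower p b (hp ▸ G.upper p (f p))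

theorem slabSimplex_erase (G : M.IsGluing lo hi e) {k : ℕ} {f : ι → Bool} {q : ι}
    (hq : posRank q + k = Fintype.card ι) :
    (slabSimplex lo hi k f).erase (lo q (f q)) = mixSimplex lo hi k f := by
  rw [slabSimplex_eq_insert hq, erase_insert (G.lo_notMem_mix hq _)]

theorem principal_eq (G : M.IsGluing lo hi e) {k : ℕ} (hk : 0 < k) (hk' : k ≤ Fintype.card ι) :
    (thickLayer lo hi k).principal = {σ | ∃ f, σ = mixSimplex lo hi k f} := by
  ext σ
  constructor
  · rintro ⟨f, q, hq, rfl⟩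
    exact ⟨f, G.slabSimplex_erase hq⟩
  · rintro ⟨f, rfl⟩
    obtain ⟨q, hq⟩ := exists_posRank_eq (ι := ι) (r := Fintype.card ι - k) (by omega)
    exact ⟨f, q, by omega, (G.slabSimplex_erase (by omega)).symm⟩

/-- A member of a layer is principal, or it misses a lower vertex before the doubled position. -/
theorem simplices_cases (G : M.IsGluing lo hi e) {k : ℕ} {σ : Finset V}
    (hσ : σ ∈ (thickLayer lo hi k).simplices) :
    (∃ f, σ = mixSimplex lo hi k f) ∨ ∃ f p, posRank p + k < Fintype.card ι ∧
      σ = (slabSimplex lo hi k f).erase (lo p (f p)) := by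
  obtain ⟨f, p, hp, rfl⟩ := hσ
  rcases hp.lt_or_eq with h | h
  · exact Or.inr ⟨f, p, h, rfl⟩
  · exact Or.inl ⟨f, G.slabSimplex_erase h⟩

theorem slabSimplex_update (G : M.IsGluing lo hi e) {k : ℕ} {f : ι → Bool} {p : ι}
    (hp : posRank p + k < Fintype.card ι)
    (b : Bool) :
    slabSimplex lo hi k (Function.update f p b) =
      insert (lo p b) ((slabSimplex lo hi k f).erase (lo p (f p))) := by
  ext x
  simp only [slabSimplex, mem_union, mem_image, mem_filter, mem_univ, true_and, mem_insert,
    mem_erase]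
  constructor
  · rintro (⟨r, hr, rfl⟩ | ⟨r, hr, rfl⟩)
    · by_cases h : r = p
      · subst h; left; rw [Function.update_self]
      · right
        rw [Function.update_of_ne h]
        exact ⟨fun e => h (G.inj (by rw [← G.pos_lo r (f r), e, G.pos_lo])),
          Or.inl ⟨r, hr, rfl⟩⟩
    · have h : r ≠ p := by rintro rfl; omega
      right
      rw [Function.update_of_ne h]
      exact ⟨fun e => G.lower p (f p) (e ▸ G.upper r (f r)), Or.inr ⟨r, hr, rfl⟩⟩
  · rintro (rfl | ⟨hne, ⟨r, hr, rfl⟩ | ⟨r, hr, rfl⟩⟩)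
    · exact Or.inl ⟨p, hp.le, by rw [Function.update_self]⟩
    · have h : r ≠ p := by rintro rfl; exact hne rfl
      exact Or.inl ⟨r, hr, by rw [Function.update_of_ne h]⟩
    · have h : r ≠ p := by rintro rfl; omega
      exact Or.inr ⟨r, hr, by rw [Function.update_of_ne h]⟩

theorem mixSimplex_union_eq_of_forall (G : M.IsGluing lo hi e) {σ : Finset V}
    (hinj : Set.InjOn M.pos σ) {k : ℕ}
    {f : ι → Bool} (hf : ∀ p, mixVertex lo hi k f p ∈ σ) {S : Set Pos} [DecidablePred (· ∈ S)]
    (hS : S = Set.range e) :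
    σ = mixSimplex lo hi k f ∪ σ.filter (fun v => M.pos v ∉ S) := by
  subst hS
  ext x
  simp only [mem_union, mixSimplex, mem_image, mem_univ, true_and, mem_filter]
  constructor
  · intro hx
    by_cases h : M.pos x ∈ Set.range e
    · obtain ⟨p, hp⟩ := h
      exact Or.inl ⟨p, hinj (hf p) hx (by rw [G.pos_mixVertex, hp])⟩
    · exact Or.inr ⟨hx, h⟩
  · rintro (⟨p, rfl⟩ | h)
    exacts [hf p, h.1]

theorem exchange_mixVertex (G : M.IsGluing lo hi e) {σ σ' : Finset V} {k : ℕ} {f : ι → Bool}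
    (hf : ∀ p, mixVertex lo hi k f p ∈ σ) {v v' : V} (hv' : v' ∈ σ') (hr : M.reg v')
    (he : σ.erase v = σ'.erase v') (hp : M.pos v = M.pos v') (hk : M.kind v = M.kind v') :
    ∃ f', ∀ p, mixVertex lo hi k f' p ∈ σ' := by
  have : ∀ p, ∃ b, (if posRank p + k < Fintype.card ι then lo p b else hi p b) ∈ σ' := by
    intro p
    by_cases h : mixVertex lo hi k f p = v
    · have hpos := G.pos_mixVertex k f p
      rw [h, hp] at hpos
      unfold mixVertex at h
      split_ifs at h ⊢
      · obtain ⟨b, rfl⟩ := (G.kind_lo hr).1 ⟨hpos, by rw [← hk, ← h]⟩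
        exact ⟨b, hv'⟩
      · obtain ⟨b, rfl⟩ := (G.kind_hi hr).1 ⟨hpos, by rw [← hk, ← h]⟩
        exact ⟨b, hv'⟩
    · have : mixVertex lo hi k f p ∈ σ'.erase v' := by rw [← he]; simp [h, hf p]
      exact ⟨f p, mem_of_mem_erase this⟩
  choose f' hf' using this
  exact ⟨f', hf'⟩

variable [Fintype Pos]

theorem transversal (G : M.IsGluing lo hi e) (R : M.IsRest lo hi e ρ)
    (hρ : ρ.card + Fintype.card ι = Fintype.card Pos)
    (k : ℕ) (f : ι → Bool) : M.IsTransversal (mixSimplex lo hi k f ∪ ρ) := by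
  have hinj : Function.Injective (mixVertex lo hi k f) := fun p p' h =>
    G.inj (by rw [← G.pos_mixVertex k f p, h, G.pos_mixVertex])
  refine ⟨⟨?_, ?_⟩, ?_, ?_⟩
  · intro v hv
    rcases mem_union.1 hv with hv | hv
    · obtain ⟨p, -, rfl⟩ := mem_image.1 hv
      exact G.reg_mixVertex _ _ _
    · exact R.good.1 v hv
  · intro v hv w hw hne
    have key : ∀ x ∈ ρ, ∀ p, M.adj x (mixVertex lo hi k f p) ∧ M.adj (mixVertex lo hi k f p) x := by
      intro x hx p
      unfold mixVertex
      split_ifs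
      exacts [R.adj_lo x hx _ _, R.adj_hi x hx _ _]
    rcases mem_union.1 hv with hv | hv <;> rcases mem_union.1 hw with hw | hw
    · obtain ⟨p, -, rfl⟩ := mem_image.1 hv
      obtain ⟨p', -, rfl⟩ := mem_image.1 hw
      exact G.adj_mixVertex k f fun e => hne (by rw [e])
    · obtain ⟨p, -, rfl⟩ := mem_image.1 hv
      exact (key w hw p).2
    · obtain ⟨p, -, rfl⟩ := mem_image.1 hw
      exact (key v hv p).1
    · exact R.good.2 v hv w hw hne
  · rw [card_union_of_disjoint, mixSimplex, card_image_of_injective _ hinj, card_univ, add_comm, hρ]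
    rw [disjoint_left]
    intro x hx hx'
    obtain ⟨p, -, rfl⟩ := mem_image.1 hx
    exact R.pos _ hx' ⟨p, (G.pos_mixVertex _ _ _).symm⟩
  · intro x hx y hy he
    rw [coe_union] at hx hy
    rcases hx with hx | hx <;> rcases hy with hy | hy
    · obtain ⟨p, -, rfl⟩ := mem_image.1 (mem_coe.1 hx)
      obtain ⟨p', -, rfl⟩ := mem_image.1 (mem_coe.1 hy)
      rw [G.pos_mixVertex, G.pos_mixVertex] at he
      rw [G.inj he]
    · obtain ⟨p, -, rfl⟩ := mem_image.1 (mem_coe.1 hx)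
      exact absurd ⟨p, by rw [← he, G.pos_mixVertex]⟩ (R.pos y hy)
    · obtain ⟨p, -, rfl⟩ := mem_image.1 (mem_coe.1 hy)
      exact absurd ⟨p, by rw [he, G.pos_mixVertex]⟩ (R.pos x hx)
    · exact R.inj hx hy he

theorem isSlab (G : M.IsGluing lo hi e) (R : M.IsRest lo hi e ρ)
    (hρ : ρ.card + Fintype.card ι = Fintype.card Pos)
    {k : ℕ} (f : ι → Bool) {q : ι} (hq : posRank q + k = Fintype.card ι) :
    M.IsSlab (slabSimplex lo hi k f ∪ ρ) (lo q (f q)) (hi q (f q)) ∧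
      (slabSimplex lo hi k f ∪ ρ).erase (lo q (f q)) = mixSimplex lo hi k f ∪ ρ := by
  have hT := G.transversal R hρ k f
  have hn : lo q (f q) ∉ mixSimplex lo hi k f ∪ ρ := by
    intro h
    rcases mem_union.1 h with h | h
    · exact G.lo_notMem_mix hq _ h
    · exact R.pos _ h ⟨q, (G.pos_lo _ _).symm⟩
  have heq : slabSimplex lo hi k f ∪ ρ = insert (lo q (f q)) (mixSimplex lo hi k f ∪ ρ) := by
    rw [slabSimplex_eq_insert hq, insert_union]
  have hhi : hi q (f q) ∈ mixSimplex lo hi k f ∪ ρ :=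
    mem_union_left _ (mem_image.2 ⟨q, mem_univ _, if_neg (by omega)⟩)
  have her : (slabSimplex lo hi k f ∪ ρ).erase (lo q (f q)) = mixSimplex lo hi k f ∪ ρ := by
    rw [heq, erase_insert hn]
  refine ⟨⟨?_, ?_, ?_, ?_, by rw [G.pos_lo, G.pos_hi], G.lower _ _, G.upper _ _, ?_⟩, her⟩
  · rw [heq]
    refine hT.good.insert_vertex (G.reg_lo _ _) fun v hv hne => ?_
    rcases mem_union.1 hv with hv | hv
    · obtain ⟨p, -, rfl⟩ := mem_image.1 hv
      unfold mixVertex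
      by_cases hp : p = q
      · subst hp
        rw [if_neg (by omega)]
        exact G.adj_self _ _
      · split_ifs with h
        · exact ⟨G.adj_lo _ _ (Ne.symm hp), G.adj_lo _ _ hp⟩
        · have : q < p := posRank_strictMono.lt_iff_lt.1 (by
            have : posRank p ≠ posRank q := fun e => hp (posRank_strictMono.injective e)
            omega)
          exact G.adj _ _ this
    · exact (R.adj_lo v hv _ _).symm
  · rw [heq, card_insert_of_notMem hn, hT.card]
  · rw [heq]; exact mem_insert_self _ _
  · rw [heq]; exact mem_insert_of_mem hhi
  · rw [her]; exact hT.inj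

theorem isLowerFace (G : M.IsGluing lo hi e) (R : M.IsRest lo hi e ρ)
    (hρ : ρ.card + Fintype.card ι = Fintype.card Pos)
    {k : ℕ} (hk : 0 < k) {f : ι → Bool} {p : ι} (hp : posRank p + k < Fintype.card ι)
    {A : Layer V} (hA : mixSimplex lo hi k f ∪ ρ ∈ A.principal) :
    M.IsLowerFace A ((slabSimplex lo hi k f).erase (lo p (f p)) ∪ ρ) := by
  obtain ⟨q, hq⟩ := exists_posRank_eq (ι := ι) (r := Fintype.card ι - k) (by omega)
  have hq' : posRank q + k = Fintype.card ι := by omega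
  obtain ⟨hs, he⟩ := G.isSlab R hρ f hq'
  have hpq : p ≠ q := by rintro rfl; omega
  have hnρ : ∀ b, lo p b ∉ ρ := fun b h => R.pos _ h ⟨p, (G.pos_lo _ _).symm⟩
  have hb : f p ≠ !(f p) := by simp
  have hne : ∀ r, lo r (f r) ≠ lo p (!(f p)) := by
    intro r e
    have : r = p := G.inj (by rw [← G.pos_lo r (f r), e, G.pos_lo])
    subst this
    exact hb (G.lo_injective e)
  refine ⟨slabSimplex lo hi k f ∪ ρ, lo q (f q), hi q (f q), lo p (f p), lo p (!(f p)), hs,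
    by rwa [he], mem_union_left _ (lo_mem_slabSimplex hp.le),
    fun e => hpq (G.inj (by rw [← G.pos_lo p (f p), e, G.pos_lo])), G.lower _ _,
    by rw [G.dom, G.pos_lo]; exact ⟨p, rfl⟩, ?_, ?_, ?_, by rw [G.pos_lo, G.pos_lo],
    ((G.kind_lo (G.reg_lo _ _)).2 ⟨_, rfl⟩).2⟩
  · rw [erase_union_distrib, erase_eq_of_notMem (hnρ _)]
  · intro h
    rcases mem_union.1 h with h | h
    · simp only [slabSimplex, mem_union, mem_image, mem_filter, mem_univ, true_and] at h
      rcases h with ⟨r, -, e⟩ | ⟨r, -, e⟩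
      · exact hne r e
      · exact G.lower p _ (e ▸ G.upper r (f r))
    · exact hnρ _ h
  · rw [erase_union_distrib, erase_eq_of_notMem (hnρ _), ← insert_union,
      ← G.slabSimplex_update hp]
    exact (G.isSlab R hρ _ hq').1.good

/-- A transversal clique whose vertices at the positions of a gluing belong to the two octahedra is
a principal simplex of one of its layers: lower vertices precede the upper ones. -/
theorem exists_mixVertex_mem (G : M.IsGluing lo hi e) {σ : Finset V} (hσ : M.IsTransversal σ)
    (h : ∀ p, ∃ b, lo p b ∈ σ ∨ hi p b ∈ σ) :
    ∃ k f, k ≤ Fintype.card ι ∧ (∀ p, mixVertex lo hi k f p ∈ σ) ∧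
      ((∃ p b, hi p b ∈ σ) → 0 < k) := by
  classical
  choose f hf using h
  set U := univ.filter (fun p => hi p (f p) ∈ σ) with hUdef
  have hU : ∀ p ∈ U, ∀ q, p ≤ q → q ∈ U := by
    intro p hp q hpq
    rw [hUdef, mem_filter] at hp ⊢
    refine ⟨mem_univ _, ?_⟩
    by_contra hq
    have hlo := (hf q).resolve_right hq
    have hne : lo q (f q) ≠ hi p (f p) := fun e => G.lower q (f q) (e ▸ G.upper p (f p))
    have hle := M.pos_le (hσ.good.2 _ hlo _ hp.2 hne) (G.lower _ _) (G.upper _ _)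
      (by rw [G.dom, G.pos_lo]; exact ⟨q, rfl⟩)
    rw [G.pos_lo, G.pos_hi] at hle
    have hqp : q = p := le_antisymm (G.mono.le_iff_le.1 hle) hpq
    exact hq (hqp ▸ hp.2)
  refine ⟨U.card, f, card_le_univ U, fun p => ?_, ?_⟩
  · unfold mixVertex
    have hp := mem_iff_card_le_of_isUpperSet hU p
    rw [hUdef, mem_filter, ← hUdef] at hp
    split_ifs with h
    · exact (hf p).resolve_right fun h1 => by
        have := hp.1 ⟨mem_univ _, h1⟩
        omega
    · exact (hp.2 (by omega)).2
  · rintro ⟨p, b, hb⟩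
    refine card_pos.2 ⟨p, ?_⟩
    rw [hUdef, mem_filter]
    refine ⟨mem_univ _, ?_⟩
    rcases hf p with h1 | h1
    · have := hσ.inj h1 hb (by rw [G.pos_lo, G.pos_hi])
      exact absurd (this ▸ G.upper p b) (G.lower _ _)
    · exact h1

end IsGluing

end PositionedGraph

/-! ### A single gluing -/

section SingleGluing

variable (p : ℕ)

/-- The thickening of an octahedron as a graph with positions: two vertices are adjacent if they
span a simplex. The kinds are the two copies. -/
def thickGraph : PositionedGraph ((Fin p ×ₗ Bool) ×ₗ Bool) (Fin p) Bool where
  reg _ := True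
  adj z w := ((ofLex (ofLex z).1).1 = (ofLex (ofLex w).1).1 → (ofLex z).1 = (ofLex w).1) ∧
    ((ofLex z).2 = false → (ofLex w).2 = true → (ofLex z).1 ≤ (ofLex w).1) ∧
    ((ofLex z).2 = true → (ofLex w).2 = false → (ofLex w).1 ≤ (ofLex z).1)
  pos z := (ofLex (ofLex z).1).1
  kind z := (ofLex z).2
  label := octahedronLabel
  upper z := (ofLex z).2 = true
  dom _ := Set.univ
  lt_of_pos_lt _ h := Prod.Lex.lt_iff.2 (Or.inl (Prod.Lex.lt_iff.2 (Or.inl h)))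
  label_eq h hp _ := by simp only [octahedronLabel, h.1 hp]
  upper_iff_not := by
    intro z w h hp hne
    have h1 : (ofLex z).2 ≠ (ofLex w).2 := fun e => hne (ofLex.injective (Prod.ext (h.1 hp) e))
    revert h1
    cases (ofLex z).2 <;> cases (ofLex w).2 <;> simp
  upper_congr h := by rw [h]
  odd_label := by
    intro z w _ _ hp hk hne
    have h1 : (ofLex (ofLex z).1).2 ≠ (ofLex (ofLex w).1).2 := fun e =>
      hne (ofLex.injective (Prod.ext (ofLex.injective (Prod.ext hp e)) hk))
    unfold octahedronLabel
    rw [hp]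
    generalize ((ofLex (ofLex w).1).1 : ℕ) = m
    revert h1
    cases (ofLex (ofLex z).1).2 <;> cases (ofLex (ofLex w).1).2 <;>
      simp only [ne_eq, not_true_eq_false, reduceCtorEq, not_false_eq_true, false_imp_iff,
        true_imp_iff, if_true, if_false, Bool.false_eq_true]
    · exact ⟨2 * m + 1, by ring⟩
    · exact ⟨2 * m + 1, by ring⟩
  pos_mem_dom _ := Set.mem_univ _
  dom_eq _ _ _ := rfl
  pos_le {a b} h ha hb _ := by
    rcases Prod.Lex.le_iff.1 (h.2.1 (by simpa using ha) hb) with h1 | h1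
    exacts [h1.le, h1.1.le]
  kind_eq _ _ hw hw' _ _ _ _ _ _ _ := by
    rw [Bool.not_eq_true] at hw hw'
    rw [hw, hw']

theorem mem_thickening_iff {τ : Finset ((Fin p ×ₗ Bool) ×ₗ Bool)} :
    τ ∈ thickening (octahedron p) ↔ τ.Nonempty ∧ (thickGraph p).IsGood τ := by
  have hmem : τ ∈ thickening (octahedron p) ↔
      ((τ.image (fun z => (ofLex z).1)).Nonempty ∧
        ∀ u ∈ τ.image (fun z => (ofLex z).1), ∀ v ∈ τ.image (fun z => (ofLex z).1),
          (ofLex u).1 = (ofLex v).1 → u = v) ∧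
      ∀ u v, toLex (u, false) ∈ τ → toLex (v, true) ∈ τ → u ≤ v := Iff.rfl
  rw [hmem, image_nonempty]
  constructor
  · rintro ⟨⟨h1, h2⟩, h3⟩
    refine ⟨h1, fun _ _ => trivial, fun z hz w hw _ => ⟨fun e => ?_, fun e1 e2 => ?_,
      fun e1 e2 => ?_⟩⟩
    · exact h2 _ (mem_image_of_mem _ hz) _ (mem_image_of_mem _ hw) e
    · exact h3 _ _ (by rw [← e1]; exact hz) (by rw [← e2]; exact hw)
    · exact h3 _ _ (by rw [← e2]; exact hw) (by rw [← e1]; exact hz)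
  · rintro ⟨h1, -, h2⟩
    refine ⟨⟨h1, fun u hu v hv e => ?_⟩, fun u v hu hv => ?_⟩
    · obtain ⟨z, hz, rfl⟩ := mem_image.1 hu
      obtain ⟨w, hw, rfl⟩ := mem_image.1 hv
      by_cases hzw : z = w
      · rw [hzw]
      · exact (h2 z hz w hw hzw).1 e
    · exact (h2 _ hu _ hv (by simp)).2.1 rfl rfl

theorem isGluing_octahedronCopy :
    (thickGraph p).IsGluing (octahedronCopy p false) (octahedronCopy p true) id where
  mono := strictMono_id
  pos_lo _ _ := rfl
  pos_hi _ _ := rfl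
  lower _ _ := by simp [thickGraph, octahedronCopy]
  upper _ _ := rfl
  dom _ _ := by simp [thickGraph]
  reg_lo _ _ := trivial
  reg_hi _ _ := trivial
  adj_lo _ _ h := by simp [thickGraph, octahedronCopy, h]
  adj_hi _ _ h := by simp [thickGraph, octahedronCopy, h]
  adj _ _ h := by
    simp [thickGraph, octahedronCopy, h.ne, h.ne', Prod.Lex.le_iff, h]
  adj_self _ _ := by simp [thickGraph, octahedronCopy]
  kind_lo := by
    intro i b z _
    constructor
    · rintro ⟨h1, h2⟩
      exact ⟨(ofLex (ofLex z).1).2,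
        ofLex.injective (Prod.ext (ofLex.injective (Prod.ext h1 rfl)) h2)⟩
    · rintro ⟨b', rfl⟩
      exact ⟨rfl, rfl⟩
  kind_hi := by
    intro i b z _
    constructor
    · rintro ⟨h1, h2⟩
      exact ⟨(ofLex (ofLex z).1).2,
        ofLex.injective (Prod.ext (ofLex.injective (Prod.ext h1 rfl)) h2)⟩
    · rintro ⟨b', rfl⟩
      exact ⟨rfl, rfl⟩
  lo_ne _ := by simp [octahedronCopy]

theorem isRest_empty :
    (thickGraph p).IsRest (octahedronCopy p false) (octahedronCopy p true) id ∅ := by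
  constructor <;> simp [PositionedGraph.IsGood]

variable {p}

theorem transversal_mixSimplex (k : ℕ) (f : Fin p → Bool) :
    (thickGraph p).IsTransversal
      (mixSimplex (octahedronCopy p false) (octahedronCopy p true) k f) := by
  have := (isGluing_octahedronCopy p).transversal (isRest_empty p) (by simp) k f
  rwa [union_empty] at this

theorem eq_mixSimplex_of_forall {σ : Finset ((Fin p ×ₗ Bool) ×ₗ Bool)}
    (hσ : (thickGraph p).IsTransversal σ) {k : ℕ} {f : Fin p → Bool}
    (hf : ∀ i, mixVertex (octahedronCopy p false) (octahedronCopy p true) k f i ∈ σ) :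
    σ = mixSimplex (octahedronCopy p false) (octahedronCopy p true) k f := by
  classical
  have := (isGluing_octahedronCopy p).mixSimplex_union_eq_of_forall hσ.inj hf
    (S := Set.univ) (by simp)
  rw [this]
  simp

theorem simplicesOfDim_octahedron (hp : 0 < p) :
    simplicesOfDim ((octahedron p).map (fun u => (toLex (u, false) : (Fin p ×ₗ Bool) ×ₗ Bool)))
      (p - 1) =
    {σ | ∃ f, σ = mixSimplex (octahedronCopy p false) (octahedronCopy p true) 0 f} := by
  ext σ
  constructor
  · rintro ⟨⟨s, ⟨hs1, hs2⟩, rfl⟩, hc⟩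
    have hgood : (thickGraph p).IsGood
        (s.image (fun u => (toLex (u, false) : (Fin p ×ₗ Bool) ×ₗ Bool))) := by
      refine ((mem_thickening_iff p).1 ⟨⟨?_, ?_⟩, ?_⟩).2
      · simpa using hs1
      · intro u hu v hv e
        simp only [mem_image, exists_exists_and_eq_and, ofLex_toLex, exists_eq_right] at hu hv
        exact hs2 u hu v hv e
      · intro u v _ hv
        simp at hv
    have hT : (thickGraph p).IsTransversal
        (s.image (fun u => (toLex (u, false) : (Fin p ×ₗ Bool) ×ₗ Bool))) := by
      refine ⟨hgood, ?_, ?_⟩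
      · rw [Fintype.card_fin]
        have := hc
        simp only at this
        omega
      · intro x hx y hy e
        simp only [coe_image, Set.mem_image, mem_coe] at hx hy
        obtain ⟨u, hu, rfl⟩ := hx
        obtain ⟨v, hv, rfl⟩ := hy
        rw [hs2 u hu v hv e]
    have : ∀ i, ∃ b, octahedronCopy p false i b ∈
        s.image (fun u => (toLex (u, false) : (Fin p ×ₗ Bool) ×ₗ Bool)) := by
      intro i
      obtain ⟨x, hx, hxi⟩ := hT.exists_pos i
      obtain ⟨u, hu, rfl⟩ := mem_image.1 hx
      exact ⟨(ofLex u).2, mem_image.2 ⟨u, hu, by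
        change toLex (u, false) = toLex (toLex (i, (ofLex u).2), false)
        rw [← hxi]; rfl⟩⟩
    choose f hf using this
    refine ⟨f, eq_mixSimplex_of_forall hT fun i => ?_⟩
    unfold mixVertex
    rw [if_pos (by simpa using posRank_lt_card i)]
    exact hf i
  · rintro ⟨f, rfl⟩
    refine ⟨⟨univ.image (fun i => toLex (i, f i)), ⟨?_, ?_⟩, ?_⟩, ?_⟩
    · exact ⟨_, mem_image_of_mem _ (mem_univ (⟨0, hp⟩ : Fin p))⟩
    · intro u hu v hv e
      obtain ⟨i, -, rfl⟩ := mem_image.1 hu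
      obtain ⟨j, -, rfl⟩ := mem_image.1 hv
      obtain rfl : i = j := e
      rfl
    · rw [mixSimplex_zero]
      simp only [image_image]
      rfl
    · rw [(transversal_mixSimplex 0 f).card, Fintype.card_fin]
      omega

/-- The layers of the thickening, starting with the unprimed octahedron as layer `0`. -/
theorem mem_allLayers_gluing (hp : 0 < p) {A : Layer ((Fin p ×ₗ Bool) ×ₗ Bool)}
    (hA : A ∈ PositionedGraph.allLayers
      ((octahedron p).map (fun u => (toLex (u, false) : (Fin p ×ₗ Bool) ×ₗ Bool)))
      (p - 1) (gluingLayers p)) :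
    ∃ k ≤ p, A.principal =
        {σ | ∃ f, σ = mixSimplex (octahedronCopy p false) (octahedronCopy p true) k f} ∧
      (∀ σ ∈ A.simplices, σ ∉ A.principal → ∃ f i, 0 < k ∧ posRank i + k < p ∧
        σ = (slabSimplex (octahedronCopy p false) (octahedronCopy p true) k f).erase
          (octahedronCopy p false i (f i))) ∧
      A.principal ⊆ A.simplices ∧ ∀ σ ∈ A.simplices, σ.card = p := by
  rcases List.mem_cons.1 hA with rfl | hA
  · refine ⟨0, hp.le, simplicesOfDim_octahedron hp, fun σ h1 h2 => absurd h1 h2, subset_rfl,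
      fun σ hσ => ?_⟩
    have := hσ.2
    omega
  · obtain ⟨k, hk, rfl⟩ := List.mem_map.1 hA
    rw [List.mem_range'_1] at hk
    have G := isGluing_octahedronCopy p
    have hpr := G.principal_eq (k := k) (by omega) (by rw [Fintype.card_fin]; omega)
    refine ⟨k, by omega, hpr, ?_, ?_, fun σ hσ => ?_⟩
    · intro σ h1 h2
      rcases G.simplices_cases h1 with h | ⟨f, i, hi, rfl⟩
      · rw [hpr] at h2
        exact absurd h h2
      · exact ⟨f, i, by omega, by rwa [Fintype.card_fin] at hi, rfl⟩
    · rintro σ ⟨f, i, hi, rfl⟩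
      exact ⟨f, i, hi.le, rfl⟩
    · rw [card_of_mem_thickLayer (Q := fun z => (ofLex z).2 = true) (k := k)
        (lo := octahedronCopy p false) (hi := octahedronCopy p true)
        (fun i b => G.lower i b) (fun i b => G.upper i b) ?_ ?_ (by omega)
        (by rw [Fintype.card_fin]; omega) hσ, Fintype.card_fin]
      · intro i j b b' h
        exact congrArg (thickGraph p).pos h
      · intro i j b b' h
        exact congrArg (thickGraph p).pos h

theorem isLayering_gluing (hp : 0 < p) :
    (thickGraph p).IsLayering (thickening (octahedron p)) (PositionedGraph.allLayers
      ((octahedron p).map (fun u => (toLex (u, false) : (Fin p ×ₗ Bool) ×ₗ Bool)))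
      (p - 1) (gluingLayers p)) := by
  have G := isGluing_octahedronCopy p
  have lower : ∀ {A}, A ∈ PositionedGraph.allLayers
      ((octahedron p).map (fun u => (toLex (u, false) : (Fin p ×ₗ Bool) ×ₗ Bool)))
      (p - 1) (gluingLayers p) → ∀ {σ}, σ ∈ A.simplices → σ ∉ A.principal →
      (thickGraph p).IsLowerFace A σ := by
    intro A hA σ hσ hn
    obtain ⟨k, hk, hpr, hcases, -⟩ := mem_allLayers_gluing hp hA
    obtain ⟨f, i, hk0, hi, rfl⟩ := hcases σ hσ hn
    have := G.isLowerFace (isRest_empty p) (by simp) hk0 (f := f) (p := i)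
      (by rwa [Fintype.card_fin]) (A := A) (by rw [hpr, union_empty]; exact ⟨f, rfl⟩)
    rwa [union_empty] at this
  have good : ∀ {A}, A ∈ PositionedGraph.allLayers
      ((octahedron p).map (fun u => (toLex (u, false) : (Fin p ×ₗ Bool) ×ₗ Bool)))
      (p - 1) (gluingLayers p) → ∀ {σ}, σ ∈ A.simplices → (thickGraph p).IsGood σ := by
    intro A hA σ hσ
    by_cases hn : σ ∈ A.principal
    · obtain ⟨k, hk, hpr, -⟩ := mem_allLayers_gluing hp hA
      rw [hpr] at hn
      obtain ⟨f, rfl⟩ := hn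
      exact (transversal_mixSimplex k f).good
    · obtain ⟨τ, a, b, u, -, h, -, -, -, -, -, rfl, -⟩ := lower hA hσ hn
      exact h.good.subset (erase_subset _ _)
  refine ⟨?_, ?_, ?_, ?_, ?_, ?_, ?_, ?_, ?_, ?_, ?_, ?_, ?_⟩
  · exact fun h1 h2 => (mem_thickening_iff p).2 ⟨h1, h2⟩
  · intro A hA
    obtain ⟨k, hk, -, -, h, -⟩ := mem_allLayers_gluing hp hA
    exact h
  · intro A hA σ hσ
    obtain ⟨k, hk, -, -, -, h⟩ := mem_allLayers_gluing hp hA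
    rw [h σ hσ, Fintype.card_fin]
  · intro A hA σ hσ
    refine (mem_thickening_iff p).2 ⟨?_, good hA hσ⟩
    obtain ⟨k, hk, -, -, -, h⟩ := mem_allLayers_gluing hp hA
    exact card_pos.1 (by rw [h σ hσ]; exact hp)
  · have count : ∀ k ≤ p, ∀ σ ∈ (thickLayer (octahedronCopy p false) (octahedronCopy p true)
        k).simplices, (σ.filter (fun z => (ofLex z).2 = true)).card = k := fun k hk σ hσ =>
      card_filter_thickLayer (Q := fun z => (ofLex z).2 = true) (lo := octahedronCopy p false)
        (hi := octahedronCopy p true) (fun i b => G.lower i b) (fun i b => G.upper i b)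
        (fun h => congrArg (thickGraph p).pos h) (by rwa [Fintype.card_fin]) hσ
    refine List.pairwise_cons.2 ⟨?_, ?_⟩
    · intro A hA
      obtain ⟨k, hk, rfl⟩ := List.mem_map.1 hA
      rw [List.mem_range'_1] at hk
      rw [simplicesOfDim_octahedron hp, Set.disjoint_left]
      rintro _ ⟨f, rfl⟩ hσ
      have h1 := count k (by omega) _ hσ
      rw [mixSimplex_zero, filter_eq_empty_iff.2, card_empty] at h1
      · omega
      · intro x hx
        obtain ⟨i, -, rfl⟩ := mem_image.1 hx
        exact G.lower i _
    · refine List.pairwise_map.2 ((List.pairwise_lt_range' (s := 1) (n := p)).imp_of_mem ?_)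
      intro k l hk hl hkl
      rw [List.mem_range'_1] at hk hl
      rw [Set.disjoint_left]
      intro σ h1 h2
      have := count k (by omega) σ h1
      have := count l (by omega) σ h2
      omega
  · intro A hA σ hσ
    obtain ⟨k, hk, hpr, -⟩ := mem_allLayers_gluing hp hA
    rw [hpr] at hσ
    obtain ⟨f, rfl⟩ := hσ
    exact transversal_mixSimplex k f
  · intro σ hσ
    have hall : ∀ i, ∃ b, octahedronCopy p false i b ∈ σ ∨ octahedronCopy p true i b ∈ σ := by
      intro i
      obtain ⟨z, hz, hi⟩ := hσ.exists_pos i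
      refine ⟨(ofLex (ofLex z).1).2, ?_⟩
      rcases h : (ofLex z).2
      · left
        convert hz using 1
        exact ofLex.injective (Prod.ext (ofLex.injective (Prod.ext hi.symm rfl)) h.symm)
      · right
        convert hz using 1
        exact ofLex.injective (Prod.ext (ofLex.injective (Prod.ext hi.symm rfl)) h.symm)
    obtain ⟨k, f, hk, hf, -⟩ := G.exists_mixVertex_mem hσ hall
    rw [Fintype.card_fin] at hk
    have he := eq_mixSimplex_of_forall hσ hf
    rcases Nat.eq_zero_or_pos k with rfl | hk0
    · exact ⟨_, List.mem_cons_self, by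
        change σ ∈ simplicesOfDim _ _
        rw [simplicesOfDim_octahedron hp]; exact ⟨f, he⟩⟩
    · refine ⟨_, List.mem_cons_of_mem _ (List.mem_map.2 ⟨k, ?_, rfl⟩), ?_⟩
      · rw [List.mem_range'_1]; omega
      · rw [G.principal_eq hk0 (by rwa [Fintype.card_fin])]
        exact ⟨f, he⟩
  · intro A hA σ σ' v v' hσ hσ' hv hv' hp' he
    obtain ⟨k, hk, hpr, -⟩ := mem_allLayers_gluing hp hA
    rw [hpr] at hσ hσ'
    obtain ⟨f, rfl⟩ := hσ
    obtain ⟨f', rfl⟩ := hσ'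
    obtain ⟨i, -, rfl⟩ := mem_image.1 hv
    obtain ⟨j, -, rfl⟩ := mem_image.1 hv'
    rw [G.pos_mixVertex, G.pos_mixVertex] at hp'
    obtain rfl : i = j := hp'
    unfold mixVertex
    split_ifs <;> rfl
  · intro A hA σ σ' v v' hσ hT hv hv' hp' he hkind
    obtain ⟨k, hk, hpr, -⟩ := mem_allLayers_gluing hp hA
    rw [hpr] at hσ ⊢
    obtain ⟨f, rfl⟩ := hσ
    obtain ⟨f', hf'⟩ := G.exchange_mixVertex (k := k) (f := f)
      (fun i => mem_image_of_mem _ (mem_univ i)) hv' trivial he hp' hkind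
    exact ⟨f', eq_mixSimplex_of_forall hT hf'⟩
  · exact fun hA _ hσ hn => Or.inl (lower hA hσ hn)
  · exact fun _ _ hc => absurd trivial hc.1
  · exact fun _ _ _ hc => absurd trivial hc.1
  · intro τ hX _ hg
    exact absurd ((mem_thickening_iff p).1 hX).2 hg

theorem exists_orientation_gluing (hp : 0 < p) :
    ∃ o : Finset ((Fin p ×ₗ Bool) ×ₗ Bool) → ℤˣ,
      (∀ σ ∈ simplicesOfDim (gluingFiltration p 0) (p - 1),
        o σ = (-1) ^ (∑ v ∈ σ, octahedronLabel v)) ∧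
      IsUniformOrientedFiltration (thickening (octahedron p)) (fun _ => 1) (p - 1) p
        (gluingFiltration p) o ∧
      gluingFiltration p 0 = (octahedron p).map (fun u => toLex (u, false)) ∧
      essentialSimplices (thickening (octahedron p)) (gluingFiltration p) (p - 1) 0 =
        simplicesOfDim (gluingFiltration p 0) (p - 1) ∧
      (∀ (s : ℕ) (hs : s < (gluingLayers p).length),
        addedSimplices (gluingFiltration p) (p - 1) (s + 1) =
            ((gluingLayers p)[s]).simplices ∧
        essentialSimplices (thickening (octahedron p)) (gluingFiltration p) (p - 1) (s + 1) =
            ((gluingLayers p)[s]).principal) := by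
  have L := isLayering_gluing hp
  have hd : Fintype.card (Fin p) = p - 1 + 1 := by rw [Fintype.card_fin]; omega
  have h0 : gluingFiltration p 0 = (octahedron p).map (fun u => toLex (u, false)) :=
    layerFiltration_zero _ _
  refine ⟨(thickGraph p).labelSign, fun _ _ => rfl, ?_, h0, ?_, fun s hs =>
    L.simplices_succ hd s hs⟩
  · have hlen : (gluingLayers p).length = p := by simp [gluingLayers]
    have := L.isUniformOrientedFiltration hd ?_ (w := fun _ => 1) (fun A _ => ⟨1, by simp⟩)
    · rwa [hlen] at this
    · rintro _ ⟨s, ⟨hs1, hs2⟩, rfl⟩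
      refine ⟨⟨?_, ?_⟩, ?_⟩
      · simpa using hs1
      · intro u hu v hv e
        simp only [mem_image, exists_exists_and_eq_and, ofLex_toLex, exists_eq_right] at hu hv
        exact hs2 u hu v hv e
      · intro u v _ hv
        simp at hv
  · rw [h0]
    exact L.essentialSimplices_zero hd

end SingleGluing

/-! ### The gadget complex as a graph with positions -/

section Gadget

variable {n t : ℕ} {H : Fin t → Term n}

/-- The position `{1ᵢ, 2ᵢ}` or `{3ᵢ, 4ᵢ}` of the label `l` in block `i`. -/
def slot (i : Fin n) (l : Fin 4) : Fin n ×ₗ Bool := toLex (i, decide (2 ≤ l))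

theorem slot_eq_iff {i j : Fin n} {l l' : Fin 4} :
    slot i l = slot j l' ↔ i = j ∧ (l < 2 ↔ l' < 2) := by
  unfold slot
  rw [toLex_inj, Prod.mk.injEq, decide_eq_decide]
  refine and_congr_right fun _ => ?_
  omega

theorem slot_lt_iff {i j : Fin n} {l l' : Fin 4} :
    slot i l < slot j l' ↔ i < j ∨ (i = j ∧ l < 2 ∧ 2 ≤ l') := by
  unfold slot
  rw [Prod.Lex.toLex_lt_toLex, Bool.lt_iff]
  simp

theorem slot_fst (i : Fin n) (l : Fin 4) : (ofLex (slot i l)).1 = i := rfl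

theorem octAdj_iff {i j : Fin n} {l l' : Fin 4} :
    octAdj (i, l) (j, l') ↔ slot i l ≠ slot j l' := by
  rw [Ne, slot_eq_iff]
  unfold octAdj squareAdj
  tauto

theorem thickAdj_iff {i j : Fin n} {l l' : Fin 4} :
    thickAdj (i, l) (j, l') ↔ (i = j ∧ l = l') ∨ slot i l < slot j l' := by
  unfold thickAdj
  rw [octAdj_iff, Prod.Lex.toLex_lt_toLex, slot_lt_iff, Ne, slot_eq_iff, Prod.mk.injEq]
  grind

/-- The kinds of vertices: an octahedron in the qubit graph for given bits, the middle octahedron or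
one of the two copies in the gadget of a term, or a central vertex. -/
inductive VertexKind (t : ℕ) : Type
  | base (a : Bool)
  | mid (g : Fin t)
  | copyX (g : Fin t)
  | copyY (g : Fin t)
  | central

namespace Vertex

/-- The block of a vertex; an arbitrary one for the central vertex of a filling gadget. -/
def block (hn : 0 < n) : Vertex H → Fin n
  | .qubit i _ _ => i
  | .mid _ _ i _ => i
  | .copyX _ i _ => i
  | .copyY _ _ i _ => i
  | .axis _ _ i => i
  | .apex _ _ => ⟨0, hn⟩

/-- The label of a vertex, as a number from `0` to `3`; an arbitrary one for central vertices. -/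
def lab : Vertex H → Fin 4
  | .qubit _ _ l => l
  | .mid _ _ _ l => l
  | .copyX _ _ l => l
  | .copyY _ _ _ l => l
  | .axis _ _ _ => 3
  | .apex _ _ => 0

/-- The octahedron of a regular vertex. For a qubit vertex only the bit is recorded, as its position
determines the block. -/
def kind : Vertex H → VertexKind t
  | .qubit _ a _ => .base a
  | .mid g _ _ _ => .mid g
  | .copyX g _ _ => .copyX g
  | .copyY g _ _ _ => .copyY g
  | .axis _ _ _ => .central
  | .apex _ _ => .central

/-- The upper octahedra are the copies `K'ˣ` and `K'ʸ`. -/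
def IsCopy : Vertex H → Prop
  | .copyX _ _ _ => True
  | .copyY _ _ _ _ => True
  | _ => False

/-- All vertices but the central ones are regular. -/
def IsRegular : Vertex H → Prop
  | .axis _ _ _ => False
  | .apex _ _ => False
  | _ => True

/-- The positions in the blocks on which the term of a copy acts. -/
def copyDom : Vertex H → Set (Fin n ×ₗ Bool)
  | .copyX g _ _ => {p | (ofLex p).1 ∈ (H g).supp}
  | .copyY g _ _ _ => {p | (ofLex p).1 ∈ (H g).supp}
  | _ => ∅

/-- Adjacency of regular vertices in the gadget graph without the edges `4ᵢ⁰4ᵢ¹`, in one direction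
at least. -/
def coreRel : Vertex H → Vertex H → Prop
  | .qubit i a l, .qubit j b l' => slot i l ≠ slot j l' ∧ (i = j → a = b)
  | .qubit j a l, .copyX g i l' =>
      j ∈ (H g).supp → (a = (H g).x j ∧ ((j = i ∧ l = l') ∨ slot j l < slot i l'))
  | .qubit j a l, .copyY g _ i l' =>
      j ∈ (H g).supp → (a = (H g).y j ∧ ((j = i ∧ l = l') ∨ slot j l < slot i l'))
  | .qubit j _ _, .mid g _ _ _ => j ∉ (H g).supp
  | .copyX g i l, .copyX g' i' l' => g = g' ∧ slot (i : Fin n) l ≠ slot (i' : Fin n) l'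
  | .copyY g _ i l, .copyY g' _ i' l' => g = g' ∧ slot (i : Fin n) l ≠ slot (i' : Fin n) l'
  | .mid g _ i l, .mid g' _ i' l' => g = g' ∧ slot (i : Fin n) l ≠ slot (i' : Fin n) l'
  | .mid g _ i l, .copyX g' i' l' =>
      g = g' ∧ (((i : Fin n) = i' ∧ l = l') ∨ slot (i : Fin n) l < slot (i' : Fin n) l')
  | .mid g _ i l, .copyY g' _ i' l' =>
      g = g' ∧ (((i : Fin n) = i' ∧ l = l') ∨ slot (i : Fin n) l < slot (i' : Fin n) l')
  | _, _ => False

/-- Adjacency of regular vertices in the gadget graph without the edges `4ᵢ⁰4ᵢ¹`. -/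
def CoreAdj (v w : Vertex H) : Prop := coreRel v w ∨ coreRel w v

theorem CoreAdj.symm {v w : Vertex H} (h : CoreAdj v w) : CoreAdj w v := Or.symm h

theorem coreAdj_iff {v w : Vertex H} (hne : v ≠ w) : CoreAdj v w ↔
    v.IsRegular ∧ w.IsRegular ∧ (gadgetGraph H).Adj v w ∧
      ∀ i a b l l', v = .qubit i a l → w = .qubit i b l' → a = b := by
  unfold gadgetGraph CoreAdj
  rw [SimpleGraph.fromRel_adj]
  cases v <;> cases w <;>
    simp only [coreRel, gadgetRel, IsRegular, thickAdj_iff, octAdj_iff, true_and, and_true,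
      false_and, and_false, or_false, false_or, iff_self, reduceCtorEq, false_imp_iff,
      imp_true_iff, hne, ne_eq, not_false_eq_true, qubit.injEq]
  case qubit.qubit i a l j b l' =>
    have h : (∀ i' a' b' m m', (i = i' ∧ a = a' ∧ l = m) → (j = i' ∧ b = b' ∧ l' = m') → a' = b') ↔
        (i = j → a = b) := by
      constructor
      · rintro h rfl
        exact h _ _ _ _ _ ⟨rfl, rfl, rfl⟩ ⟨rfl, rfl, rfl⟩
      · rintro h _ _ _ _ _ ⟨rfl, rfl, rfl⟩ ⟨rfl, rfl, rfl⟩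
        exact h rfl
    rw [h]
    simp only [slot_eq_iff, squareAdj]
    grind

theorem eq_of_kind_eq {hn : 0 < n} {v w : Vertex H} (hv : v.IsRegular) (hk : v.kind = w.kind)
    (hb : v.block hn = w.block hn) (hl : v.lab = w.lab) : v = w := by
  cases v <;> cases w <;>
    simp only [kind, IsRegular, block, lab, reduceCtorEq, VertexKind.base.injEq,
      VertexKind.mid.injEq, VertexKind.copyX.injEq, VertexKind.copyY.injEq] at *
  all_goals
    subst hk hl
    first
    | subst hb; rfl
    | rw [Subtype.val_inj] at hb; subst hb; rfl

/-- The gadget complex as a graph with positions. The edges `4ᵢ⁰4ᵢ¹` and the central vertices are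
left out; each copy `K'ˣ`, `K'ʸ` extends to the blocks on which its term acts. -/
def coreGraph (H : Fin t → Term n) (hn : 0 < n) :
    PositionedGraph (Vertex H) (Fin n ×ₗ Bool) (VertexKind t) where
  reg := IsRegular
  adj := CoreAdj
  pos v := slot (v.block hn) v.lab
  kind := kind
  label v := (v.lab : ℕ) + 1
  upper := IsCopy
  dom := copyDom
  lt_of_pos_lt := by
    intro v w h hlt
    rw [slot_lt_iff] at hlt
    change v.key < w.key
    cases v <;> cases w <;>
      simp only [CoreAdj, coreRel, block, lab, key, Prod.Lex.toLex_lt_toLex, slot_lt_iff,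
        or_false, false_or] at * <;> grind
  label_eq := by
    intro v w h hp hne
    cases v <;> cases w <;>
      simp only [CoreAdj, coreRel, block, lab, slot_lt_iff, slot_eq_iff, ne_eq, or_false,
        false_or] at * <;>
      grind
  upper_iff_not := by
    intro v w h hp hne
    cases v <;> cases w <;>
      simp only [CoreAdj, coreRel, block, lab, slot_lt_iff, slot_eq_iff, ne_eq, or_false, false_or,
        IsCopy] at * <;>
      grind
  upper_congr := by
    intro v w h
    cases v <;> cases w <;> simp_all [kind, IsCopy]
  odd_label := by
    intro v w hv hw hp hk hne
    rw [slot_eq_iff] at hp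
    have hl : v.lab ≠ w.lab := fun hl => hne (eq_of_kind_eq hv hk hp.1 hl)
    have hl' := hp.2
    revert hl hl'
    generalize v.lab = l
    generalize w.lab = l'
    revert l l'
    decide
  pos_mem_dom := by
    intro b hb
    cases b <;> simp_all [IsCopy, copyDom, block, slot]
  dom_eq := by
    intro b b' h hb hb'
    cases b <;> cases b' <;> simp only [IsCopy, CoreAdj, coreRel, or_false] at *
    all_goals
      obtain rfl : _ = _ := h.elim And.left fun h => h.1.symm
      rfl
  pos_le := by
    intro a b h ha hb hd
    rw [le_iff_lt_or_eq]
    cases a <;> cases b <;>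
      simp only [CoreAdj, coreRel, block, lab, slot_lt_iff, slot_eq_iff, or_false,
        IsCopy, not_true_eq_false, copyDom, Set.mem_ofPred_eq, slot_fst] at * <;>
      grind
  kind_eq := by
    intro a b w w' ha hb hw hw' hp hda hdw h1 h2 h3 h4
    cases a <;> cases b <;> simp only [IsCopy, not_true_eq_false, not_false_eq_true] at ha hb <;>
    cases w <;> simp only [IsCopy, not_true_eq_false, not_false_eq_true] at hw <;>
    cases w' <;>
      simp only [CoreAdj, coreRel, block, lab, slot_lt_iff, slot_eq_iff, ne_eq, or_false, false_or,
        IsCopy, not_true_eq_false, not_false_eq_true, copyDom, Set.mem_ofPred_eq, slot_fst, kind,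
        VertexKind.base.injEq] at * <;>
      grind

end Vertex
end Gadget

/-! ### The octahedra of a term -/

section Gadget

variable {n t : ℕ} {H : Fin t → Term n} {hn : 0 < n} {g : Fin t}

open Vertex

theorem slot_posLabel (i : Fin n) (h b : Bool) : slot i (posLabel h b) = toLex (i, h) := by
  cases h <;> cases b <;> rfl

theorem exists_posLabel_eq (l : Fin 4) : ∃ b, posLabel (decide (2 ≤ l)) b = l := by
  revert l; decide

/-- The positions of the octahedra of the term `g`, as positions in the whole graph. -/
def gadgetEmb (H : Fin t → Term n) (g : Fin t) (p : GadgetPos H g) : Fin n ×ₗ Bool :=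
  toLex (((ofLex p).1 : Fin n), (ofLex p).2)

theorem gadgetEmb_strictMono : StrictMono (gadgetEmb H g) := by
  intro p q h
  rw [Prod.Lex.lt_iff] at h
  unfold gadgetEmb
  rw [Prod.Lex.toLex_lt_toLex]
  rcases h with h | ⟨h1, h2⟩
  · exact Or.inl h
  · exact Or.inr ⟨congrArg Subtype.val h1, h2⟩

theorem range_gadgetEmb : Set.range (gadgetEmb H g) = {p | (ofLex p).1 ∈ (H g).supp} := by
  ext q
  constructor
  · rintro ⟨p, rfl⟩
    exact (ofLex p).1.2
  · intro hq
    exact ⟨toLex (⟨_, hq⟩, (ofLex q).2), rfl⟩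

theorem card_gadgetPos : Fintype.card (GadgetPos H g) = 2 * (H g).supp.card := by
  rw [Fintype.card_lex, Fintype.card_prod, Fintype.card_coe, Fintype.card_bool, mul_comm]

theorem Term.supp_nonempty (T : Term n) : T.supp.Nonempty := by
  cases T with
  | fill I hI x => exact hI
  | glue I x y hxy => exact hxy.imp fun _ h => h.1

theorem card_gadgetPos_ge : 2 ≤ Fintype.card (GadgetPos H g) := by
  rw [card_gadgetPos]
  have := (H g).supp_nonempty.card_pos
  omega

theorem eq_octahedron_vertex_iff {c : GadgetPos H g → Bool → Vertex H}
    (hreg : ∀ p b, (c p b).IsRegular) (hb : ∀ p b, (c p b).block hn = (ofLex p).1)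
    (hl : ∀ p b, (c p b).lab = posLabel (ofLex p).2 b) (hk : ∀ p b b', (c p b).kind = (c p b').kind)
    {p : GadgetPos H g} {b : Bool} {v : Vertex H} :
    slot (v.block hn) v.lab = gadgetEmb H g p ∧ v.kind = (c p b).kind ↔ ∃ b', v = c p b' := by
  constructor
  · rintro ⟨h1, h2⟩
    obtain ⟨h3, h4⟩ := Prod.mk.injEq _ _ _ _ ▸ toLex_inj.1 h1
    obtain ⟨b', hb'⟩ := exists_posLabel_eq v.lab
    refine ⟨b', (eq_of_kind_eq (hn := hn) (hreg p b') ?_ ?_ ?_).symm⟩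
    · rw [h2, hk]
    · rw [hb, h3]
    · rw [hl, ← h4, hb']
  · rintro ⟨b', rfl⟩
    refine ⟨?_, hk _ _ _⟩
    rw [hb, hl, slot_posLabel]
    rfl

theorem GadgetPos.ne_iff {p q : GadgetPos H g} :
    p ≠ q ↔ ¬ (((ofLex p).1 : Fin n) = (ofLex q).1 ∧ (ofLex p).2 = (ofLex q).2) := by
  rw [Ne, ← ofLex_inj, Prod.ext_iff, Subtype.ext_iff]

theorem GadgetPos.lt_iff {p q : GadgetPos H g} :
    p < q ↔ ((ofLex p).1 : Fin n) < (ofLex q).1 ∨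
      (((ofLex p).1 : Fin n) = (ofLex q).1 ∧ (ofLex p).2 < (ofLex q).2) := by
  rw [Prod.Lex.lt_iff, Subtype.ext_iff, Subtype.coe_lt_coe]

theorem isGluing_octX :
    (coreGraph H hn).IsGluing (octX H g) (octCopyX H g) (gadgetEmb H g) where
  mono := gadgetEmb_strictMono
  pos_lo _ _ := slot_posLabel _ _ _
  pos_hi _ _ := slot_posLabel _ _ _
  lower _ _ := id
  upper _ _ := trivial
  dom _ _ := range_gadgetEmb.symm
  reg_lo _ _ := trivial
  reg_hi _ _ := trivial
  adj_lo {p p'} b b' h := by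
    rw [GadgetPos.ne_iff] at h
    simp only [coreGraph, octX, CoreAdj, coreRel, slot_posLabel, ne_eq, toLex_inj, Prod.mk.injEq]
    exact Or.inl ⟨h, fun e => by rw [e]⟩
  adj_hi b b' h := by
    rw [GadgetPos.ne_iff] at h
    simp only [coreGraph, octCopyX, CoreAdj, coreRel, slot_posLabel, ne_eq, toLex_inj,
      Prod.mk.injEq]
    exact Or.inl ⟨trivial, h⟩
  adj b b' h := by
    rw [GadgetPos.lt_iff] at h
    simp only [coreGraph, octX, octCopyX, CoreAdj, coreRel, slot_posLabel, Prod.Lex.toLex_lt_toLex]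
    exact ⟨Or.inl fun _ => ⟨trivial, Or.inr h⟩, Or.inr fun _ => ⟨trivial, Or.inr h⟩⟩
  adj_self p b := by simp [coreGraph, octX, octCopyX, CoreAdj, coreRel]
  kind_lo {_ b _} _ := eq_octahedron_vertex_iff (c := octX H g) (b := b)
    (fun _ _ => trivial) (fun _ _ => rfl) (fun _ _ => rfl) (fun _ _ _ => rfl)
  kind_hi {_ b _} _ := eq_octahedron_vertex_iff (c := octCopyX H g) (b := b)
    (fun _ _ => trivial) (fun _ _ => rfl) (fun _ _ => rfl) (fun _ _ _ => rfl)
  lo_ne p := by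
    unfold octX
    cases (ofLex p).2 <;> simp [posLabel]

theorem isGluing_octY (hg : (H g).IsGlue) :
    (coreGraph H hn).IsGluing (octY H g) (octCopyY H g hg) (gadgetEmb H g) where
  mono := gadgetEmb_strictMono
  pos_lo _ _ := slot_posLabel _ _ _
  pos_hi _ _ := slot_posLabel _ _ _
  lower _ _ := id
  upper _ _ := trivial
  dom _ _ := range_gadgetEmb.symm
  reg_lo _ _ := trivial
  reg_hi _ _ := trivial
  adj_lo {p p'} b b' h := by
    rw [GadgetPos.ne_iff] at h
    simp only [coreGraph, octY, CoreAdj, coreRel, slot_posLabel, ne_eq, toLex_inj, Prod.mk.injEq]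
    exact Or.inl ⟨h, fun e => by rw [e]⟩
  adj_hi b b' h := by
    rw [GadgetPos.ne_iff] at h
    simp only [coreGraph, octCopyY, CoreAdj, coreRel, slot_posLabel, ne_eq, toLex_inj,
      Prod.mk.injEq]
    exact Or.inl ⟨trivial, h⟩
  adj b b' h := by
    rw [GadgetPos.lt_iff] at h
    simp only [coreGraph, octY, octCopyY, CoreAdj, coreRel, slot_posLabel, Prod.Lex.toLex_lt_toLex]
    exact ⟨Or.inl fun _ => ⟨trivial, Or.inr h⟩, Or.inr fun _ => ⟨trivial, Or.inr h⟩⟩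
  adj_self p b := by simp [coreGraph, octY, octCopyY, CoreAdj, coreRel]
  kind_lo {_ b _} _ := eq_octahedron_vertex_iff (c := octY H g) (b := b)
    (fun _ _ => trivial) (fun _ _ => rfl) (fun _ _ => rfl) (fun _ _ _ => rfl)
  kind_hi {_ b _} _ := eq_octahedron_vertex_iff (c := octCopyY H g hg) (b := b)
    (fun _ _ => trivial) (fun _ _ => rfl) (fun _ _ => rfl) (fun _ _ _ => rfl)
  lo_ne p := by
    unfold octY
    cases (ofLex p).2 <;> simp [posLabel]

theorem isGluing_octMid_octCopyX (hg : (H g).IsGlue) :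
    (coreGraph H hn).IsGluing (octMid H g hg) (octCopyX H g) (gadgetEmb H g) where
  mono := gadgetEmb_strictMono
  pos_lo _ _ := slot_posLabel _ _ _
  pos_hi _ _ := slot_posLabel _ _ _
  lower _ _ := id
  upper _ _ := trivial
  dom _ _ := range_gadgetEmb.symm
  reg_lo _ _ := trivial
  reg_hi _ _ := trivial
  adj_lo b b' h := by
    rw [GadgetPos.ne_iff] at h
    simp only [coreGraph, octMid, CoreAdj, coreRel, slot_posLabel, ne_eq, toLex_inj, Prod.mk.injEq]
    exact Or.inl ⟨trivial, h⟩
  adj_hi := (isGluing_octX (hn := hn)).adj_hi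
  adj b b' h := by
    rw [GadgetPos.lt_iff] at h
    simp only [coreGraph, octMid, octCopyX, CoreAdj, coreRel, slot_posLabel,
      Prod.Lex.toLex_lt_toLex]
    exact ⟨Or.inl ⟨trivial, Or.inr h⟩, Or.inr ⟨trivial, Or.inr h⟩⟩
  adj_self p b := by simp [coreGraph, octMid, octCopyX, CoreAdj, coreRel]
  kind_lo {_ b _} _ := eq_octahedron_vertex_iff (c := octMid H g hg) (b := b)
    (fun _ _ => trivial) (fun _ _ => rfl) (fun _ _ => rfl) (fun _ _ _ => rfl)
  kind_hi := (isGluing_octX (hn := hn)).kind_hi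
  lo_ne p := by
    unfold octMid
    cases (ofLex p).2 <;> simp [posLabel]

theorem isGluing_octMid_octCopyY (hg : (H g).IsGlue) :
    (coreGraph H hn).IsGluing (octMid H g hg) (octCopyY H g hg) (gadgetEmb H g) where
  mono := gadgetEmb_strictMono
  pos_lo _ _ := slot_posLabel _ _ _
  pos_hi _ _ := slot_posLabel _ _ _
  lower _ _ := id
  upper _ _ := trivial
  dom _ _ := range_gadgetEmb.symm
  reg_lo _ _ := trivial
  reg_hi _ _ := trivial
  adj_lo := (isGluing_octMid_octCopyX (hn := hn) hg).adj_lo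
  adj_hi := (isGluing_octY (hn := hn) hg).adj_hi
  adj b b' h := by
    rw [GadgetPos.lt_iff] at h
    simp only [coreGraph, octMid, octCopyY, CoreAdj, coreRel, slot_posLabel,
      Prod.Lex.toLex_lt_toLex]
    exact ⟨Or.inl ⟨trivial, Or.inr h⟩, Or.inr ⟨trivial, Or.inr h⟩⟩
  adj_self p b := by simp [coreGraph, octMid, octCopyY, CoreAdj, coreRel]
  kind_lo := (isGluing_octMid_octCopyX (hn := hn) hg).kind_lo
  kind_hi := (isGluing_octY (hn := hn) hg).kind_hi
  lo_ne := (isGluing_octMid_octCopyX (hn := hn) hg).lo_ne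

theorem disjGraph_adj_iff {i j : Fin n} {a b : Bool} {l l' : Fin 4} :
    (disjGraph H).Adj (.qubit i a l) (.qubit j b l') ↔ slot i l ≠ slot j l' ∧ (i = j → a = b) := by
  unfold disjGraph
  simp only [SimpleGraph.fromRel_adj, disjRel, ne_eq, qubit.injEq, slot_eq_iff, squareAdj]
  grind

/-- A set of qubit vertices is a clique of the disjoint qubit graph if and only if it is a clique of
the gadget graph without the edges `4ᵢ⁰4ᵢ¹`. -/
theorem isClique_disjGraph_iff {ρ : Finset (Vertex H)} (hq : ∀ v ∈ ρ, ∃ i a l, v = .qubit i a l) :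
    (disjGraph H).IsClique (ρ : Set (Vertex H)) ↔ (coreGraph H hn).IsGood ρ := by
  constructor
  · intro h
    refine ⟨fun v hv => ?_, fun v hv w hw hne => ?_⟩
    · obtain ⟨i, a, l, rfl⟩ := hq v hv
      trivial
    · have := h hv hw hne
      obtain ⟨i, a, l, rfl⟩ := hq v hv
      obtain ⟨j, b, l', rfl⟩ := hq w hw
      exact Or.inl (disjGraph_adj_iff.1 this)
  · intro h v hv w hw hne
    have := h.2 v hv w hw hne
    obtain ⟨i, a, l, rfl⟩ := hq v hv
    obtain ⟨j, b, l', rfl⟩ := hq w hw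
    rw [disjGraph_adj_iff]
    rcases this with h | ⟨h1, h2⟩
    exacts [h, ⟨h1.symm, fun e => (h2 e.symm).symm⟩]

theorem isRest_of_mem_restSimplices {lo hi : GadgetPos H g → Bool → Vertex H}
    (hlo : (∃ hg, lo = octMid H g hg) ∨ lo = octX H g ∨ lo = octY H g)
    (hhi : hi = octCopyX H g ∨ ∃ hg, hi = octCopyY H g hg) {ρ : Finset (Vertex H)}
    (hρ : ρ ∈ restSimplices H (H g).supp) : (coreGraph H hn).IsRest lo hi (gadgetEmb H g) ρ := by
  obtain ⟨-, hcl, hv⟩ := hρ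
  have hg : (coreGraph H hn).IsGood ρ :=
    (isClique_disjGraph_iff fun v h => by
      obtain ⟨i, -, a, l, e⟩ := hv v h
      exact ⟨i, a, l, e⟩).1 hcl
  refine ⟨hg, fun v hv' w hw' e => ?_, fun v hv' => ?_, fun v hv' p b => ?_, fun v hv' p b => ?_⟩
  · by_contra hne
    have := hg.2 v hv' w hw' hne
    obtain ⟨i, -, a, l, rfl⟩ := hv v hv'
    obtain ⟨j, -, a', l', rfl⟩ := hv w hw'
    rcases this with h | h
    exacts [h.1 e, h.1 e.symm]
  · obtain ⟨i, hi, a, l, rfl⟩ := hv v hv'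
    rw [range_gadgetEmb]
    exact hi
  · obtain ⟨i, hi, a, l, rfl⟩ := hv v hv'
    have hne : i ≠ (ofLex p).1 := fun e => hi (e ▸ (ofLex p).1.2)
    have : CoreAdj (.qubit i a l) (lo p b) := by
      rcases hlo with ⟨hg, rfl⟩ | rfl | rfl
      · exact Or.inl hi
      · exact Or.inl ⟨fun e => hne (slot_eq_iff.1 e).1, fun e => absurd e hne⟩
      · exact Or.inl ⟨fun e => hne (slot_eq_iff.1 e).1, fun e => absurd e hne⟩
    exact ⟨this, this.symm⟩
  · obtain ⟨i, hiI, a, l, rfl⟩ := hv v hv'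
    have : CoreAdj (.qubit i a l) (hi p b) := by
      rcases hhi with rfl | ⟨hg, rfl⟩
      · exact Or.inl fun h => absurd h hiI
      · exact Or.inl fun h => absurd h hiI
    exact ⟨this, this.symm⟩

theorem card_positions : Fintype.card (Fin n ×ₗ Bool) = 2 * n := by
  rw [Fintype.card_lex, Fintype.card_prod, Fintype.card_fin, Fintype.card_bool, mul_comm]

theorem card_add_card_gadgetPos {ρ : Finset (Vertex H)} (hρ : ρ ∈ restSimplices H (H g).supp) :
    ρ.card + Fintype.card (GadgetPos H g) = Fintype.card (Fin n ×ₗ Bool) := by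
  have h := card_le_univ (H g).supp
  rw [Fintype.card_fin] at h
  rw [hρ.1, card_gadgetPos, card_positions]
  omega

end Gadget

/-! ### The layers of a term -/

section Gadget

variable {n t : ℕ} {H : Fin t → Term n} {hn : 0 < n} {g : Fin t}

open Vertex

/-- The term to which a vertex outside the qubit graph belongs. -/
def Vertex.gadget : Vertex H → Option (Fin t)
  | .qubit _ _ _ => none
  | .mid g _ _ _ => some g
  | .copyX g _ _ => some g
  | .copyY g _ _ _ => some g
  | .axis g _ _ => some g
  | .apex g _ => some g

theorem gadget_eq_none_iff {v : Vertex H} : v.gadget = none ↔ ∃ i a l, v = .qubit i a l := by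
  cases v <;> simp [Vertex.gadget]

/-- The pairs of octahedra glued by the term `g`. -/
inductive IsGluingPair (H : Fin t → Term n) (g : Fin t) :
    (GadgetPos H g → Bool → Vertex H) → (GadgetPos H g → Bool → Vertex H) → Prop
  | x : IsGluingPair H g (octX H g) (octCopyX H g)
  | y (hg : (H g).IsGlue) : IsGluingPair H g (octY H g) (octCopyY H g hg)
  | midX (hg : (H g).IsGlue) : IsGluingPair H g (octMid H g hg) (octCopyX H g)
  | midY (hg : (H g).IsGlue) : IsGluingPair H g (octMid H g hg) (octCopyY H g hg)

namespace IsGluingPair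

variable {lo hi : GadgetPos H g → Bool → Vertex H}

theorem isGluing (h : IsGluingPair H g lo hi) :
    (coreGraph H hn).IsGluing lo hi (gadgetEmb H g) := by
  cases h
  exacts [isGluing_octX, isGluing_octY _, isGluing_octMid_octCopyX _, isGluing_octMid_octCopyY _]

theorem isRest (h : IsGluingPair H g lo hi) {ρ : Finset (Vertex H)}
    (hρ : ρ ∈ restSimplices H (H g).supp) : (coreGraph H hn).IsRest lo hi (gadgetEmb H g) ρ := by
  cases h
  · exact isRest_of_mem_restSimplices (Or.inr (Or.inl rfl)) (Or.inl rfl) hρ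
  · exact isRest_of_mem_restSimplices (Or.inr (Or.inr rfl)) (Or.inr ⟨_, rfl⟩) hρ
  · exact isRest_of_mem_restSimplices (Or.inl ⟨_, rfl⟩) (Or.inl rfl) hρ
  · exact isRest_of_mem_restSimplices (Or.inl ⟨_, rfl⟩) (Or.inr ⟨_, rfl⟩) hρ

theorem gadget_hi (h : IsGluingPair H g lo hi) (p : GadgetPos H g) (b : Bool) :
    (hi p b).gadget = some g := by
  cases h <;> rfl

theorem gadget_lo (h : IsGluingPair H g lo hi) (p : GadgetPos H g) (b : Bool) :
    (lo p b).gadget = none ∨ (lo p b).gadget = some g := by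
  cases h
  exacts [Or.inl rfl, Or.inl rfl, Or.inr rfl, Or.inr rfl]

end IsGluingPair

/-- The last layer of a filling gadget, before the join with the remaining blocks. -/
def fillLayer (H : Fin t → Term n) (g : Fin t) (hg : ¬ (H g).IsGlue) : Layer (Vertex H) :=
  (thickLayer (octX H g) (octCopyX H g) (2 * (H g).supp.card)).union
    (coneLayer (octCopyX H g) (.apex g hg))

/-- `B` is a union of the `k`-th layers of gluings of pairs in `S`, possibly with the simplices that
touch the central vertex. The field `pair_eq` says that the pair of octahedra of a principal simplex
can be read off from all its vertices but one. -/
structure IsMixLayer (H : Fin t → Term n) (g : Fin t) (B : Layer (Vertex H)) (k : ℕ)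
    (S : Set ((GadgetPos H g → Bool → Vertex H) × (GadgetPos H g → Bool → Vertex H))) : Prop where
  pair : ∀ q ∈ S, IsGluingPair H g q.1 q.2
  principal : B.principal = {σ | ∃ q ∈ S, ∃ f, σ = mixSimplex q.1 q.2 k f}
  subset : B.principal ⊆ B.simplices
  simplices : ∀ σ ∈ B.simplices, σ ∈ B.principal ∨
    (∃ q ∈ S, ∃ (f : GadgetPos H g → Bool) (p : GadgetPos H g), 0 < k ∧
      posRank p + k < Fintype.card (GadgetPos H g) ∧
      σ = (slabSimplex q.1 q.2 k f).erase (q.1 p (f p))) ∨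
    (∃ (hg : ¬ (H g).IsGlue) (f : GadgetPos H g → Bool) (p : GadgetPos H g),
      k = Fintype.card (GadgetPos H g) ∧ B = fillLayer H g hg ∧ σ = insert (.apex g hg)
        ((univ.image (fun q => octCopyX H g q (f q))).erase (octCopyX H g p (f p))))
  pair_eq : ∀ q ∈ S, ∀ q' ∈ S, ∀ f f' p₀,
    (∀ p, p ≠ p₀ → mixVertex q.1 q.2 k f p = mixVertex q'.1 q'.2 k f' p) → q = q'
  exists_gadget : ∀ q ∈ S, ∀ f, ∃ p, (mixVertex q.1 q.2 k f p).gadget = some g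

theorem isMixLayer_thickLayer (hn : 0 < n) {lo hi : GadgetPos H g → Bool → Vertex H}
    (h : IsGluingPair H g lo hi) {k : ℕ} (hk : 0 < k) (hk' : k ≤ Fintype.card (GadgetPos H g)) :
    IsMixLayer H g (thickLayer lo hi k) k {(lo, hi)} := by
  have G := h.isGluing (hn := hn)
  have hpr := G.principal_eq hk hk'
  refine ⟨?_, ?_, ?_, ?_, ?_, ?_⟩
  · rintro _ rfl
    exact h
  · rw [hpr]
    simp
  · rintro σ ⟨f, p, hp, rfl⟩
    exact ⟨f, p, hp.le, rfl⟩
  · intro σ hσ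
    rcases G.simplices_cases hσ with h1 | ⟨f, p, hp, rfl⟩
    · left; rw [hpr]; exact h1
    · exact Or.inr (Or.inl ⟨_, rfl, f, p, hk, hp, rfl⟩)
  · rintro _ rfl _ rfl _ _ _ _
    rfl
  · rintro _ rfl f
    obtain ⟨q, hq⟩ := exists_posRank_eq (ι := GadgetPos H g)
      (r := Fintype.card (GadgetPos H g) - k) (by omega)
    refine ⟨q, ?_⟩
    unfold mixVertex
    rw [if_neg (by omega)]
    exact h.gadget_hi _ _

/-- Two different positions with the largest ranks. -/
theorem exists_two_last : ∃ p q : GadgetPos H g, p ≠ q ∧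
    posRank p + 1 = Fintype.card (GadgetPos H g) ∧
    posRank q + 2 = Fintype.card (GadgetPos H g) := by
  have h2 := card_gadgetPos_ge (H := H) (g := g)
  obtain ⟨p, hp⟩ := exists_posRank_eq (ι := GadgetPos H g)
    (r := Fintype.card (GadgetPos H g) - 1) (by omega)
  obtain ⟨q, hq⟩ := exists_posRank_eq (ι := GadgetPos H g)
    (r := Fintype.card (GadgetPos H g) - 2) (by omega)
  exact ⟨p, q, by rintro rfl; omega, by omega, by omega⟩

theorem isMixLayer_union {A B : Layer (Vertex H)} {k : ℕ}
    {q₁ q₂ : (GadgetPos H g → Bool → Vertex H) × (GadgetPos H g → Bool → Vertex H)}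
    (hk : k < Fintype.card (GadgetPos H g) ∨ (H g).IsGlue)
    (hA : IsMixLayer H g A k {q₁}) (hB : IsMixLayer H g B k {q₂})
    (hne : ∀ f f' p₀, (∀ p, p ≠ p₀ → mixVertex q₁.1 q₁.2 k f p = mixVertex q₂.1 q₂.2 k f' p) →
      False) :
    IsMixLayer H g (A.union B) k {q₁, q₂} := by
  refine ⟨?_, ?_, ?_, ?_, ?_, ?_⟩
  · rintro _ (rfl | rfl)
    exacts [hA.pair _ rfl, hB.pair _ rfl]
  · unfold Layer.union
    rw [hA.principal, hB.principal]
    ext σ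
    simp
  · exact Set.union_subset_union hA.subset hB.subset
  · have hfill : ∀ hg : ¬ (H g).IsGlue, k ≠ Fintype.card (GadgetPos H g) := by
      intro hg
      rcases hk with h | h
      exacts [h.ne, absurd h hg]
    rintro σ (hσ | hσ)
    · rcases hA.simplices σ hσ with h | ⟨q, hq, h⟩ | ⟨hg, f, p, h, -⟩
      · exact Or.inl (Or.inl h)
      · exact Or.inr (Or.inl ⟨q, Or.inl hq, h⟩)
      · exact absurd h (hfill hg)
    · rcases hB.simplices σ hσ with h | ⟨q, hq, h⟩ | ⟨hg, f, p, h, -⟩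
      · exact Or.inl (Or.inr h)
      · exact Or.inr (Or.inl ⟨q, Or.inr hq, h⟩)
      · exact absurd h (hfill hg)
  · rintro _ (rfl | rfl) _ (rfl | rfl) f f' p₀ h
    · rfl
    · exact (hne f f' p₀ h).elim
    · exact (hne f' f p₀ fun p hp => (h p hp).symm).elim
    · rfl
  · rintro _ (rfl | rfl) f
    exacts [hA.exists_gadget _ rfl f, hB.exists_gadget _ rfl f]

theorem isMixLayer_xy (hn : 0 < n) (hg : (H g).IsGlue) {k : ℕ} (hk : 0 < k)
    (hk' : k ≤ Fintype.card (GadgetPos H g)) :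
    IsMixLayer H g ((thickLayer (octX H g) (octCopyX H g) k).union
      (thickLayer (octY H g) (octCopyY H g hg) k)) k
      {(octX H g, octCopyX H g), (octY H g, octCopyY H g hg)} := by
  refine isMixLayer_union (Or.inr hg) (isMixLayer_thickLayer hn .x hk hk')
    (isMixLayer_thickLayer hn (.y hg) hk hk') fun f f' p₀ h => ?_
  -- a vertex away from `p₀` is a qubit vertex that shows the common bit of `x` and `y`, and each
  -- block has such a position
  have hlow : ∀ p, p ≠ p₀ → (H g).x (ofLex p).1 = (H g).y (ofLex p).1 := by
    intro p hp
    have := h p hp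
    unfold mixVertex at this
    split_ifs at this
    · simp only [octX, octY, qubit.injEq] at this
      exact this.2.1
    · simp [octCopyX, octCopyY] at this
  have hall : ∀ i : (H g).supp, (H g).x i = (H g).y i := by
    intro i
    by_cases h0 : (toLex (i, false) : GadgetPos H g) = p₀
    · exact hlow (toLex (i, true)) (by rw [← h0]; simp)
    · exact hlow (toLex (i, false)) h0
  clear hlow h
  revert hall hg
  generalize H g = T
  intro hg
  cases T with
  | fill I hI x => exact hg.elim
  | glue I x y hxy =>
    intro hall
    obtain ⟨i, hi, hne⟩ := hxy
    exact hne (hall ⟨i, hi⟩)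

theorem isMixLayer_mid (hn : 0 < n) (hg : (H g).IsGlue) {k : ℕ} (hk : 2 ≤ k)
    (hk' : k < Fintype.card (GadgetPos H g)) :
    IsMixLayer H g ((thickLayer (octMid H g hg) (octCopyX H g) k).union
      (thickLayer (octMid H g hg) (octCopyY H g hg) k)) k
      {(octMid H g hg, octCopyX H g), (octMid H g hg, octCopyY H g hg)} := by
  refine isMixLayer_union (Or.inr hg) (isMixLayer_thickLayer hn (.midX hg) (by omega) hk'.le)
    (isMixLayer_thickLayer hn (.midY hg) (by omega) hk'.le) fun f f' p₀ h => ?_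
  -- as `k ≥ 2`, the last two vertices belong to the copies, and one of them is not at `p₀`
  obtain ⟨p, q, hpq, hp, hq⟩ := exists_two_last (H := H) (g := g)
  have key : ∀ r, r ≠ p₀ → Fintype.card (GadgetPos H g) ≤ posRank r + k → False := by
    intro r hr hle
    have := h r hr
    unfold mixVertex at this
    rw [if_neg (by omega), if_neg (by omega)] at this
    simp [octCopyX, octCopyY] at this
  by_cases h0 : p = p₀
  · exact key q (fun e => hpq (h0.trans e.symm)) (by omega)
  · exact key p h0 (by omega)

theorem isMixLayer_octahedron (hg : (H g).IsGlue) :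
    IsMixLayer H g (octahedronLayer (octMid H g hg)) 0 {(octMid H g hg, octCopyX H g)} := by
  refine ⟨?_, ?_, subset_rfl, fun σ h => Or.inl h, ?_, ?_⟩
  · rintro _ rfl
    exact .midX hg
  · ext σ
    simp [octahedronLayer, mixSimplex_zero]
  · rintro _ rfl _ rfl _ _ _ _
    rfl
  · rintro _ rfl f
    obtain ⟨p, -⟩ := exists_two_last (H := H) (g := g)
    refine ⟨p, ?_⟩
    unfold mixVertex
    rw [if_pos (by simpa using posRank_lt_card p)]
    rfl

theorem isMixLayer_fill (hn : 0 < n) (hg : ¬ (H g).IsGlue) :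
    IsMixLayer H g (fillLayer H g hg) (2 * (H g).supp.card) {(octX H g, octCopyX H g)} := by
  have h2 := card_gadgetPos_ge (H := H) (g := g)
  rw [card_gadgetPos] at h2
  have h := isMixLayer_thickLayer hn (IsGluingPair.x (H := H) (g := g))
    (k := 2 * (H g).supp.card) (by omega) (by rw [card_gadgetPos])
  have hp : (fillLayer H g hg).principal =
      (thickLayer (octX H g) (octCopyX H g) (2 * (H g).supp.card)).principal := by
    simp [fillLayer, Layer.union, coneLayer]
  refine ⟨h.pair, by rw [hp, h.principal], ?_, ?_, h.pair_eq, h.exists_gadget⟩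
  · rw [hp]
    exact h.subset.trans Set.subset_union_left
  · rintro σ (hσ | ⟨f, p, rfl⟩)
    · rcases h.simplices σ hσ with h1 | h1 | ⟨hg', f, p, -, -, e⟩
      · left; rwa [hp]
      · exact Or.inr (Or.inl h1)
      · exact Or.inr (Or.inr ⟨hg', f, p, card_gadgetPos.symm, rfl, e⟩)
    · exact Or.inr (Or.inr ⟨hg, f, p, card_gadgetPos.symm, rfl, rfl⟩)

theorem exists_isMixLayer (hn : 0 < n) {B : Layer (Vertex H)} (hB : B ∈ termLayers H g) :
    ∃ k S, IsMixLayer H g B k S := by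
  have hP := card_gadgetPos (H := H) (g := g)
  have h2 := card_gadgetPos_ge (H := H) (g := g)
  unfold termLayers at hB
  split_ifs at hB with hg
  · simp only [List.mem_append, List.mem_map, List.mem_reverse, List.mem_range'_1,
      List.mem_cons, List.not_mem_nil, or_false] at hB
    rcases hB with (⟨k, hk, rfl⟩ | ⟨k, hk, rfl⟩) | rfl | rfl | rfl
    · exact ⟨_, _, isMixLayer_xy hn hg (k := k) (by omega) (by omega)⟩
    · exact ⟨_, _, isMixLayer_mid hn hg (k := k) (by omega) (by omega)⟩
    · exact ⟨_, _, isMixLayer_thickLayer hn (.midX hg) one_pos (by omega)⟩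
    · exact ⟨_, _, isMixLayer_thickLayer hn (.midY hg) one_pos (by omega)⟩
    · exact ⟨_, _, isMixLayer_octahedron hg⟩
  · simp only [List.mem_append, List.mem_map, List.mem_range'_1,
      List.mem_cons, List.not_mem_nil, or_false] at hB
    rcases hB with ⟨k, hk, rfl⟩ | rfl
    · exact ⟨_, _, isMixLayer_thickLayer hn .x (k := k) (by omega) (by omega)⟩
    · exact ⟨_, _, isMixLayer_fill hn hg⟩

theorem fillLayer_mem (hg : ¬ (H g).IsGlue) : fillLayer H g hg ∈ termLayers H g := by
  unfold termLayers
  rw [dif_neg hg]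
  exact List.mem_append_right _ (List.mem_singleton.2 rfl)

/-- Every principal simplex of every gluing belongs to one of the layers; those of the `2m`-th
layer of `K'' → K'ˣ` are the maximal simplices of `K'ˣ`. -/
theorem exists_mem_termLayers (hn : 0 < n) {lo hi : GadgetPos H g → Bool → Vertex H}
    (h : IsGluingPair H g lo hi) {k : ℕ} (hk : k ≤ Fintype.card (GadgetPos H g))
    (hk0 : 0 < k ∨ ∃ hg, lo = octMid H g hg) :
    ∃ B ∈ termLayers H g, ∀ f, mixSimplex lo hi k f ∈ B.principal := by
  have hP := card_gadgetPos (H := H) (g := g)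
  have h2 := card_gadgetPos_ge (H := H) (g := g)
  have xlayer : ∀ j, 0 < j → j ≤ Fintype.card (GadgetPos H g) →
      ∃ B ∈ termLayers H g, ∀ f, mixSimplex (octX H g) (octCopyX H g) j f ∈ B.principal := by
    intro j hj hj'
    have hpr := (isGluing_octX (hn := hn) (H := H) (g := g)).principal_eq hj hj'
    by_cases hg : (H g).IsGlue
    · refine ⟨(thickLayer (octX H g) (octCopyX H g) j).union
        (thickLayer (octY H g) (octCopyY H g hg) j), ?_, fun f => Or.inl ?_⟩
      rotate_left
      · rw [hpr]; exact ⟨f, rfl⟩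
      · unfold termLayers
        rw [dif_pos hg]
        exact List.mem_append_left _ (List.mem_append_left _
          (List.mem_map.2 ⟨j, List.mem_range'_1.2 (by omega), rfl⟩))
    · rcases hj'.lt_or_eq with hlt | rfl
      · refine ⟨thickLayer (octX H g) (octCopyX H g) j, ?_, fun f => ?_⟩
        · unfold termLayers
          rw [dif_neg hg]
          exact List.mem_append_left _ (List.mem_map.2 ⟨j, List.mem_range'_1.2 (by omega), rfl⟩)
        · rw [hpr]; exact ⟨f, rfl⟩
      · refine ⟨_, fillLayer_mem hg, fun f => Or.inl ?_⟩
        rw [← hP, hpr]; exact ⟨f, rfl⟩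
  have ylayer : ∀ hg j, 0 < j → j ≤ Fintype.card (GadgetPos H g) →
      ∃ B ∈ termLayers H g, ∀ f,
        mixSimplex (octY H g) (octCopyY H g hg) j f ∈ B.principal := by
    intro hg j hj hj'
    have hpr := (isGluing_octY (hn := hn) hg).principal_eq hj hj'
    refine ⟨(thickLayer (octX H g) (octCopyX H g) j).union
      (thickLayer (octY H g) (octCopyY H g hg) j), ?_, fun f => Or.inr ?_⟩
    rotate_left
    · rw [hpr]; exact ⟨f, rfl⟩
    · unfold termLayers
      rw [dif_pos hg]
      exact List.mem_append_left _ (List.mem_append_left _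
        (List.mem_map.2 ⟨j, List.mem_range'_1.2 (by omega), rfl⟩))
  have octlayer : ∀ hg (hi' : GadgetPos H g → Bool → Vertex H), ∃ B ∈ termLayers H g, ∀ f,
      mixSimplex (octMid H g hg) hi' 0 f ∈ B.principal := by
    intro hg hi'
    refine ⟨octahedronLayer (octMid H g hg), ?_, fun f => ⟨f, mixSimplex_zero f⟩⟩
    unfold termLayers
    rw [dif_pos hg]
    simp
  have midlayer : ∀ hg j, 2 ≤ j → j < Fintype.card (GadgetPos H g) →
      (thickLayer (octMid H g hg) (octCopyX H g) j).union
        (thickLayer (octMid H g hg) (octCopyY H g hg) j) ∈ termLayers H g := by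
    intro hg j hj hj'
    unfold termLayers
    rw [dif_pos hg]
    exact List.mem_append_left _ (List.mem_append_right _
      (List.mem_map.2 ⟨j, List.mem_reverse.2 (List.mem_range'_1.2 (by omega)), rfl⟩))
  cases h with
  | x =>
    refine xlayer k (hk0.resolve_right ?_) hk
    rintro ⟨hg, e⟩
    obtain ⟨p, -⟩ := exists_two_last (H := H) (g := g)
    have := congrFun (congrFun e p) true
    simp [octX, octMid] at this
  | y hg =>
    refine ylayer hg k (hk0.resolve_right ?_) hk
    rintro ⟨hg, e⟩
    obtain ⟨p, -⟩ := exists_two_last (H := H) (g := g)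
    have := congrFun (congrFun e p) true
    simp [octY, octMid] at this
  | midX hg =>
    rcases Nat.eq_zero_or_pos k with rfl | hk1
    · exact octlayer hg _
    rcases hk.lt_or_eq with hlt | rfl
    · have hpr := (isGluing_octMid_octCopyX (hn := hn) hg).principal_eq hk1 hk
      by_cases h1 : k = 1
      · subst h1
        refine ⟨thickLayer (octMid H g hg) (octCopyX H g) 1, ?_, fun f => ?_⟩
        · unfold termLayers
          rw [dif_pos hg]
          simp
        · rw [hpr]; exact ⟨f, rfl⟩
      · refine ⟨_, midlayer hg k (by omega) hlt, fun f => Or.inl ?_⟩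
        rw [hpr]; exact ⟨f, rfl⟩
    · obtain ⟨B, hB, h⟩ := xlayer _ hk1 le_rfl
      refine ⟨B, hB, fun f => ?_⟩
      have := h f
      rwa [mixSimplex_card] at this ⊢
  | midY hg =>
    rcases Nat.eq_zero_or_pos k with rfl | hk1
    · exact octlayer hg _
    rcases hk.lt_or_eq with hlt | rfl
    · have hpr := (isGluing_octMid_octCopyY (hn := hn) hg).principal_eq hk1 hk
      by_cases h1 : k = 1
      · subst h1
        refine ⟨thickLayer (octMid H g hg) (octCopyY H g hg) 1, ?_, fun f => ?_⟩
        · unfold termLayers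
          rw [dif_pos hg]
          simp
        · rw [hpr]; exact ⟨f, rfl⟩
      · refine ⟨_, midlayer hg k (by omega) hlt, fun f => Or.inr ?_⟩
        rw [hpr]; exact ⟨f, rfl⟩
    · obtain ⟨B, hB, h⟩ := ylayer hg _ hk1 le_rfl
      refine ⟨B, hB, fun f => ?_⟩
      have := h f
      rwa [mixSimplex_card] at this ⊢

end Gadget

/-! ### Joining the layers with the other blocks -/

section Gadget

variable {n t : ℕ} {H : Fin t → Term n} {hn : 0 < n} {g : Fin t}

open Vertex PositionedGraph

theorem mem_simplicesOfDim_disjComplex (hn : 0 < n) {σ : Finset (Vertex H)} :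
    σ ∈ simplicesOfDim (disjComplex H) (2 * n - 1) ↔
      (coreGraph H hn).IsTransversal σ ∧ ∀ v ∈ σ, ∃ i a l, v = .qubit i a l := by
  constructor
  · rintro ⟨⟨-, hq, hcl⟩, hcard⟩
    have hq' : ∀ v ∈ σ, ∃ i a l, v = .qubit i a l := fun v hv => hq hv
    have hgood := (isClique_disjGraph_iff (hn := hn) hq').1 hcl
    refine ⟨⟨hgood, by rw [hcard, card_positions]; omega, fun v hv w hw e => ?_⟩, hq'⟩
    by_contra hne
    have := hgood.2 v hv w hw hne
    obtain ⟨i, a, l, rfl⟩ := hq' v hv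
    obtain ⟨j, b, l', rfl⟩ := hq' w hw
    rcases this with h | h
    exacts [h.1 e, h.1 e.symm]
  · rintro ⟨hT, hq⟩
    have hcard := hT.card
    rw [card_positions] at hcard
    exact ⟨⟨card_pos.1 (by omega), fun v hv => hq v hv, (isClique_disjGraph_iff hq).2 hT.good⟩,
      by omega⟩

theorem mem_allLayers_iff {A : Layer (Vertex H)} :
    A ∈ allLayers (disjComplex H) (2 * n - 1) (gadgetLayers H) ↔
      A = ⟨simplicesOfDim (disjComplex H) (2 * n - 1),
        simplicesOfDim (disjComplex H) (2 * n - 1)⟩ ∨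
      ∃ g, ∃ B ∈ termLayers H g, A = B.join (restSimplices H (H g).supp) := by
  unfold allLayers gadgetLayers
  simp only [List.mem_cons, List.mem_flatMap, List.mem_finRange, true_and, List.mem_map, eq_comm]

theorem mem_gadgetComplex_of_isGood {τ : Finset (Vertex H)} (hne : τ.Nonempty)
    (h : (coreGraph H hn).IsGood τ) : τ ∈ gadgetComplex H :=
  ⟨hne, Set.subset_univ _, fun v hv w hw hvw => ((coreAdj_iff hvw).1 (h.2 v hv w hw hvw)).2.2.1⟩

theorem gadgetGraph_adj_of_mem {τ : Finset (Vertex H)} (h : τ ∈ gadgetComplex H) {v w : Vertex H}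
    (hv : v ∈ τ) (hw : w ∈ τ) (hne : v ≠ w) : (gadgetGraph H).Adj v w :=
  h.2.2 hv hw hne

theorem PositionedGraph.IsGluing.kind_mixVertex {V Pos κ ι : Type*} [LinearOrder V]
    [LinearOrder Pos] [LinearOrder ι] [Fintype ι] {M : PositionedGraph V Pos κ}
    {lo hi : ι → Bool → V} {e : ι → Pos} (G : M.IsGluing lo hi e) (k : ℕ) (f f' : ι → Bool)
    (p : ι) : M.kind (mixVertex lo hi k f p) = M.kind (mixVertex lo hi k f' p) := by
  unfold mixVertex
  split_ifs
  · exact ((G.kind_lo (G.reg_lo _ _)).2 ⟨_, rfl⟩).2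
  · exact ((G.kind_hi (G.reg_hi _ _)).2 ⟨_, rfl⟩).2

theorem IsGluingPair.pos_mem_supp {lo hi : GadgetPos H g → Bool → Vertex H}
    (h : IsGluingPair H g lo hi) (k : ℕ) (f : GadgetPos H g → Bool) (p : GadgetPos H g) :
    (ofLex ((coreGraph H hn).pos (mixVertex lo hi k f p))).1 ∈ (H g).supp := by
  rw [h.isGluing.pos_mixVertex]
  exact (ofLex p).1.2

theorem IsGluingPair.transversal {lo hi : GadgetPos H g → Bool → Vertex H}
    (h : IsGluingPair H g lo hi) {ρ : Finset (Vertex H)}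
    (hρ : ρ ∈ restSimplices H (H g).supp) (k : ℕ) (f : GadgetPos H g → Bool) :
    (coreGraph H hn).IsTransversal (mixSimplex lo hi k f ∪ ρ) :=
  h.isGluing.transversal (h.isRest hρ) (card_add_card_gadgetPos hρ) k f

section Join

variable {B : Layer (Vertex H)} {k : ℕ}
  {S : Set ((GadgetPos H g → Bool → Vertex H) × (GadgetPos H g → Bool → Vertex H))}

theorem IsMixLayer.principal_join (hM : IsMixLayer H g B k S) {σ : Finset (Vertex H)} :
    σ ∈ (B.join (restSimplices H (H g).supp)).principal ↔
      ∃ q ∈ S, ∃ f, ∃ ρ ∈ restSimplices H (H g).supp, σ = mixSimplex q.1 q.2 k f ∪ ρ := by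
  unfold Layer.join
  rw [hM.principal]
  constructor
  · rintro ⟨_, ⟨q, hq, f, rfl⟩, ρ, hρ, rfl⟩
    exact ⟨q, hq, f, ρ, hρ, rfl⟩
  · rintro ⟨q, hq, f, ρ, hρ, rfl⟩
    exact ⟨_, ⟨q, hq, f, rfl⟩, ρ, hρ, rfl⟩

/-- A simplex that touches the central vertex, after the join: a vertex of a principal simplex is
exchanged with the central vertex. -/
theorem cone_union_eq {hg : ¬ (H g).IsGlue} {f : GadgetPos H g → Bool} {p : GadgetPos H g}
    {ρ : Finset (Vertex H)} (hρ : ρ ∈ restSimplices H (H g).supp) :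
    insert (.apex g hg) ((univ.image (fun q => octCopyX H g q (f q))).erase (octCopyX H g p (f p)))
        ∪ ρ =
      insert (.apex g hg) ((mixSimplex (octX H g) (octCopyX H g) (Fintype.card (GadgetPos H g)) f
        ∪ ρ).erase (octCopyX H g p (f p))) := by
  have : octCopyX H g p (f p) ∉ ρ := by
    intro h
    obtain ⟨i, -, a, l, e⟩ := hρ.2.2 _ h
    simp [octCopyX] at e
  rw [mixSimplex_card, insert_union, erase_union_distrib, erase_eq_of_notMem this]

theorem IsMixLayer.simplices_join (hM : IsMixLayer H g B k S) {σ : Finset (Vertex H)}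
    (hσ : σ ∈ (B.join (restSimplices H (H g).supp)).simplices) :
    ∃ ρ ∈ restSimplices H (H g).supp,
      (∃ q ∈ S, ∃ f, σ = mixSimplex q.1 q.2 k f ∪ ρ) ∨
      (∃ q ∈ S, ∃ (f : GadgetPos H g → Bool) (p : GadgetPos H g), 0 < k ∧
        posRank p + k < Fintype.card (GadgetPos H g) ∧
        σ = (slabSimplex q.1 q.2 k f).erase (q.1 p (f p)) ∪ ρ) ∨
      (∃ (hg : ¬ (H g).IsGlue) (f : GadgetPos H g → Bool) (p : GadgetPos H g),
        B = fillLayer H g hg ∧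
        σ = insert (.apex g hg) ((mixSimplex (octX H g) (octCopyX H g)
          (Fintype.card (GadgetPos H g)) f ∪ ρ).erase (octCopyX H g p (f p)))) := by
  obtain ⟨α, hα, ρ, hρ, rfl⟩ := hσ
  refine ⟨ρ, hρ, ?_⟩
  rcases hM.simplices α hα with h | ⟨q, hq, f, p, hk, hp, rfl⟩ | ⟨hg, f, p, -, hB, rfl⟩
  · rw [hM.principal] at h
    obtain ⟨q, hq, f, rfl⟩ := h
    exact Or.inl ⟨q, hq, f, rfl⟩
  · exact Or.inr (Or.inl ⟨q, hq, f, p, hk, hp, rfl⟩)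
  · exact Or.inr (Or.inr ⟨hg, f, p, hB, cone_union_eq hρ⟩)

theorem IsMixLayer.isLowerFace (hM : IsMixLayer H g B k S)
    {q : (GadgetPos H g → Bool → Vertex H) × (GadgetPos H g → Bool → Vertex H)} (hq : q ∈ S)
    {ρ : Finset (Vertex H)} (hρ : ρ ∈ restSimplices H (H g).supp) {f : GadgetPos H g → Bool}
    {p : GadgetPos H g} (hk : 0 < k) (hp : posRank p + k < Fintype.card (GadgetPos H g)) :
    (coreGraph H hn).IsLowerFace (B.join (restSimplices H (H g).supp))
      ((slabSimplex q.1 q.2 k f).erase (q.1 p (f p)) ∪ ρ) :=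
  (hM.pair q hq).isGluing.isLowerFace ((hM.pair q hq).isRest hρ) (card_add_card_gadgetPos hρ) hk hp
    (hM.principal_join.2 ⟨q, hq, f, ρ, hρ, rfl⟩)

/-- A transversal clique that contains a principal simplex of `B` is principal in the join if its
vertices in the other blocks are qubit vertices: these form a maximal simplex of the disjoint qubit
graph there. -/
theorem mem_principal_of_mixVertex (hM : IsMixLayer H g B k S) {σ : Finset (Vertex H)}
    (hσ : (coreGraph H hn).IsTransversal σ)
    {q : (GadgetPos H g → Bool → Vertex H) × (GadgetPos H g → Bool → Vertex H)} (hq : q ∈ S)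
    {f : GadgetPos H g → Bool} (hf : ∀ p, mixVertex q.1 q.2 k f p ∈ σ)
    (hrest : ∀ w ∈ σ, (ofLex ((coreGraph H hn).pos w)).1 ∉ (H g).supp →
      ∃ i a l, w = .qubit i a l) :
    σ ∈ (B.join (restSimplices H (H g).supp)).principal := by
  classical
  have G := (hM.pair q hq).isGluing (hn := hn)
  have heq := G.mixSimplex_union_eq_of_forall hσ.inj hf range_gadgetEmb.symm
  refine hM.principal_join.2 ⟨q, hq, f, _, ⟨?_, ?_, ?_⟩, heq⟩
  · have hc := hσ.card
    have h2 := card_filter_add_card_filter_not (s := σ)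
      (fun v => (coreGraph H hn).pos v ∈ {p | (ofLex p).1 ∈ (H g).supp})
    have h3 : σ.filter (fun v => (coreGraph H hn).pos v ∈ {p | (ofLex p).1 ∈ (H g).supp}) =
        mixSimplex q.1 q.2 k f := by
      ext x
      simp only [mem_filter, mixSimplex, mem_image, mem_univ, true_and]
      constructor
      · rintro ⟨hx, hx'⟩
        rw [← range_gadgetEmb] at hx'
        obtain ⟨p, hp⟩ := hx'
        exact ⟨p, hσ.inj (hf p) hx (by rw [G.pos_mixVertex, hp])⟩
      · rintro ⟨p, rfl⟩
        exact ⟨hf p, (hM.pair q hq).pos_mem_supp k f p⟩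
    have h4 : (mixSimplex q.1 q.2 k f).card = 2 * (H g).supp.card := by
      rw [mixSimplex, card_image_of_injective, card_univ, card_gadgetPos]
      exact fun p p' h => G.inj (by rw [← G.pos_mixVertex k f p, h, G.pos_mixVertex])
    rw [h3, h4, hc, card_positions] at h2
    omega
  · exact (isClique_disjGraph_iff fun v hv => hrest v (mem_filter.1 hv).1 (mem_filter.1 hv).2).2
      (hσ.good.subset (filter_subset _ _))
  · intro v hv
    obtain ⟨hv1, hv2⟩ := mem_filter.1 hv
    obtain ⟨i, a, l, rfl⟩ := hrest v hv1 hv2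
    exact ⟨i, hv2, a, l, rfl⟩

end Join

/-- The vertices of a clique that contains a vertex of the gadget of `g` belong to two octahedra
glued by `g` or to blocks on which `g` does not act. -/
theorem exists_gluingPair_of_isGood {σ : Finset (Vertex H)} (hσ : (coreGraph H hn).IsGood σ)
    {v : Vertex H} (hv : v ∈ σ) (hvg : v.gadget = some g) :
    ∃ lo hi, IsGluingPair H g lo hi ∧
      (∀ w ∈ σ, (∃ p b, w = lo p b ∨ w = hi p b) ∨ ∃ i ∉ (H g).supp, ∃ a l, w = .qubit i a l) ∧
      ((∃ p b, hi p b ∈ σ) ∨ ∃ hg, lo = octMid H g hg) := by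
  have hX : ∀ i l, ∃ p b, (Vertex.copyX g i l : Vertex H) = octCopyX H g p b := fun i l => by
    obtain ⟨b, hb⟩ := exists_posLabel_eq l
    exact ⟨toLex (i, decide (2 ≤ l)), b, by simp [octCopyX, hb]⟩
  have hY : ∀ hg i l, ∃ p b, (Vertex.copyY g hg i l : Vertex H) = octCopyY H g hg p b :=
    fun hg i l => by
      obtain ⟨b, hb⟩ := exists_posLabel_eq l
      exact ⟨toLex (i, decide (2 ≤ l)), b, by simp [octCopyY, hb]⟩
  have hM : ∀ hg i l, ∃ p b, (Vertex.mid g hg i l : Vertex H) = octMid H g hg p b :=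
    fun hg i l => by
      obtain ⟨b, hb⟩ := exists_posLabel_eq l
      exact ⟨toLex (i, decide (2 ≤ l)), b, by simp [octMid, hb]⟩
  have hQX : ∀ i (_ : i ∈ (H g).supp) l, ∃ p b,
      (Vertex.qubit i ((H g).x i) l : Vertex H) = octX H g p b := fun i hi l => by
    obtain ⟨b, hb⟩ := exists_posLabel_eq l
    exact ⟨toLex (⟨i, hi⟩, decide (2 ≤ l)), b, by simp [octX, hb]⟩
  have hQY : ∀ i (_ : i ∈ (H g).supp) l, ∃ p b,
      (Vertex.qubit i ((H g).y i) l : Vertex H) = octY H g p b := fun i hi l => by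
    obtain ⟨b, hb⟩ := exists_posLabel_eq l
    exact ⟨toLex (⟨i, hi⟩, decide (2 ≤ l)), b, by simp [octY, hb]⟩
  have hadj : ∀ x ∈ σ, ∀ w ∈ σ, w = x ∨ CoreAdj x w := fun x hx w hw => by
    by_cases h : w = x
    exacts [Or.inl h, Or.inr (hσ.2 x hx w hw (Ne.symm h))]
  by_cases hx : ∃ i l, .copyX g i l ∈ σ
  · obtain ⟨i, l, hx⟩ := hx
    by_cases hm : ∃ hg j l', .mid g hg j l' ∈ σ
    · obtain ⟨hg, j, l', hm⟩ := hm
      refine ⟨_, _, .midX hg, fun w hw => ?_, Or.inr ⟨hg, rfl⟩⟩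
      have h1 := hadj _ hx w hw
      have h2 := hadj _ hm w hw
      cases w <;> simp only [CoreAdj, coreRel, reduceCtorEq, or_false, false_or] at h1 h2
      case qubit j' a l'' =>
        exact Or.inr ⟨j', h2, a, l'', rfl⟩
      case mid g' hg' j' l'' =>
        obtain ⟨rfl, -⟩ := h1
        exact Or.inl ((hM hg' j' l'').imp fun p => Exists.imp fun b => Or.inl)
      case copyX g' j' l'' =>
        obtain rfl : g' = g := by
          rcases h1 with h1 | h1 | h1
          · cases h1; rfl
          · exact h1.1.symm
          · exact h1.1
        exact Or.inl ((hX j' l'').imp fun p => Exists.imp fun b => Or.inr)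
    · refine ⟨_, _, .x, fun w hw => ?_, ?_⟩
      swap
      · obtain ⟨p, b, e⟩ := hX i l
        exact Or.inl ⟨p, b, e ▸ hx⟩
      have h1 := hadj _ hx w hw
      cases w <;> simp only [CoreAdj, coreRel, reduceCtorEq, or_false, false_or] at h1
      case qubit j' a l'' =>
        by_cases hj : j' ∈ (H g).supp
        · obtain ⟨rfl, -⟩ := h1 hj
          exact Or.inl ((hQX j' hj l'').imp fun p => Exists.imp fun b => Or.inl)
        · exact Or.inr ⟨j', hj, a, l'', rfl⟩
      case mid g' hg' j' l'' =>
        obtain ⟨rfl, -⟩ := h1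
        exact absurd ⟨hg', j', l'', hw⟩ hm
      case copyX g' j' l'' =>
        obtain rfl : g' = g := by
          rcases h1 with h1 | h1 | h1
          · cases h1; rfl
          · exact h1.1.symm
          · exact h1.1
        exact Or.inl ((hX j' l'').imp fun p => Exists.imp fun b => Or.inr)
  by_cases hy : ∃ hg i l, .copyY g hg i l ∈ σ
  · obtain ⟨hg, i, l, hy⟩ := hy
    by_cases hm : ∃ hg j l', .mid g hg j l' ∈ σ
    · obtain ⟨hg, j, l', hm⟩ := hm
      refine ⟨_, _, .midY hg, fun w hw => ?_, Or.inr ⟨hg, rfl⟩⟩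
      have h1 := hadj _ hy w hw
      have h2 := hadj _ hm w hw
      cases w <;> simp only [CoreAdj, coreRel, reduceCtorEq, or_false, false_or] at h1 h2
      case qubit j' a l'' =>
        exact Or.inr ⟨j', h2, a, l'', rfl⟩
      case mid g' hg' j' l'' =>
        obtain ⟨rfl, -⟩ := h1
        exact Or.inl ((hM hg' j' l'').imp fun p => Exists.imp fun b => Or.inl)
      case copyY g' hg' j' l'' =>
        obtain rfl : g' = g := by
          rcases h1 with h1 | h1 | h1
          · cases h1; rfl
          · exact h1.1.symm
          · exact h1.1
        exact Or.inl ((hY hg' j' l'').imp fun p => Exists.imp fun b => Or.inr)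
    · refine ⟨_, _, .y hg, fun w hw => ?_, ?_⟩
      swap
      · obtain ⟨p, b, e⟩ := hY hg i l
        exact Or.inl ⟨p, b, e ▸ hy⟩
      have h1 := hadj _ hy w hw
      cases w <;> simp only [CoreAdj, coreRel, reduceCtorEq, or_false, false_or] at h1
      case qubit j' a l'' =>
        by_cases hj : j' ∈ (H g).supp
        · obtain ⟨rfl, -⟩ := h1 hj
          exact Or.inl ((hQY j' hj l'').imp fun p => Exists.imp fun b => Or.inl)
        · exact Or.inr ⟨j', hj, a, l'', rfl⟩
      case mid g' hg' j' l'' =>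
        obtain ⟨rfl, -⟩ := h1
        exact absurd ⟨hg', j', l'', hw⟩ hm
      case copyY g' hg' j' l'' =>
        obtain rfl : g' = g := by
          rcases h1 with h1 | h1 | h1
          · cases h1; rfl
          · exact h1.1.symm
          · exact h1.1
        exact Or.inl ((hY hg' j' l'').imp fun p => Exists.imp fun b => Or.inr)
  have hreg := hσ.1 v hv
  cases v <;> simp only [Vertex.gadget, reduceCtorEq, Option.some.injEq] at hvg
  case copyX g' i l => subst hvg; exact absurd ⟨i, l, hv⟩ hx
  case copyY g' hg i l => subst hvg; exact absurd ⟨hg, i, l, hv⟩ hy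
  case axis => exact hreg.elim
  case apex => exact hreg.elim
  case mid g' hg i l =>
    subst hvg
    refine ⟨_, _, .midX hg, fun w hw => ?_, Or.inr ⟨hg, rfl⟩⟩
    have h1 := hadj _ hv w hw
    cases w <;> simp only [CoreAdj, coreRel, reduceCtorEq, or_false, false_or] at h1
    case qubit j' a l'' => exact Or.inr ⟨j', h1, a, l'', rfl⟩
    case mid g'' hg' j' l'' =>
      obtain rfl : g'' = g' := by
        rcases h1 with h1 | h1 | h1
        · cases h1; rfl
        · exact h1.1.symm
        · exact h1.1
      exact Or.inl ((hM hg' j' l'').imp fun p => Exists.imp fun b => Or.inl)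
    case copyX g'' j' l'' => obtain ⟨rfl, -⟩ := h1; exact absurd ⟨j', l'', hw⟩ hx
    case copyY g'' hg' j' l'' => obtain ⟨rfl, -⟩ := h1; exact absurd ⟨hg', j', l'', hw⟩ hy

end Gadget

/-! ### Distinguishing the layers of the gadget complex -/

section Gadget

variable {n t : ℕ} {H : Fin t → Term n} {hn : 0 < n} {g : Fin t}

open Vertex PositionedGraph

theorem Vertex.gadget_eq_none_of_mem_rest {ρ : Finset (Vertex H)} {I : Finset (Fin n)}
    (hρ : ρ ∈ restSimplices H I) {v : Vertex H} (hv : v ∈ ρ) : v.gadget = none := by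
  obtain ⟨i, -, a, l, rfl⟩ := hρ.2.2 v hv
  rfl

theorem IsGluingPair.gadget_mixVertex {lo hi : GadgetPos H g → Bool → Vertex H}
    (h : IsGluingPair H g lo hi) (k : ℕ) (f : GadgetPos H g → Bool) (p : GadgetPos H g) :
    (mixVertex lo hi k f p).gadget = none ∨ (mixVertex lo hi k f p).gadget = some g := by
  unfold mixVertex
  split_ifs
  exacts [h.gadget_lo _ _, Or.inr (h.gadget_hi _ _)]

/-- A member of a layer of the term `g` leaves the qubit graph, and only into the gadget of `g`. -/
theorem gadget_of_mem_join {B : Layer (Vertex H)} (hB : B ∈ termLayers H g)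
    {σ : Finset (Vertex H)} (hσ : σ ∈ (B.join (restSimplices H (H g).supp)).simplices)
    (hn : 0 < n) :
    (∀ v ∈ σ, v.gadget = none ∨ v.gadget = some g) ∧ ∃ v ∈ σ, v.gadget = some g := by
  obtain ⟨k, S, hM⟩ := exists_isMixLayer hn hB
  have hmix : ∀ {lo hi : GadgetPos H g → Bool → Vertex H} (_ : IsGluingPair H g lo hi) k f ρ
      (_ : ρ ∈ restSimplices H (H g).supp), ∀ v ∈ mixSimplex lo hi k f ∪ ρ,
      v.gadget = none ∨ v.gadget = some g := by
    intro lo hi h k f ρ hρ v hv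
    rcases mem_union.1 hv with hv | hv
    · obtain ⟨p, -, rfl⟩ := mem_image.1 hv
      exact h.gadget_mixVertex k f p
    · exact Or.inl (gadget_eq_none_of_mem_rest hρ hv)
  obtain ⟨ρ, hρ, ⟨q, hq, f, rfl⟩ | ⟨q, hq, f, p, hk, hp, rfl⟩ | ⟨hg, f, p, -, rfl⟩⟩ :=
    hM.simplices_join hσ
  · refine ⟨hmix (hM.pair q hq) _ _ _ hρ, ?_⟩
    obtain ⟨p, hp⟩ := hM.exists_gadget q hq f
    exact ⟨_, mem_union_left _ (mem_image_of_mem _ (mem_univ p)), hp⟩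
  · have hpair := hM.pair q hq
    constructor
    · intro v hv
      rcases mem_union.1 hv with hv | hv
      · have := (mem_erase.1 hv).2
        rcases mem_union.1 this with h | h
        · obtain ⟨r, -, rfl⟩ := mem_image.1 h
          exact hpair.gadget_lo _ _
        · obtain ⟨r, -, rfl⟩ := mem_image.1 h
          exact Or.inr (hpair.gadget_hi _ _)
      · exact Or.inl (gadget_eq_none_of_mem_rest hρ hv)
    · obtain ⟨r, hr⟩ := exists_posRank_eq (ι := GadgetPos H g)
        (r := Fintype.card (GadgetPos H g) - k) (by omega)
      refine ⟨q.2 r (f r), mem_union_left _ (mem_erase.2 ⟨fun e => ?_, ?_⟩), hpair.gadget_hi _ _⟩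
      · have G := hpair.isGluing (hn := hn)
        exact G.lower p (f p) (e ▸ G.upper r (f r))
      · exact mem_union_right _ (mem_image_of_mem _ (mem_filter.2 ⟨mem_univ _, by omega⟩))
  · constructor
    · intro v hv
      rcases mem_insert.1 hv with rfl | hv
      · exact Or.inr rfl
      · exact hmix .x _ _ _ hρ v (mem_of_mem_erase hv)
    · exact ⟨_, mem_insert_self _ _, rfl⟩

/-- The number of vertices outside the qubit graph. -/
def newCount (σ : Finset (Vertex H)) : ℕ := (σ.filter (fun v => v.gadget ≠ none)).card

open Classical in
/-- The number of vertices of the copies `K'ˣ` and `K'ʸ`. -/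
noncomputable def copyCount (σ : Finset (Vertex H)) : ℕ := (σ.filter IsCopy).card

theorem newCount_union {α ρ : Finset (Vertex H)} {I : Finset (Fin n)}
    (hρ : ρ ∈ restSimplices H I) : newCount (α ∪ ρ) = newCount α := by
  unfold newCount
  rw [filter_union, (filter_eq_empty_iff (s := ρ)).2, union_empty]
  intro v hv
  simp [gadget_eq_none_of_mem_rest hρ hv]

theorem copyCount_union {α ρ : Finset (Vertex H)} {I : Finset (Fin n)}
    (hρ : ρ ∈ restSimplices H I) : copyCount (α ∪ ρ) = copyCount α := by
  classical
  unfold copyCount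
  rw [filter_union, (filter_eq_empty_iff (s := ρ)).2, union_empty]
  intro v hv
  obtain ⟨i, -, a, l, rfl⟩ := hρ.2.2 v hv
  exact id

theorem IsGluingPair.copyCount_eq (hn : 0 < n) {lo hi : GadgetPos H g → Bool → Vertex H}
    (h : IsGluingPair H g lo hi) {k : ℕ} (hk : k ≤ Fintype.card (GadgetPos H g))
    {σ : Finset (Vertex H)} (hσ : σ ∈ (thickLayer lo hi k).simplices) : copyCount σ = k := by
  have G := h.isGluing (hn := hn)
  classical
  unfold copyCount
  exact card_filter_thickLayer (Q := IsCopy) G.lower G.upper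
    (fun e => G.inj (by rw [← G.pos_hi, e, G.pos_hi])) hk hσ

theorem IsGluingPair.newCount_eq_of_qubit (hn : 0 < n)
    {lo hi : GadgetPos H g → Bool → Vertex H}
    (h : IsGluingPair H g lo hi) (hlo : ∀ p b, (lo p b).gadget = none) {k : ℕ}
    (hk : k ≤ Fintype.card (GadgetPos H g))
    {σ : Finset (Vertex H)} (hσ : σ ∈ (thickLayer lo hi k).simplices) : newCount σ = k := by
  have G := h.isGluing (hn := hn)
  unfold newCount
  exact card_filter_thickLayer (fun p b => by simp [hlo]) (fun p b => by simp [h.gadget_hi p b])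
    (fun e => G.inj (by rw [← G.pos_hi, e, G.pos_hi])) hk hσ

theorem IsGluingPair.newCount_eq_of_mid (hn : 0 < n)
    {lo hi : GadgetPos H g → Bool → Vertex H}
    (h : IsGluingPair H g lo hi) (hlo : ∀ p b, (lo p b).gadget = some g) {k : ℕ} (hk0 : 0 < k)
    (hk : k ≤ Fintype.card (GadgetPos H g))
    {σ : Finset (Vertex H)} (hσ : σ ∈ (thickLayer lo hi k).simplices) :
    newCount σ = Fintype.card (GadgetPos H g) := by
  classical
  have G := h.isGluing (hn := hn)
  rw [← card_of_mem_thickLayer (Q := IsCopy) G.lower G.upper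
    (fun e => G.inj (by rw [← G.pos_hi, e, G.pos_hi]))
    (fun e => G.inj (by rw [← G.pos_lo, e, G.pos_lo])) hk0 hk hσ]
  unfold newCount
  rw [filter_true_of_mem]
  obtain ⟨f, p, -, rfl⟩ := hσ
  intro v hv
  rcases mem_union.1 (mem_of_mem_erase hv) with hv | hv
  · obtain ⟨r, -, rfl⟩ := mem_image.1 hv
    simp [hlo]
  · obtain ⟨r, -, rfl⟩ := mem_image.1 hv
    simp [h.gadget_hi]

theorem counts_octahedronLayer (hn : 0 < n) (hg : (H g).IsGlue) {σ : Finset (Vertex H)}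
    (hσ : σ ∈ (octahedronLayer (octMid H g hg)).simplices) :
    newCount σ = Fintype.card (GadgetPos H g) ∧ copyCount σ = 0 := by
  have G := isGluing_octMid_octCopyX (hn := hn) hg
  obtain ⟨f, rfl⟩ := hσ
  constructor
  · unfold newCount
    rw [filter_true_of_mem, card_image_of_injective, card_univ]
    · exact fun p p' e => G.inj (by rw [← G.pos_lo p (f p), e, G.pos_lo])
    · intro v hv
      obtain ⟨p, -, rfl⟩ := mem_image.1 hv
      simp [octMid, Vertex.gadget]
  · classical
    unfold copyCount
    rw [card_eq_zero, filter_eq_empty_iff]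
    intro v hv
    obtain ⟨p, -, rfl⟩ := mem_image.1 hv
    exact id

theorem newCount_fillLayer (hn : 0 < n) (hg : ¬ (H g).IsGlue) {σ : Finset (Vertex H)}
    (hσ : σ ∈ (fillLayer H g hg).simplices) : newCount σ = Fintype.card (GadgetPos H g) := by
  have G := isGluing_octX (hn := hn) (H := H) (g := g)
  rcases hσ with hσ | ⟨f, p, rfl⟩
  · rw [IsGluingPair.newCount_eq_of_qubit hn .x (fun _ _ => rfl) card_gadgetPos.ge hσ,
      card_gadgetPos]
  · unfold newCount
    have hP : 0 < Fintype.card (GadgetPos H g) := lt_of_lt_of_le two_pos card_gadgetPos_ge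
    rw [filter_true_of_mem, card_insert_of_notMem,
      card_erase_of_mem (mem_image_of_mem _ (mem_univ p)), card_image_of_injective, card_univ]
    · omega
    · exact fun p p' e => G.inj (by rw [← G.pos_hi p (f p), e, G.pos_hi])
    · intro h
      obtain ⟨r, -, e⟩ := mem_image.1 (mem_of_mem_erase h)
      simp [octCopyX] at e
    · intro v hv
      rcases mem_insert.1 hv with rfl | hv
      · simp [Vertex.gadget]
      · obtain ⟨r, -, rfl⟩ := mem_image.1 (mem_of_mem_erase hv)
        simp [octCopyX, Vertex.gadget]

/-- All members of a layer have the same number of vertices outside the qubit graph. -/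
theorem exists_newCount (hn : 0 < n) {B : Layer (Vertex H)} (hB : B ∈ termLayers H g) :
    ∃ N, ∀ σ ∈ B.simplices, newCount σ = N := by
  have hP := card_gadgetPos (H := H) (g := g)
  have h2 := card_gadgetPos_ge (H := H) (g := g)
  unfold termLayers at hB
  split_ifs at hB with hg
  · simp only [List.mem_append, List.mem_map, List.mem_reverse, List.mem_range'_1,
      List.mem_cons, List.not_mem_nil, or_false] at hB
    rcases hB with (⟨k, hk, rfl⟩ | ⟨k, hk, rfl⟩) | rfl | rfl | rfl
    · refine ⟨k, ?_⟩
      rintro σ (hσ | hσ)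
      · exact IsGluingPair.newCount_eq_of_qubit hn .x (fun _ _ => rfl) (by omega) hσ
      · exact IsGluingPair.newCount_eq_of_qubit hn (.y hg) (fun _ _ => rfl) (by omega) hσ
    · refine ⟨Fintype.card (GadgetPos H g), ?_⟩
      rintro σ (hσ | hσ)
      · exact IsGluingPair.newCount_eq_of_mid hn (.midX hg) (fun _ _ => rfl) (by omega)
          (by omega) hσ
      · exact IsGluingPair.newCount_eq_of_mid hn (.midY hg) (fun _ _ => rfl) (by omega)
          (by omega) hσ
    · exact ⟨_, fun σ hσ => IsGluingPair.newCount_eq_of_mid hn (.midX hg) (fun _ _ => rfl)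
        one_pos (by omega) hσ⟩
    · exact ⟨_, fun σ hσ => IsGluingPair.newCount_eq_of_mid hn (.midY hg) (fun _ _ => rfl)
        one_pos (by omega) hσ⟩
    · exact ⟨_, fun σ hσ => (counts_octahedronLayer hn hg hσ).1⟩
  · simp only [List.mem_append, List.mem_map, List.mem_range'_1,
      List.mem_cons, List.not_mem_nil, or_false] at hB
    rcases hB with ⟨k, hk, rfl⟩ | rfl
    · exact ⟨k, fun σ hσ => IsGluingPair.newCount_eq_of_qubit hn .x (fun _ _ => rfl) (by omega) hσ⟩
    · exact ⟨_, fun σ hσ => newCount_fillLayer hn hg hσ⟩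

theorem disjoint_join_of_counts {A B : Layer (Vertex H)} {F : ℕ → ℕ → ℕ}
    (h : ∀ σ ∈ A.simplices, ∀ σ' ∈ B.simplices,
      F (newCount σ) (copyCount σ) ≠ F (newCount σ') (copyCount σ')) (I : Finset (Fin n)) :
    Disjoint (A.join (restSimplices H I)).simplices (B.join (restSimplices H I)).simplices := by
  rw [Set.disjoint_left]
  rintro _ ⟨α, hα, ρ, hρ, rfl⟩ ⟨β, hβ, ρ', hρ', e⟩
  refine h α hα β hβ ?_
  rw [← newCount_union hρ, ← copyCount_union hρ, e, newCount_union hρ', copyCount_union hρ']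

/-- The layers of one gadget are disjoint. With `N` new vertices, `C` of which belong to the copies,
the number `2 N - C` increases along the list, but it is the same for the first layers of
`K'' → K'ˣ` and `K'' → K'ʸ`. -/
theorem pairwise_termLayers (hn : 0 < n) : (termLayers H g).Pairwise (fun A B => Disjoint
    (A.join (restSimplices H (H g).supp)).simplices
    (B.join (restSimplices H (H g).supp)).simplices) := by
  have hP := card_gadgetPos (H := H) (g := g)
  have h2 := card_gadgetPos_ge (H := H) (g := g)
  have hmid1 : ∀ hg, Disjoint
      ((thickLayer (octMid H g hg) (octCopyX H g) 1).join (restSimplices H (H g).supp)).simplices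
      ((thickLayer (octMid H g hg) (octCopyY H g hg) 1).join
        (restSimplices H (H g).supp)).simplices := by
    classical
    intro hg
    rw [Set.disjoint_left]
    rintro _ ⟨α, hα, ρ, hρ, rfl⟩ ⟨β, hβ, ρ', hρ', e⟩
    have hc := IsGluingPair.copyCount_eq hn (.midX hg) (k := 1) (by omega) hα
    unfold copyCount at hc
    obtain ⟨v, hv⟩ := card_pos.1 (by rw [hc]; exact one_pos)
    obtain ⟨hvα, hvc⟩ := mem_filter.1 hv
    have hvβ : v ∈ β ∪ ρ' := e ▸ mem_union_left _ hvα
    obtain ⟨f, p, -, rfl⟩ := hα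
    have hX : ∃ r b, v = octCopyX H g r b := by
      rcases mem_union.1 (mem_of_mem_erase hvα) with h | h
      · obtain ⟨r, -, rfl⟩ := mem_image.1 h
        exact hvc.elim
      · obtain ⟨r, -, rfl⟩ := mem_image.1 h
        exact ⟨_, _, rfl⟩
    obtain ⟨r, b, rfl⟩ := hX
    rcases mem_union.1 hvβ with h | h
    · obtain ⟨f', p', -, rfl⟩ := hβ
      rcases mem_union.1 (mem_of_mem_erase h) with h | h
      · obtain ⟨r', -, e'⟩ := mem_image.1 h
        simp [octMid, octCopyX] at e'
      · obtain ⟨r', -, e'⟩ := mem_image.1 h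
        simp [octCopyY, octCopyX] at e'
    · exact absurd (gadget_eq_none_of_mem_rest hρ' h) (by simp [octCopyX, Vertex.gadget])
  have hxy : ∀ hg k, k ≤ 2 * (H g).supp.card →
      ∀ σ ∈ ((thickLayer (octX H g) (octCopyX H g) k).union
        (thickLayer (octY H g) (octCopyY H g hg) k)).simplices,
      2 * newCount σ - copyCount σ = k := by
    rintro hg k hk σ (hσ | hσ)
    · rw [IsGluingPair.newCount_eq_of_qubit hn .x (fun _ _ => rfl) (by omega) hσ,
        IsGluingPair.copyCount_eq hn .x (by omega) hσ]
      omega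
    · rw [IsGluingPair.newCount_eq_of_qubit hn (.y hg) (fun _ _ => rfl) (by omega) hσ,
        IsGluingPair.copyCount_eq hn (.y hg) (by omega) hσ]
      omega
  have hmX : ∀ hg k, 0 < k → k ≤ 2 * (H g).supp.card →
      ∀ σ ∈ (thickLayer (octMid H g hg) (octCopyX H g) k).simplices,
      2 * newCount σ - copyCount σ = 4 * (H g).supp.card - k := by
    intro hg k hk0 hk σ hσ
    rw [IsGluingPair.newCount_eq_of_mid hn (.midX hg) (fun _ _ => rfl) hk0 (by omega) hσ,
      IsGluingPair.copyCount_eq hn (.midX hg) (by omega) hσ]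
    omega
  have hmY : ∀ hg k, 0 < k → k ≤ 2 * (H g).supp.card →
      ∀ σ ∈ (thickLayer (octMid H g hg) (octCopyY H g hg) k).simplices,
      2 * newCount σ - copyCount σ = 4 * (H g).supp.card - k := by
    intro hg k hk0 hk σ hσ
    rw [IsGluingPair.newCount_eq_of_mid hn (.midY hg) (fun _ _ => rfl) hk0 (by omega) hσ,
      IsGluingPair.copyCount_eq hn (.midY hg) (by omega) hσ]
    omega
  have hmid : ∀ hg k, 0 < k → k ≤ 2 * (H g).supp.card →
      ∀ σ ∈ ((thickLayer (octMid H g hg) (octCopyX H g) k).union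
        (thickLayer (octMid H g hg) (octCopyY H g hg) k)).simplices,
      2 * newCount σ - copyCount σ = 4 * (H g).supp.card - k := by
    rintro hg k hk0 hk σ (hσ | hσ)
    exacts [hmX hg k hk0 hk σ hσ, hmY hg k hk0 hk σ hσ]
  have hoct : ∀ hg, ∀ σ ∈ (octahedronLayer (octMid H g hg)).simplices,
      2 * newCount σ - copyCount σ = 4 * (H g).supp.card := by
    intro hg σ hσ
    rw [(counts_octahedronLayer hn hg hσ).1, (counts_octahedronLayer hn hg hσ).2]
    omega
  have key : ∀ {A B : Layer (Vertex H)} {a b : ℕ},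
      (∀ σ ∈ A.simplices, 2 * newCount σ - copyCount σ = a) →
      (∀ σ ∈ B.simplices, 2 * newCount σ - copyCount σ = b) → a ≠ b → Disjoint
      (A.join (restSimplices H (H g).supp)).simplices
      (B.join (restSimplices H (H g).supp)).simplices := fun hA hB hab =>
    disjoint_join_of_counts (F := fun x y => 2 * x - y)
      (fun σ hσ σ' hσ' => by simpa only [hA σ hσ, hB σ' hσ'] using hab) _
  unfold termLayers
  split_ifs with hg
  · rw [List.pairwise_append, List.pairwise_append]
    refine ⟨⟨?_, ?_, ?_⟩, ?_, ?_⟩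
    · rw [List.pairwise_map]
      refine (List.pairwise_lt_range' (s := 1)).imp_of_mem fun {k l} hk hl h => ?_
      rw [List.mem_range'_1] at hk hl
      exact key (hxy hg k (by omega)) (hxy hg l (by omega)) h.ne
    · rw [List.pairwise_map, List.pairwise_reverse]
      refine (List.pairwise_lt_range' (s := 2)).imp_of_mem fun {k l} hk hl h => ?_
      rw [List.mem_range'_1] at hk hl
      exact key (hmid hg l (by omega) (by omega)) (hmid hg k (by omega) (by omega)) (by omega)
    · intro A hA B hB
      obtain ⟨k, hk, rfl⟩ := List.mem_map.1 hA
      obtain ⟨l, hl, rfl⟩ := List.mem_map.1 hB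
      rw [List.mem_reverse] at hl
      rw [List.mem_range'_1] at hk hl
      exact key (hxy hg k (by omega)) (hmid hg l (by omega) (by omega)) (by omega)
    · simp only [List.pairwise_cons, List.mem_cons, List.not_mem_nil, or_false, forall_eq_or_imp,
        forall_eq, IsEmpty.forall_iff, implies_true, List.Pairwise.nil, and_true]
      exact ⟨⟨hmid1 hg, key (hmX hg 1 one_pos (by omega)) (hoct hg) (by omega)⟩,
        key (hmY hg 1 one_pos (by omega)) (hoct hg) (by omega)⟩
    · intro A hA B hB
      have hA' : ∃ a, a + 1 < 4 * (H g).supp.card ∧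
          ∀ σ ∈ A.simplices, 2 * newCount σ - copyCount σ = a := by
        rcases List.mem_append.1 hA with hA | hA
        · obtain ⟨k, hk, rfl⟩ := List.mem_map.1 hA
          rw [List.mem_range'_1] at hk
          exact ⟨k, by omega, hxy hg k (by omega)⟩
        · obtain ⟨l, hl, rfl⟩ := List.mem_map.1 hA
          rw [List.mem_reverse, List.mem_range'_1] at hl
          exact ⟨_, by omega, hmid hg l (by omega) (by omega)⟩
      obtain ⟨a, ha, hA'⟩ := hA'
      simp only [List.mem_cons, List.not_mem_nil, or_false] at hB
      rcases hB with rfl | rfl | rfl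
      · exact key hA' (hmX hg 1 one_pos (by omega)) (by omega)
      · exact key hA' (hmY hg 1 one_pos (by omega)) (by omega)
      · exact key hA' (hoct hg) (by omega)
  · rw [List.pairwise_append]
    have hx : ∀ k, k ≤ 2 * (H g).supp.card →
        ∀ σ ∈ (thickLayer (octX H g) (octCopyX H g) k).simplices, newCount σ = k := fun k hk σ hσ =>
      IsGluingPair.newCount_eq_of_qubit hn .x (fun _ _ => rfl) (by omega) hσ
    have key' : ∀ {A B : Layer (Vertex H)} {a b : ℕ},
        (∀ σ ∈ A.simplices, newCount σ = a) → (∀ σ ∈ B.simplices, newCount σ = b) → a ≠ b →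
        Disjoint (A.join (restSimplices H (H g).supp)).simplices
        (B.join (restSimplices H (H g).supp)).simplices := fun hA hB hab =>
      disjoint_join_of_counts (F := fun x _ => x)
        (fun σ hσ σ' hσ' => by simpa only [hA σ hσ, hB σ' hσ'] using hab) _
    refine ⟨?_, List.pairwise_singleton _ _, ?_⟩
    · rw [List.pairwise_map]
      refine (List.pairwise_lt_range' (s := 1)).imp_of_mem fun {k l} hk hl h => ?_
      rw [List.mem_range'_1] at hk hl
      exact key' (hx k (by omega)) (hx l (by omega)) h.ne
    · intro A hA B hB
      obtain ⟨k, hk, rfl⟩ := List.mem_map.1 hA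
      rw [List.mem_range'_1] at hk
      obtain rfl := List.mem_singleton.1 hB
      exact key' (hx k (by omega)) (fun σ hσ => newCount_fillLayer hn hg hσ) (by omega)

theorem pairwise_allLayers (hn : 0 < n) :
    (allLayers (disjComplex H) (2 * n - 1) (gadgetLayers H)).Pairwise
      (fun A B => Disjoint A.simplices B.simplices) := by
  unfold allLayers
  rw [List.pairwise_cons]
  constructor
  · intro A hA
    unfold gadgetLayers at hA
    obtain ⟨g, -, hA⟩ := List.mem_flatMap.1 hA
    obtain ⟨B, hB, rfl⟩ := List.mem_map.1 hA
    rw [Set.disjoint_left]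
    intro σ hσ hσ'
    obtain ⟨v, hv, e⟩ := (gadget_of_mem_join hB hσ' hn).2
    obtain ⟨i, a, l, rfl⟩ := ((mem_simplicesOfDim_disjComplex hn).1 hσ).2 v hv
    simp [Vertex.gadget] at e
  · unfold gadgetLayers
    rw [List.pairwise_flatMap]
    constructor
    · intro g _
      rw [List.pairwise_map]
      exact pairwise_termLayers hn
    · refine (List.nodup_finRange t).imp fun {g g'} hgg A hA A' hA' => ?_
      obtain ⟨B, hB, rfl⟩ := List.mem_map.1 hA
      obtain ⟨B', hB', rfl⟩ := List.mem_map.1 hA'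
      rw [Set.disjoint_left]
      intro σ hσ hσ'
      obtain ⟨v, hv, e⟩ := (gadget_of_mem_join hB hσ hn).2
      rcases (gadget_of_mem_join hB' hσ' hn).1 v hv with h | h
      · rw [e] at h; cases h
      · rw [e, Option.some.injEq] at h
        exact hgg h

/-- The weight of a simplex is `lam ^ N` for the number `N` of its vertices outside the qubit graph,
which is constant on each layer. -/
theorem exists_weight_eq (hn : 0 < n) (lam : ℝ) {A : Layer (Vertex H)}
    (hA : A ∈ allLayers (disjComplex H) (2 * n - 1) (gadgetLayers H)) :
    ∃ W : ℝ, ∀ σ ∈ A.simplices, ∏ v ∈ σ, vertexWeight lam v = W := by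
  have hw : ∀ σ : Finset (Vertex H), ∏ v ∈ σ, vertexWeight lam v = lam ^ newCount σ := by
    intro σ
    unfold newCount
    rw [← prod_filter_mul_prod_filter_not σ (fun v => v.gadget ≠ none)]
    rw [prod_congr rfl (g := fun _ => lam), prod_const, prod_eq_one, mul_one]
    · intro v hv
      obtain ⟨i, a, l, rfl⟩ := gadget_eq_none_iff.1 (not_not.1 (mem_filter.1 hv).2)
      rfl
    · intro v hv
      have := (mem_filter.1 hv).2
      cases v
      exacts [absurd rfl this, rfl, rfl, rfl, rfl, rfl]
  rcases mem_allLayers_iff.1 hA with rfl | ⟨g, B, hB, rfl⟩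
  · refine ⟨1, fun σ hσ => prod_eq_one fun v hv => ?_⟩
    obtain ⟨i, a, l, rfl⟩ := ((mem_simplicesOfDim_disjComplex hn).1 hσ).2 v hv
    rfl
  · obtain ⟨N, hN⟩ := exists_newCount hn hB
    refine ⟨lam ^ N, ?_⟩
    rintro _ ⟨α, hα, ρ, hρ, rfl⟩
    rw [hw, newCount_union hρ, hN α hα]

theorem length_gadgetLayers_le : (gadgetLayers H).length ≤ 5 * n * t := by
  have h1 : ∀ g, (termLayers H g).length ≤ 5 * n := by
    intro g
    have h := card_le_univ (H g).supp
    have h0 := (H g).supp_nonempty.card_pos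
    rw [Fintype.card_fin] at h
    unfold termLayers
    split_ifs <;> simp <;> omega
  unfold gadgetLayers
  rw [List.length_flatMap]
  refine (List.sum_le_card_nsmul _ (5 * n) ?_).trans ?_
  · intro x hx
    obtain ⟨g, -, rfl⟩ := List.mem_map.1 hx
    rw [List.length_map]
    exact h1 g
  · simp [mul_comm]

end Gadget

/-! ### The gadget complex is layered -/

section Gadget

variable {n t : ℕ} {H : Fin t → Term n} {hn : 0 < n} {g : Fin t}

open Vertex PositionedGraph

theorem transversal_of_mem_principal {A : Layer (Vertex H)}
    (hA : A ∈ allLayers (disjComplex H) (2 * n - 1) (gadgetLayers H)) {σ : Finset (Vertex H)}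
    (hσ : σ ∈ A.principal) : (coreGraph H hn).IsTransversal σ := by
  rcases mem_allLayers_iff.1 hA with rfl | ⟨g, B, hB, rfl⟩
  · exact ((mem_simplicesOfDim_disjComplex hn).1 hσ).1
  · obtain ⟨k, S, hM⟩ := exists_isMixLayer hn hB
    obtain ⟨q, hq, f, ρ, hρ, rfl⟩ := hM.principal_join.1 hσ
    exact (hM.pair q hq).transversal hρ k f

/-- The simplex spanned by the central vertex of a filling gadget and a principal simplex of its
last layer. -/
theorem insert_apex_mem (hn : 0 < n) (hg : ¬ (H g).IsGlue) {ρ : Finset (Vertex H)}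
    (hρ : ρ ∈ restSimplices H (H g).supp) (f : GadgetPos H g → Bool) :
    insert (.apex g hg) (mixSimplex (octX H g) (octCopyX H g) (Fintype.card (GadgetPos H g)) f ∪ ρ)
      ∈ gadgetComplex H := by
  have hT := (IsGluingPair.x (H := H) (g := g)).transversal (hn := hn) hρ
    (Fintype.card (GadgetPos H g)) f
  have hadj : ∀ w ∈ mixSimplex (octX H g) (octCopyX H g) (Fintype.card (GadgetPos H g)) f ∪ ρ,
      (gadgetGraph H).Adj w (.apex g hg) := by
    intro w hw
    rw [mixSimplex_card] at hw
    unfold gadgetGraph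
    rw [SimpleGraph.fromRel_adj]
    rcases mem_union.1 hw with hw | hw
    · obtain ⟨p, -, rfl⟩ := mem_image.1 hw
      exact ⟨by simp [octCopyX], Or.inl rfl⟩
    · obtain ⟨i, hi, a, l, rfl⟩ := hρ.2.2 w hw
      exact ⟨by simp, Or.inl hi⟩
  refine ⟨insert_nonempty _ _, Set.subset_univ _, ?_⟩
  rw [coe_insert, SimpleGraph.isClique_insert]
  refine ⟨fun v hv w hw hvw => ((coreAdj_iff hvw).1 (hT.good.2 v hv w hw hvw)).2.2.1,
    fun w hw _ => (hadj w hw).symm⟩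

theorem apex_notMem_of_isGood {σ : Finset (Vertex H)} (hσ : (coreGraph H hn).IsGood σ)
    {hg : ¬ (H g).IsGlue} : Vertex.apex g hg ∉ σ :=
  fun h => hσ.1 _ h

/-- A member of a layer is principal, misses a lower vertex of a slab simplex, or touches the
central vertex of a filling gadget. -/
theorem mem_layer_cases {A : Layer (Vertex H)}
    (hA : A ∈ allLayers (disjComplex H) (2 * n - 1) (gadgetLayers H)) {σ : Finset (Vertex H)}
    (hσ : σ ∈ A.simplices) :
    σ ∈ A.principal ∨ (coreGraph H hn).IsLowerFace A σ ∨
    ∃ g, ∃ hg : ¬ (H g).IsGlue, ∃ f p, ∃ ρ ∈ restSimplices H (H g).supp,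
      A = (fillLayer H g hg).join (restSimplices H (H g).supp) ∧
      σ = insert (.apex g hg) ((mixSimplex (octX H g) (octCopyX H g)
        (Fintype.card (GadgetPos H g)) f ∪ ρ).erase (octCopyX H g p (f p))) := by
  rcases mem_allLayers_iff.1 hA with rfl | ⟨g, B, hB, rfl⟩
  · exact Or.inl hσ
  obtain ⟨k, S, hM⟩ := exists_isMixLayer hn hB
  obtain ⟨ρ, hρ, ⟨q, hq, f, rfl⟩ | ⟨q, hq, f, p, hk, hp, rfl⟩ | ⟨hg, f, p, rfl, rfl⟩⟩ :=
    hM.simplices_join hσ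
  · exact Or.inl (hM.principal_join.2 ⟨q, hq, f, ρ, hρ, rfl⟩)
  · exact Or.inr (Or.inl (hM.isLowerFace hq hρ hk hp))
  · exact Or.inr (Or.inr ⟨g, hg, f, p, ρ, hρ, rfl, rfl⟩)

theorem octCopyX_mem (f : GadgetPos H g → Bool) (p : GadgetPos H g) (ρ : Finset (Vertex H)) :
    octCopyX H g p (f p) ∈
      mixSimplex (octX H g) (octCopyX H g) (Fintype.card (GadgetPos H g)) f ∪ ρ := by
  rw [mixSimplex_card]
  exact mem_union_left _ (mem_image_of_mem _ (mem_univ p))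

theorem card_of_mem_layer (hn : 0 < n) {A : Layer (Vertex H)}
    (hA : A ∈ allLayers (disjComplex H) (2 * n - 1) (gadgetLayers H)) {σ : Finset (Vertex H)}
    (hσ : σ ∈ A.simplices) : σ.card = Fintype.card (Fin n ×ₗ Bool) := by
  rcases mem_layer_cases (hn := hn) hA hσ with h | ⟨τ, a, b, u, u', hs, -, hu, -, -, -, rfl, -⟩ |
    ⟨g, hg, f, p, ρ, hρ, -, rfl⟩
  · exact (transversal_of_mem_principal (hn := hn) hA h).card
  · rw [card_erase_of_mem hu, hs.card]; rfl
  · have hT := (IsGluingPair.x (H := H) (g := g)).transversal (hn := hn) hρ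
      (Fintype.card (GadgetPos H g)) f
    have hm := octCopyX_mem f p ρ
    rw [card_insert_of_notMem fun h => apex_notMem_of_isGood hT.good (mem_of_mem_erase h),
      card_erase_of_mem hm, hT.card]
    have := card_positions (n := n)
    omega

theorem mem_gadgetComplex_of_mem_layer (hn : 0 < n) {A : Layer (Vertex H)}
    (hA : A ∈ allLayers (disjComplex H) (2 * n - 1) (gadgetLayers H)) {σ : Finset (Vertex H)}
    (hσ : σ ∈ A.simplices) : σ ∈ gadgetComplex H := by
  have hne : σ.Nonempty := by
    rw [← card_pos, card_of_mem_layer hn hA hσ, card_positions]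
    omega
  rcases mem_layer_cases (hn := hn) hA hσ with h | ⟨τ, a, b, u, u', hs, -, hu, -, -, -, rfl, -⟩ |
    ⟨g, hg, f, p, ρ, hρ, -, rfl⟩
  · exact mem_gadgetComplex_of_isGood hne (transversal_of_mem_principal (hn := hn) hA h).good
  · exact mem_gadgetComplex_of_isGood hne (hs.good.subset (erase_subset _ _))
  · exact ((gadgetComplex H).isRelLowerSet_faces (insert_apex_mem hn hg hρ f)).2
      (insert_subset_insert _ (erase_subset _ _)) hne

/-- Every transversal clique is a principal simplex of some layer: of the initial one, or of a
gluing of the only term whose gadget it meets. -/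
theorem exists_layer_of_transversal {σ : Finset (Vertex H)}
    (hσ : (coreGraph H hn).IsTransversal σ) :
    ∃ A ∈ allLayers (disjComplex H) (2 * n - 1) (gadgetLayers H), σ ∈ A.principal := by
  by_cases hq : ∀ v ∈ σ, ∃ i a l, v = .qubit i a l
  · exact ⟨_, mem_allLayers_iff.2 (Or.inl rfl), (mem_simplicesOfDim_disjComplex hn).2 ⟨hσ, hq⟩⟩
  push Not at hq
  obtain ⟨v, hv, hvq⟩ := hq
  obtain ⟨g, hg⟩ : ∃ g, v.gadget = some g := by
    rw [← Option.ne_none_iff_exists']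
    intro h
    obtain ⟨i, a, l, rfl⟩ := gadget_eq_none_iff.1 h
    exact hvq i a l rfl
  obtain ⟨lo, hi, hP, hmem, hk0⟩ := exists_gluingPair_of_isGood hσ.good hv hg
  have G := hP.isGluing (hn := hn)
  obtain ⟨k, f, hk, hf, hk'⟩ := G.exists_mixVertex_mem hσ fun p => by
    obtain ⟨w, hw, hwp⟩ := hσ.exists_pos (gadgetEmb H g p)
    rcases hmem w hw with ⟨p', b, e⟩ | ⟨i, hi, a, l, rfl⟩
    · obtain rfl : p' = p := G.inj (by
        rw [← hwp]
        rcases e with rfl | rfl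
        exacts [(G.pos_lo _ _).symm, (G.pos_hi _ _).symm])
      refine ⟨b, ?_⟩
      rcases e with rfl | rfl
      exacts [Or.inl hw, Or.inr hw]
    · have : i = (ofLex p).1 := congrArg (fun x => (ofLex x).1) hwp
      exact absurd (this ▸ (ofLex p).1.2) hi
  obtain ⟨B, hB, hBp⟩ := exists_mem_termLayers hn hP hk (hk0.imp hk' id)
  obtain ⟨k', S, hM⟩ := exists_isMixLayer hn hB
  refine ⟨_, mem_allLayers_iff.2 (Or.inr ⟨g, B, hB, rfl⟩), ?_⟩
  classical
  -- the layer `B` may present the simplex through another gluing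
  have hf0 := hBp f
  rw [hM.principal] at hf0
  obtain ⟨q, hq, f', e⟩ := hf0
  refine mem_principal_of_mixVertex hM hσ hq (f := f') (fun p => ?_) fun w hw hws => ?_
  · have : mixVertex q.1 q.2 k' f' p ∈ mixSimplex lo hi k f := by
      rw [e]; exact mem_image_of_mem _ (mem_univ p)
    obtain ⟨r, -, hr⟩ := mem_image.1 this
    rw [← hr]
    exact hf r
  · rcases hmem w hw with ⟨p, b, e⟩ | ⟨i, -, a, l, rfl⟩
    · refine absurd ?_ hws
      rcases e with rfl | rfl
      · rw [G.pos_lo]; exact (ofLex p).1.2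
      · rw [G.pos_hi]; exact (ofLex p).1.2
    · exact ⟨i, a, l, rfl⟩

/-- In a transversal clique the bit of a qubit vertex is determined by the other vertex of its
block. -/
theorem kind_eq_of_qubit {σ σ' : Finset (Vertex H)} (hσ : (coreGraph H hn).IsTransversal σ)
    (hσ' : (coreGraph H hn).IsTransversal σ') {v v' : Vertex H} (hv : v ∈ σ) (hv' : v' ∈ σ')
    (hp : (coreGraph H hn).pos v = (coreGraph H hn).pos v') (he : σ.erase v = σ'.erase v')
    (hq : ∃ i a l, v = .qubit i a l) (hq' : ∃ i a l, v' = .qubit i a l)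
    (hblock : ∀ w ∈ σ, w.block hn = v.block hn → ∃ i a l, w = .qubit i a l) :
    v.kind = v'.kind := by
  obtain ⟨i, a, l, rfl⟩ := hq
  obtain ⟨i', a', l', rfl⟩ := hq'
  obtain rfl : i = i' := (slot_eq_iff.1 hp).1
  obtain ⟨w, hw, hwp⟩ := hσ.exists_pos (toLex (i, !(decide (2 ≤ l))))
  have hwi : w.block hn = i := congrArg (fun x => (ofLex x).1) hwp
  obtain ⟨j, b, m, rfl⟩ := hblock w hw hwi
  obtain rfl : j = i := hwi
  have hne : (Vertex.qubit j b m : Vertex H) ≠ .qubit j a l := by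
    intro e
    rw [e] at hwp
    have := congrArg (fun x => (ofLex x).2) hwp
    change decide (2 ≤ l) = !decide (2 ≤ l) at this
    exact Bool.not_ne_self _ this.symm
  have hwe : Vertex.qubit j b m ∈ σ'.erase (.qubit j a' l') := by
    rw [← he]; exact mem_erase.2 ⟨hne, hw⟩
  obtain ⟨hne', hw'⟩ := mem_erase.1 hwe
  have h1 : b = a := by
    rcases hσ.good.2 _ hw _ hv hne with h | h
    exacts [h.2 rfl, (h.2 rfl).symm]
  have h2 : b = a' := by
    rcases hσ'.good.2 _ hw' _ hv' hne' with h | h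
    exacts [h.2 rfl, (h.2 rfl).symm]
  rw [← h1, ← h2]
  rfl

theorem qubit_of_mem_union_of_notMem_supp {lo hi : GadgetPos H g → Bool → Vertex H}
    (h : IsGluingPair H g lo hi) {k : ℕ} {f : GadgetPos H g → Bool} {ρ : Finset (Vertex H)}
    (hρ : ρ ∈ restSimplices H (H g).supp) {w : Vertex H} (hw : w ∈ mixSimplex lo hi k f ∪ ρ)
    (hws : (ofLex ((coreGraph H hn).pos w)).1 ∉ (H g).supp) : ∃ i a l, w = .qubit i a l := by
  rcases mem_union.1 hw with hw | hw
  · obtain ⟨p, -, rfl⟩ := mem_image.1 hw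
    exact absurd (h.pos_mem_supp k f p) hws
  · obtain ⟨i, -, a, l, rfl⟩ := hρ.2.2 w hw
    exact ⟨i, a, l, rfl⟩

/-- If the exchange takes place in a block of the term, the common face determines the pair of
octahedra, hence the kind; elsewhere the other vertex of the block determines the bit. -/
theorem kind_of_exchange {A : Layer (Vertex H)}
    (hA : A ∈ allLayers (disjComplex H) (2 * n - 1) (gadgetLayers H))
    {σ σ' : Finset (Vertex H)} {v v' : Vertex H} (hσ : σ ∈ A.principal) (hσ' : σ' ∈ A.principal)
    (hv : v ∈ σ) (hv' : v' ∈ σ') (hp : (coreGraph H hn).pos v = (coreGraph H hn).pos v')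
    (he : σ.erase v = σ'.erase v') : (coreGraph H hn).kind v = (coreGraph H hn).kind v' := by
  have hT := transversal_of_mem_principal (hn := hn) hA hσ
  have hT' := transversal_of_mem_principal (hn := hn) hA hσ'
  rcases mem_allLayers_iff.1 hA with rfl | ⟨g, B, hB, rfl⟩
  · have h1 := ((mem_simplicesOfDim_disjComplex hn).1 hσ).2
    have h2 := ((mem_simplicesOfDim_disjComplex hn).1 hσ').2
    exact kind_eq_of_qubit hT hT' hv hv' hp he (h1 v hv) (h2 v' hv') fun w hw _ => h1 w hw
  obtain ⟨k, S, hM⟩ := exists_isMixLayer hn hB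
  obtain ⟨q, hq, f, ρ, hρ, rfl⟩ := hM.principal_join.1 hσ
  obtain ⟨q', hq', f', ρ', hρ', rfl⟩ := hM.principal_join.1 hσ'
  by_cases hs : (ofLex ((coreGraph H hn).pos v)).1 ∈ (H g).supp
  · have hs' : (coreGraph H hn).pos v ∈ Set.range (gadgetEmb H g) := by
      rw [range_gadgetEmb]; exact hs
    obtain ⟨p₀, hp₀⟩ := hs'
    have G := (hM.pair q hq).isGluing (hn := hn)
    have G' := (hM.pair q' hq').isGluing (hn := hn)
    have hmem : ∀ p, mixVertex q.1 q.2 k f p ∈ mixSimplex q.1 q.2 k f ∪ ρ := fun p =>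
      mem_union_left _ (mem_image_of_mem _ (mem_univ p))
    have hmem' : ∀ p, mixVertex q'.1 q'.2 k f' p ∈ mixSimplex q'.1 q'.2 k f' ∪ ρ' := fun p =>
      mem_union_left _ (mem_image_of_mem _ (mem_univ p))
    have hqq : q = q' := hM.pair_eq q hq q' hq' f f' p₀ fun p hpp => by
      have hne : mixVertex q.1 q.2 k f p ≠ v := by
        rintro rfl
        rw [G.pos_mixVertex] at hp₀
        exact hpp (G.inj hp₀).symm
      have : mixVertex q.1 q.2 k f p ∈ (mixSimplex q'.1 q'.2 k f' ∪ ρ').erase v' := by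
        rw [← he]; exact mem_erase.2 ⟨hne, hmem p⟩
      exact hT'.inj (mem_of_mem_erase this) (hmem' p) (by rw [G.pos_mixVertex, G'.pos_mixVertex])
    subst hqq
    have e1 : mixVertex q.1 q.2 k f p₀ = v := hT.inj (hmem p₀) hv (by rw [G.pos_mixVertex, hp₀])
    have e2 : mixVertex q.1 q.2 k f' p₀ = v' :=
      hT'.inj (hmem' p₀) hv' (by rw [G.pos_mixVertex, hp₀, hp])
    rw [← e1, ← e2]
    exact G.kind_mixVertex k f f' p₀
  · refine kind_eq_of_qubit hT hT' hv hv' hp he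
      (qubit_of_mem_union_of_notMem_supp (hM.pair q hq) hρ hv hs)
      (qubit_of_mem_union_of_notMem_supp (hM.pair q' hq') hρ' hv' (hp ▸ hs)) fun w hw hb => ?_
    refine qubit_of_mem_union_of_notMem_supp (hn := hn) (hM.pair q hq) hρ hw ?_
    change w.block hn ∉ _
    rw [hb]
    exact hs

/-- Exchanging a vertex with another one of the same kind stays within the layer. -/
theorem mem_principal_of_exchange {A : Layer (Vertex H)}
    (hA : A ∈ allLayers (disjComplex H) (2 * n - 1) (gadgetLayers H))
    {σ σ' : Finset (Vertex H)} {v v' : Vertex H} (hσ : σ ∈ A.principal)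
    (hσ' : (coreGraph H hn).IsTransversal σ') (hv : v ∈ σ) (hv' : v' ∈ σ')
    (hp : (coreGraph H hn).pos v = (coreGraph H hn).pos v') (he : σ.erase v = σ'.erase v')
    (hk : (coreGraph H hn).kind v = (coreGraph H hn).kind v') : σ' ∈ A.principal := by
  have hmem : ∀ w ∈ σ', w ≠ v' → w ∈ σ := fun w hw hne => by
    have : w ∈ σ.erase v := by rw [he]; exact mem_erase.2 ⟨hne, hw⟩
    exact mem_of_mem_erase this
  have hbase : (∃ i a l, v = .qubit i a l) → ∃ i a l, v' = .qubit i a l := by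
    rintro ⟨i, a, l, rfl⟩
    cases v'
    case qubit i a l => exact ⟨i, a, l, rfl⟩
    all_goals cases hk
  rcases mem_allLayers_iff.1 hA with rfl | ⟨g, B, hB, rfl⟩
  · have h1 := ((mem_simplicesOfDim_disjComplex hn).1 hσ).2
    refine (mem_simplicesOfDim_disjComplex hn).2 ⟨hσ', fun w hw => ?_⟩
    by_cases hne : w = v'
    · subst hne; exact hbase (h1 v hv)
    · exact h1 w (hmem w hw hne)
  obtain ⟨k, S, hM⟩ := exists_isMixLayer hn hB
  obtain ⟨q, hq, f, ρ, hρ, rfl⟩ := hM.principal_join.1 hσ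
  have G := (hM.pair q hq).isGluing (hn := hn)
  obtain ⟨f', hf'⟩ := G.exchange_mixVertex (k := k) (f := f)
    (fun p => mem_union_left _ (mem_image_of_mem _ (mem_univ p))) hv' (hσ'.good.1 v' hv') he hp hk
  refine mem_principal_of_mixVertex hM hσ' hq hf' fun w hw hws => ?_
  by_cases hne : w = v'
  · subst hne
    exact hbase (qubit_of_mem_union_of_notMem_supp (hM.pair q hq) hρ hv (by rw [hp]; exact hws))
  · exact qubit_of_mem_union_of_notMem_supp (hM.pair q hq) hρ (hmem w hw hne) hws

/-- A simplex that touches the central vertex is internal: it shares a coface with each of the two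
principal simplices obtained by exchanging the central vertex. -/
theorem isInternalSimplex_of_apex_mem (hn : 0 < n) {hg : ¬ (H g).IsGlue} {f : GadgetPos H g → Bool}
    {p : GadgetPos H g} {ρ : Finset (Vertex H)} (hρ : ρ ∈ restSimplices H (H g).supp) :
    IsInternalSimplex (gadgetComplex H) (Fintype.card (Fin n ×ₗ Bool) - 1)
      ((fillLayer H g hg).join (restSimplices H (H g).supp)).simplices
      (insert (.apex g hg) ((mixSimplex (octX H g) (octCopyX H g)
        (Fintype.card (GadgetPos H g)) f ∪ ρ).erase (octCopyX H g p (f p)))) := by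
  have hM := isMixLayer_fill hn hg
  rw [← card_gadgetPos] at hM
  set f' := Function.update f p (!(f p)) with hf'
  set T := mixSimplex (octX H g) (octCopyX H g) (Fintype.card (GadgetPos H g)) f ∪ ρ with hTd
  set T' := mixSimplex (octX H g) (octCopyX H g) (Fintype.card (GadgetPos H g)) f' ∪ ρ with hTd'
  have hT := (IsGluingPair.x (H := H) (g := g)).transversal (hn := hn) hρ
    (Fintype.card (GadgetPos H g)) f
  have hT' := (IsGluingPair.x (H := H) (g := g)).transversal (hn := hn) hρ
    (Fintype.card (GadgetPos H g)) f'
  rw [← hTd] at hT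
  rw [← hTd'] at hT'
  have hsub : ∀ {x}, x ∈ ((fillLayer H g hg).join (restSimplices H (H g).supp)).principal →
      x ∈ ((fillLayer H g hg).join (restSimplices H (H g).supp)).simplices := by
    rintro x ⟨α, hα, h⟩
    exact ⟨α, hM.subset hα, h⟩
  have hmem : T ∈ ((fillLayer H g hg).join (restSimplices H (H g).supp)).simplices :=
    hsub (hM.principal_join.2 ⟨_, rfl, f, ρ, hρ, rfl⟩)
  have hmem' : T' ∈ ((fillLayer H g hg).join (restSimplices H (H g).supp)).simplices :=
    hsub (hM.principal_join.2 ⟨_, rfl, f', ρ, hρ, rfl⟩)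
  have haT : Vertex.apex g hg ∉ T := apex_notMem_of_isGood hT.good
  have haT' : Vertex.apex g hg ∉ T' := apex_notMem_of_isGood hT'.good
  have hcT : octCopyX H g p (f p) ∈ T := octCopyX_mem f p ρ
  have hcT' : octCopyX H g p (!(f p)) ∈ T' := by
    have := octCopyX_mem f' p ρ
    rwa [hf', Function.update_self] at this
  have hcne : octCopyX H g p (f p) ≠ octCopyX H g p (!(f p)) := by
    have : ∀ h b, posLabel h b ≠ posLabel h (!b) := by decide
    intro e
    simp only [octCopyX, copyX.injEq, heq_eq_eq, true_and] at e
    exact this _ _ e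
  have hcnT' : octCopyX H g p (f p) ∉ T' := fun h => hcne (hT'.inj h hcT' (by
    rw [IsGluingPair.x.isGluing.pos_hi, IsGluingPair.x.isGluing.pos_hi]))
  have hTT' : T ≠ T' := fun e => hcnT' (e ▸ hcT)
  have hsubT' : T.erase (octCopyX H g p (f p)) ⊆ T' := by
    intro x hx
    obtain ⟨hx1, hx2⟩ := mem_erase.1 hx
    rcases mem_union.1 hx2 with hx2 | hx2
    · rw [mixSimplex_card] at hx2
      obtain ⟨r, -, rfl⟩ := mem_image.1 hx2
      have hr : r ≠ p := by rintro rfl; exact hx1 rfl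
      have := octCopyX_mem f' r ρ
      rwa [hf', Function.update_of_ne hr] at this
    · exact mem_union_right _ hx2
  have hd : ∀ {U : Finset (Vertex H)}, (coreGraph H hn).IsTransversal U → Vertex.apex g hg ∉ U →
      (insert (Vertex.apex g hg) U).card = Fintype.card (Fin n ×ₗ Bool) - 1 + 1 + 1 := by
    intro U hU ha
    rw [card_insert_of_notMem ha, hU.card, card_positions]
    omega
  refine ⟨T, hmem, T', hmem', fun e => haT (e ▸ mem_insert_self _ _),
    fun e => haT' (e ▸ mem_insert_self _ _), hTT', insert (.apex g hg) T,
    ⟨insert_apex_mem hn hg hρ f, hd hT haT⟩, insert (.apex g hg) T',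
    ⟨insert_apex_mem hn hg hρ f', hd hT' haT'⟩, ?_, insert_subset_insert _ (erase_subset _ _),
    insert_subset_insert _ hsubT', subset_insert _ _, subset_insert _ _⟩
  intro e
  rw [← erase_insert haT, e, erase_insert haT'] at hTT'
  exact hTT' rfl

theorem exists_of_isCap {A : Layer (Vertex H)}
    (hA : A ∈ allLayers (disjComplex H) (2 * n - 1) (gadgetLayers H)) {c : Vertex H}
    (hc : (coreGraph H hn).IsCap A c) : ∃ g, ∃ hg : ¬ (H g).IsGlue,
      c = .apex g hg ∧ A = (fillLayer H g hg).join (restSimplices H (H g).supp) := by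
  obtain ⟨hr, σ, hσ, hcσ⟩ := hc
  rcases mem_layer_cases (hn := hn) hA hσ with h | ⟨τ, a, b, u, u', hs, -, hu, -, -, -, rfl, -⟩ |
    ⟨g, hg, f, p, ρ, hρ, hAe, rfl⟩
  · exact absurd ((transversal_of_mem_principal (hn := hn) hA h).good.1 c hcσ) hr
  · exact absurd (hs.good.1 c (mem_of_mem_erase hcσ)) hr
  · refine ⟨g, hg, ?_, hAe⟩
    rcases mem_insert.1 hcσ with h | h
    · exact h
    · exact absurd (((IsGluingPair.x (H := H) (g := g)).transversal (hn := hn) hρ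
        (Fintype.card (GadgetPos H g)) f).good.1 c (mem_of_mem_erase h)) hr

/-- A non-principal member of the last layer of a filling gadget touches the central vertex. -/
theorem apex_mem_of_notMem_principal (hn : 0 < n) {hg : ¬ (H g).IsGlue} {σ : Finset (Vertex H)}
    (hσ : σ ∈ ((fillLayer H g hg).join (restSimplices H (H g).supp)).simplices)
    (hp : σ ∉ ((fillLayer H g hg).join (restSimplices H (H g).supp)).principal) :
    Vertex.apex g hg ∈ σ := by
  have hM := isMixLayer_fill hn hg
  obtain ⟨ρ, hρ, ⟨q, hq, f, rfl⟩ | ⟨q, hq, f, p, hk, h, rfl⟩ | ⟨hg', f, p, -, rfl⟩⟩ :=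
    hM.simplices_join hσ
  · exact absurd (hM.principal_join.2 ⟨q, hq, f, ρ, hρ, rfl⟩) hp
  · rw [card_gadgetPos] at h
    omega
  · exact mem_insert_self _ _

end Gadget

/-! ### Cliques with irregular vertices -/

section Gadget

variable {n t : ℕ} {H : Fin t → Term n} {hn : 0 < n} {g : Fin t}

open Vertex PositionedGraph

/-- A member of a layer has a vertex at the first position of each block `i`, unless it contains a
vertex of a copy in the gadget of a term that acts on `i`. -/
theorem exists_vertex_of_mem_layer {A : Layer (Vertex H)}
    (hA : A ∈ allLayers (disjComplex H) (2 * n - 1) (gadgetLayers H)) {σ : Finset (Vertex H)}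
    (hσ : σ ∈ A.simplices) (i : Fin n) :
    (∃ z ∈ σ, z.IsRegular ∧ (coreGraph H hn).pos z = toLex (i, false)) ∨
    ∃ g, i ∈ (H g).supp ∧ ((∃ j l, .copyX g j l ∈ σ) ∨ ∃ hg j l, .copyY g hg j l ∈ σ) := by
  have hprin : ∀ {T : Finset (Vertex H)}, (coreGraph H hn).IsTransversal T →
      ∃ z ∈ T, z.IsRegular ∧ (coreGraph H hn).pos z = toLex (i, false) := fun hT => by
    obtain ⟨z, hz, e⟩ := hT.exists_pos (toLex (i, false))
    exact ⟨z, hz, hT.good.1 z hz, e⟩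
  rcases mem_allLayers_iff.1 hA with rfl | ⟨g, B, hB, rfl⟩
  · exact Or.inl (hprin (transversal_of_mem_principal (hn := hn) hA hσ))
  obtain ⟨k, S, hM⟩ := exists_isMixLayer hn hB
  obtain ⟨ρ, hρ, h⟩ := hM.simplices_join hσ
  by_cases hi : i ∈ (H g).supp
  · rcases h with ⟨q, hq, f, rfl⟩ | ⟨q, hq, f, p, hk, hp, rfl⟩ | ⟨hg, f, p, -, rfl⟩
    · exact Or.inl (hprin ((hM.pair q hq).transversal hρ k f))
    · right
      refine ⟨g, hi, ?_⟩
      obtain ⟨r, hr⟩ := exists_posRank_eq (ι := GadgetPos H g)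
        (r := Fintype.card (GadgetPos H g) - k) (by omega)
      have hpair := hM.pair q hq
      have G := hpair.isGluing (hn := hn)
      have hmem : q.2 r (f r) ∈ (slabSimplex q.1 q.2 k f).erase (q.1 p (f p)) ∪ ρ :=
        mem_union_left _ (mem_erase.2 ⟨fun e => G.lower p (f p) (e ▸ G.upper r (f r)),
          mem_union_right _ (mem_image_of_mem _ (mem_filter.2 ⟨mem_univ _, by omega⟩))⟩)
      obtain ⟨lo, hi'⟩ := q
      cases hpair
      exacts [Or.inl ⟨_, _, hmem⟩, Or.inr ⟨_, _, _, hmem⟩, Or.inl ⟨_, _, hmem⟩,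
        Or.inr ⟨_, _, _, hmem⟩]
    · right
      refine ⟨g, hi, Or.inl ?_⟩
      obtain ⟨p₁, p₂, hne, -⟩ := exists_two_last (H := H) (g := g)
      obtain ⟨r, hr⟩ : ∃ r, r ≠ p := by
        by_cases h : p₁ = p
        exacts [⟨p₂, fun e => hne (h.trans e.symm)⟩, ⟨p₁, h⟩]
      refine ⟨_, _, mem_insert_of_mem (mem_erase.2 ⟨fun e => hr ?_, octCopyX_mem f r ρ⟩)⟩
      exact (isGluing_octX (hn := hn) (H := H) (g := g)).inj (by
        rw [← isGluing_octX.pos_hi r (f r)]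
        change (coreGraph H hn).pos (octCopyX H g r (f r)) = _
        rw [show octCopyX H g r (f r) = octCopyX H g p (f p) from e, isGluing_octX.pos_hi])
  · left
    -- outside the blocks of `g` the vertex comes from the disjoint qubit graph
    have hrest : ∃ z ∈ ρ, z.IsRegular ∧ (coreGraph H hn).pos z = toLex (i, false) := by
      obtain ⟨q, hq⟩ : ∃ f : GadgetPos H g → Bool, f = fun _ => false := ⟨_, rfl⟩
      obtain ⟨z, hz, hzr, hzp⟩ := hprin
        ((IsGluingPair.x (H := H) (g := g)).transversal (hn := hn) hρ 0 q)
      rcases mem_union.1 hz with hz | hz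
      · obtain ⟨p, -, rfl⟩ := mem_image.1 hz
        have := (IsGluingPair.x (H := H) (g := g)).pos_mem_supp (hn := hn) 0 q p
        rw [hzp] at this
        exact absurd this hi
      · exact ⟨z, hz, hzr, hzp⟩
    obtain ⟨z, hz, hzr⟩ := hrest
    refine ⟨z, ?_, hzr⟩
    rcases h with ⟨q, hq, f, rfl⟩ | ⟨q, hq, f, p, hk, hp, rfl⟩ | ⟨hg, f, p, -, rfl⟩
    · exact mem_union_right _ hz
    · exact mem_union_right _ hz
    · refine mem_insert_of_mem (mem_erase.2 ⟨?_, mem_union_right _ hz⟩)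
      rintro rfl
      exact absurd (gadget_eq_none_of_mem_rest hρ hz) (by simp [octCopyX, Vertex.gadget])

theorem gadgetRel_of_adj {v w : Vertex H} (h : (gadgetGraph H).Adj v w) :
    gadgetRel v w ∨ gadgetRel w v :=
  ((SimpleGraph.fromRel_adj _ _ _).1 h).2

/-- A coface of a member of a layer does not contain an edge `4ᵢ⁰4ᵢ¹`: its endpoints have no common
neighbour at the position `{1ᵢ, 2ᵢ}`, and none in the copies of a term that acts on `i`. -/
theorem bit_eq_of_mem_coface (hn : 0 < n) {A : Layer (Vertex H)}
    (hA : A ∈ allLayers (disjComplex H) (2 * n - 1) (gadgetLayers H)) {σ τ : Finset (Vertex H)}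
    (hσ : σ ∈ A.simplices) (hτ : τ ∈ gadgetComplex H) (hs : σ ⊆ τ) {i : Fin n} {a b : Bool}
    {l l' : Fin 4} (hu : .qubit i a l ∈ τ) (hw : .qubit i b l' ∈ τ) : a = b := by
  by_contra hab
  have hne : (Vertex.qubit i a l : Vertex H) ≠ .qubit i b l' := fun e => by
    cases e; exact hab rfl
  have hl : l = 3 ∧ l' = 3 := by
    have := gadgetRel_of_adj (gadgetGraph_adj_of_mem hτ hu hw hne)
    simp only [gadgetRel, ne_eq, not_true_eq_false, false_or] at this
    grind
  obtain ⟨rfl, rfl⟩ := hl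
  rcases exists_vertex_of_mem_layer (hn := hn) hA hσ i with ⟨z, hz, hzr, hzp⟩ | ⟨g, hi, hc⟩
  · have key : ∀ c, .qubit i c 3 ∈ τ → gadgetRel (.qubit i c 3) z ∨ gadgetRel z (.qubit i c 3) := by
      intro c hc
      refine gadgetRel_of_adj (gadgetGraph_adj_of_mem hτ hc (hs hz) ?_)
      rintro rfl
      have := congrArg (fun x => (ofLex x).2) hzp
      exact absurd this (by change decide ((2 : Fin 4) ≤ 3) ≠ false; decide)
    have h1 := key a hu
    have h2 := key b hw
    have hzb : z.block hn = i := congrArg (fun x => (ofLex x).1) hzp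
    have hzl : decide (2 ≤ z.lab) = false := congrArg (fun x => (ofLex x).2) hzp
    rw [decide_eq_false_iff_not] at hzl
    cases z <;> simp only [gadgetRel, Vertex.block, Vertex.lab, thickAdj_iff, slot_lt_iff,
      or_false, Vertex.IsRegular] at h1 h2 hzb hzl hzr
    case qubit j c m =>
      subst hzb
      grind
    case mid g hg j m =>
      subst hzb
      exact h1 j.2
    case copyX g j m =>
      subst hzb
      have := (h1 j.2).2
      grind
    case copyY g hg j m =>
      subst hzb
      have := (h1 j.2).2
      grind
  · rcases hc with ⟨j, m, hc⟩ | ⟨hg, j, m, hc⟩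
    · have h1 := gadgetRel_of_adj (gadgetGraph_adj_of_mem hτ hu (hs hc) (by simp))
      have h2 := gadgetRel_of_adj (gadgetGraph_adj_of_mem hτ hw (hs hc) (by simp))
      simp only [gadgetRel, or_false] at h1 h2
      exact hab ((h1 hi).1.trans (h2 hi).1.symm)
    · have h1 := gadgetRel_of_adj (gadgetGraph_adj_of_mem hτ hu (hs hc) (by simp))
      have h2 := gadgetRel_of_adj (gadgetGraph_adj_of_mem hτ hw (hs hc) (by simp))
      simp only [gadgetRel, or_false] at h1 h2
      exact hab ((h1 hi).1.trans (h2 hi).1.symm)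

theorem axis_notMem_of_mem_layer (hn : 0 < n) {A : Layer (Vertex H)}
    (hA : A ∈ allLayers (disjComplex H) (2 * n - 1) (gadgetLayers H)) {σ : Finset (Vertex H)}
    (hσ : σ ∈ A.simplices) {hg : (H g).IsGlue} {i : (H g).supp} : Vertex.axis g hg i ∉ σ := by
  intro h
  obtain ⟨g', hg', e, -⟩ := exists_of_isCap (hn := hn) hA ⟨id, σ, hσ, h⟩
  cases e

/-- A coface with a central vertex `4ᵢᶜ` has at most one facet in the filtration, which is not
essential. -/
theorem coface_of_axis_mem {A : Layer (Vertex H)}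
    (hA : A ∈ allLayers (disjComplex H) (2 * n - 1) (gadgetLayers H)) {σ τ : Finset (Vertex H)}
    (hσ : σ ∈ A.simplices) (hτ : τ ∈ gadgetComplex H)
    (hc : τ.card = Fintype.card (Fin n ×ₗ Bool) + 1) (hs : σ ⊆ τ) {hg : (H g).IsGlue}
    {i : (H g).supp} (h : Vertex.axis g hg i ∈ τ) :
    σ ∉ A.principal ∧ (∀ c, ¬ (coreGraph H hn).IsCap A c) ∧
      ∀ A' ∈ allLayers (disjComplex H) (2 * n - 1) (gadgetLayers H), ∀ σ' ∈ A'.simplices,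
        σ' ⊆ τ → σ' = σ := by
  have heq : ∀ A' ∈ allLayers (disjComplex H) (2 * n - 1) (gadgetLayers H), ∀ σ' ∈ A'.simplices,
      σ' ⊆ τ → σ' = τ.erase (.axis g hg i) := fun A' hA' σ' hσ' hs' =>
    erase_eq_of_subset hs' (axis_notMem_of_mem_layer hn hA' hσ')
      (by rw [hc, card_of_mem_layer hn hA' hσ']) h
  have hadj : ∀ z ∈ σ, gadgetRel z (.axis g hg i) ∨ gadgetRel (.axis g hg i) z := fun z hz => by
    refine gadgetRel_of_adj (gadgetGraph_adj_of_mem hτ (hs hz) h ?_)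
    rintro rfl
    exact axis_notMem_of_mem_layer hn hA hσ hz
  -- a vertex at the position `{1ᵢ, 2ᵢ}` is not adjacent to `4ᵢᶜ`
  have hnp : σ ∉ A.principal := by
    intro hp
    have hT := transversal_of_mem_principal (hn := hn) hA hp
    obtain ⟨z, hz, hzp⟩ := hT.exists_pos (toLex ((i : Fin n), false))
    have h1 := hadj z hz
    have hzr := hT.good.1 z hz
    have hzb : z.block hn = i := congrArg (fun x => (ofLex x).1) hzp
    have hzl : decide (2 ≤ z.lab) = false := congrArg (fun x => (ofLex x).2) hzp
    rw [decide_eq_false_iff_not] at hzl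
    cases z <;> simp only [gadgetRel, Vertex.block, Vertex.lab, or_false] at h1 hzb hzl
    case qubit j c m =>
      rcases h1 with h1 | ⟨rfl, -⟩
      exacts [h1 hzb, hzl (by decide)]
    case mid j m =>
      rcases h1.2 with h1 | rfl
      exacts [h1 hzb, hzl (by decide)]
    case copyX j m =>
      rcases h1.2 with h1 | rfl
      exacts [h1 hzb, hzl (by decide)]
    case copyY j m =>
      rcases h1.2 with h1 | rfl
      exacts [h1 hzb, hzl (by decide)]
    case axis => exact hzr
  refine ⟨hnp, fun c hcap => ?_, fun A' hA' σ' hσ' hs' => ?_⟩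
  -- a central vertex of a filling gadget is not adjacent to `4ᵢᶜ`
  · obtain ⟨g', hg', -, rfl⟩ := exists_of_isCap hA hcap
    have h1 := hadj _ (apex_mem_of_notMem_principal hn hσ hnp)
    simp [gadgetRel] at h1
  · rw [heq A' hA' σ' hσ' hs', heq A hA σ hσ hs]

/-- A coface with the central vertex of a filling gadget is the cone over a principal simplex of the
last layer of this gadget, to which all its facets in the filtration belong. -/
theorem coface_of_apex_mem {A : Layer (Vertex H)}
    (hA : A ∈ allLayers (disjComplex H) (2 * n - 1) (gadgetLayers H)) {σ τ : Finset (Vertex H)}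
    (hσ : σ ∈ A.simplices) (hτ : τ ∈ gadgetComplex H)
    (hc : τ.card = Fintype.card (Fin n ×ₗ Bool) + 1) (hs : σ ⊆ τ) {hg : ¬ (H g).IsGlue}
    (h : Vertex.apex g hg ∈ τ) :
    (coreGraph H hn).IsCap A (.apex g hg) ∧ τ.erase (.apex g hg) ∈ A.principal ∧
      ∀ A' ∈ allLayers (disjComplex H) (2 * n - 1) (gadgetLayers H), ∀ σ' ∈ A'.simplices,
        σ' ⊆ τ → σ' ∈ A.simplices := by
  set T := τ.erase (Vertex.apex g hg) with hTd
  set A₁ := (fillLayer H g hg).join (restSimplices H (H g).supp) with hA₁d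
  have hA₁ : A₁ ∈ allLayers (disjComplex H) (2 * n - 1) (gadgetLayers H) :=
    mem_allLayers_iff.2 (Or.inr ⟨g, _, fillLayer_mem hg, rfl⟩)
  have hM := isMixLayer_fill hn hg
  rw [← card_gadgetPos] at hM
  -- the neighbours of the central vertex
  have hnb : ∀ v ∈ T, (∃ i ∉ (H g).supp, ∃ a l, v = .qubit i a l) ∨ ∃ i l, v = .copyX g i l := by
    intro v hv
    obtain ⟨hne, hv'⟩ := mem_erase.1 hv
    have := gadgetRel_of_adj (gadgetGraph_adj_of_mem hτ hv' h hne)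
    cases v <;> simp only [gadgetRel, or_false] at this
    case qubit i a l => exact Or.inl ⟨i, this, a, l, rfl⟩
    case copyX g' i l => subst this; exact Or.inr ⟨i, l, rfl⟩
  have hgood : (coreGraph H hn).IsGood T := by
    refine ⟨fun v hv => ?_, fun v hv w hw hne => (coreAdj_iff hne).2 ⟨?_, ?_,
      gadgetGraph_adj_of_mem hτ (mem_of_mem_erase hv) (mem_of_mem_erase hw) hne, ?_⟩⟩
    · rcases hnb v hv with ⟨i, -, a, l, rfl⟩ | ⟨i, l, rfl⟩ <;> trivial
    · rcases hnb v hv with ⟨i, -, a, l, rfl⟩ | ⟨i, l, rfl⟩ <;> trivial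
    · rcases hnb w hw with ⟨i, -, a, l, rfl⟩ | ⟨i, l, rfl⟩ <;> trivial
    · rintro i a b l l' rfl rfl
      exact bit_eq_of_mem_coface hn hA hσ hτ hs (mem_of_mem_erase hv) (mem_of_mem_erase hw)
  have hTc : T.card = Fintype.card (Fin n ×ₗ Bool) := by
    rw [hTd, card_erase_of_mem h, hc]; rfl
  have hT : (coreGraph H hn).IsTransversal T := by
    refine ⟨hgood, hTc, fun v hv w hw e => ?_⟩
    by_contra hne
    have hup := (coreGraph H hn).upper_iff_not (hgood.2 v hv w hw hne) e hne
    rcases hnb v hv with ⟨i, hi, a, l, rfl⟩ | ⟨i, l, rfl⟩ <;>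
      rcases hnb w hw with ⟨j, hj, b, m, rfl⟩ | ⟨j, m, rfl⟩
    · exact hup.2 id
    · obtain ⟨rfl, -⟩ := slot_eq_iff.1 e
      exact hi j.2
    · obtain ⟨e1, -⟩ := slot_eq_iff.1 e
      change (i : Fin n) = j at e1
      exact hj (e1 ▸ i.2)
    · exact hup.1 trivial trivial
  -- in the blocks of `g` all vertices belong to the copy, so `T` is one of its maximal simplices
  have hpos : ∀ p, ∃ b, octCopyX H g p b ∈ T := by
    intro p
    obtain ⟨w, hw, hwp⟩ := hT.exists_pos (gadgetEmb H g p)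
    rcases hnb w hw with ⟨i, hi, a, l, rfl⟩ | ⟨i, l, rfl⟩
    · have : i = (ofLex p).1 := congrArg (fun x => (ofLex x).1) hwp
      exact absurd (this ▸ (ofLex p).1.2) hi
    · obtain ⟨b, e⟩ := (isGluing_octX.kind_hi (b := false) (hT.good.1 _ hw)).1 ⟨hwp, rfl⟩
      exact ⟨b, e ▸ hw⟩
  choose f hf using hpos
  have hTp : T ∈ A₁.principal := by
    refine mem_principal_of_mixVertex hM hT (Set.mem_singleton _) (f := f) (fun p => ?_)
      fun w hw hws => ?_
    · unfold mixVertex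
      rw [if_neg (by omega)]
      exact hf p
    · rcases hnb w hw with ⟨i, hi, a, l, rfl⟩ | ⟨i, l, rfl⟩
      · exact ⟨i, a, l, rfl⟩
      · exact absurd i.2 hws
  have hTs : T ∈ A₁.simplices := by
    obtain ⟨α, hα, e⟩ := hTp
    exact ⟨α, hM.subset hα, e⟩
  have hall : ∀ A' ∈ allLayers (disjComplex H) (2 * n - 1) (gadgetLayers H), ∀ σ' ∈ A'.simplices,
      σ' ⊆ τ → σ' ∈ A₁.simplices := by
    intro A' hA' σ' hσ' hs'
    by_cases ha : Vertex.apex g hg ∈ σ'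
    · obtain ⟨g', hg', e, rfl⟩ := exists_of_isCap (hn := hn) hA' ⟨id, σ', hσ', ha⟩
      cases e
      exact hσ'
    · rw [erase_eq_of_subset hs' ha (by rw [hc, card_of_mem_layer hn hA' hσ']) h]
      exact hTs
  have hAA : A = A₁ := by
    by_contra hne
    have : Std.Symm fun A B : Layer (Vertex H) => Disjoint A.simplices B.simplices :=
      ⟨fun _ _ h => h.symm⟩
    exact Set.disjoint_left.1 ((pairwise_allLayers hn).forall hA hA₁ hne) hσ (hall A hA σ hσ hs)
  rw [hAA]
  refine ⟨⟨id, ?_⟩, hTp, hall⟩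
  obtain ⟨q, rfl, f, ρ, hρ, -⟩ := hM.principal_join.1 hTp
  obtain ⟨p, -⟩ := exists_two_last (H := H) (g := g)
  exact ⟨_, ⟨_, Or.inr ⟨f, p, rfl⟩, ρ, hρ, rfl⟩, mem_union_left _ (mem_insert_self _ _)⟩

/-- The gadget complex is layered. -/
theorem isLayering_gadget (hn : 0 < n) : (coreGraph H hn).IsLayering (gadgetComplex H)
    (allLayers (disjComplex H) (2 * n - 1) (gadgetLayers H)) where
  good_mem hne h := mem_gadgetComplex_of_isGood hne h
  principal_subset {A} hA := by
    rcases mem_allLayers_iff.1 hA with rfl | ⟨g, B, hB, rfl⟩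
    · exact subset_rfl
    · obtain ⟨k, S, hM⟩ := exists_isMixLayer hn hB
      rintro σ ⟨α, hα, h⟩
      exact ⟨α, hM.subset hα, h⟩
  card_eq hA _ hσ := card_of_mem_layer hn hA hσ
  mem_complex hA _ hσ := mem_gadgetComplex_of_mem_layer hn hA hσ
  disj := pairwise_allLayers hn
  transversal hA _ hσ := transversal_of_mem_principal hA hσ
  exists_layer hσ := exists_layer_of_transversal hσ
  kind_of_exchange hA _ _ _ _ hσ hσ' hv hv' hp he := kind_of_exchange hA hσ hσ' hv hv' hp he
  exchange hA _ _ _ _ hσ hσ' hv hv' hp he hk := mem_principal_of_exchange hA hσ hσ' hv hv' hp he hk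
  nonprincipal hA σ hσ hp := by
    rcases mem_layer_cases (hn := hn) hA hσ with h | h | ⟨g, hg, f, p, ρ, hρ, rfl, rfl⟩
    · exact absurd h hp
    · exact Or.inl h
    · exact Or.inr ⟨fun h => apex_notMem_of_isGood h (mem_insert_self _ _),
        isInternalSimplex_of_apex_mem hn hρ⟩
  not_good_of_cap hA c hc σ hσ hp hgood := by
    obtain ⟨g, hg, rfl, rfl⟩ := exists_of_isCap hA hc
    exact apex_notMem_of_isGood hgood (apex_mem_of_notMem_principal hn hσ hp)
  cap_unique hA c c' hc hc' := by
    obtain ⟨g, hg, rfl, rfl⟩ := exists_of_isCap hA hc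
    obtain ⟨g', hg', rfl, e⟩ := exists_of_isCap hA hc'
    obtain ⟨-, σ, hσ, hcσ⟩ := hc
    rw [e] at hσ
    rcases (gadget_of_mem_join (fillLayer_mem hg') hσ hn).1 _ hcσ with h | h
    · cases h
    · obtain rfl : g = g' := Option.some.inj h
      rfl
  coface_not_good {τ} hτ hc hng A hA σ hσ hs := by
    obtain ⟨v, hv, hr⟩ : ∃ v ∈ τ, ¬ v.IsRegular := by
      by_contra! hreg
      refine hng ⟨hreg, fun v hv w hw hne => (coreAdj_iff hne).2 ⟨hreg v hv, hreg w hw,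
        gadgetGraph_adj_of_mem hτ hv hw hne, ?_⟩⟩
      rintro i a b l l' rfl rfl
      exact bit_eq_of_mem_coface hn hA hσ hτ hs hv hw
    cases v
    case axis g hg i => exact Or.inl (coface_of_axis_mem hA hσ hτ hc hs hv)
    case apex g hg => exact Or.inr ⟨_, hv, coface_of_apex_mem hA hσ hτ hc hs hv⟩
    all_goals exact absurd trivial hr

end Gadget

/-! ### The filtrations of the gadget complex and of a gluing -/

section Gadget

variable {n t : ℕ} {H : Fin t → Term n}

theorem disjComplex_le_gadgetComplex : disjComplex H ≤ gadgetComplex H := by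
  rintro σ ⟨hne, hq, hcl⟩
  refine ⟨hne, Set.subset_univ _, fun v hv w hw hvw => ?_⟩
  obtain ⟨i, a, l, rfl⟩ := hq hv
  obtain ⟨j, b, l', rfl⟩ := hq hw
  have h := hcl hv hw hvw
  unfold disjGraph at h
  unfold gadgetGraph
  rw [SimpleGraph.fromRel_adj] at h ⊢
  exact ⟨h.1, h.2.imp (Or.imp_right Or.inl) (Or.imp_right Or.inl)⟩

end Gadget

theorem mainTheorem6 :
    -- the gadget complex of an arbitrary Hamiltonian `H = ∑ g, H g` on `n ≥ 1` qubits
    (∀ (n t : ℕ) (_ : 0 < n) (H : Fin t → Term n) (lam : ℝ) (_ : 0 < lam),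
      ∃ o : Finset (Vertex H) → ℤˣ,
        (∀ σ ∈ simplicesOfDim (qubitComplex H) (2 * n - 1),
          o σ = (-1) ^ (∑ v ∈ σ, qubitLabel v)) ∧
        IsUniformOrientedFiltration (gadgetComplex H) (vertexWeight lam) (2 * n - 1)
          (gadgetLayers H).length (gadgetFiltration H) o ∧
        (gadgetLayers H).length ≤ 5 * n * t ∧
        gadgetFiltration H 0 = disjComplex H ∧
        essentialSimplices (gadgetComplex H) (gadgetFiltration H) (2 * n - 1) 0 =
          simplicesOfDim (disjComplex H) (2 * n - 1) ∧
        (∀ (s : ℕ) (hs : s < (gadgetLayers H).length),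
          addedSimplices (gadgetFiltration H) (2 * n - 1) (s + 1) =
              ((gadgetLayers H)[s]).simplices ∧
          essentialSimplices (gadgetComplex H) (gadgetFiltration H) (2 * n - 1) (s + 1) =
              ((gadgetLayers H)[s]).principal)) ∧
    -- a single gluing of two generalized octahedra, unweighted
    (∀ (p : ℕ) (_ : 0 < p),
      ∃ o : Finset ((Fin p ×ₗ Bool) ×ₗ Bool) → ℤˣ,
        (∀ σ ∈ simplicesOfDim (gluingFiltration p 0) (p - 1),
          o σ = (-1) ^ (∑ v ∈ σ, octahedronLabel v)) ∧
        IsUniformOrientedFiltration (thickening (octahedron p)) (fun _ => 1) (p - 1) p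
          (gluingFiltration p) o ∧
        gluingFiltration p 0 = (octahedron p).map (fun u => toLex (u, false)) ∧
        essentialSimplices (thickening (octahedron p)) (gluingFiltration p) (p - 1) 0 =
          simplicesOfDim (gluingFiltration p 0) (p - 1) ∧
        (∀ (s : ℕ) (hs : s < (gluingLayers p).length),
          addedSimplices (gluingFiltration p) (p - 1) (s + 1) =
              ((gluingLayers p)[s]).simplices ∧
          essentialSimplices (thickening (octahedron p)) (gluingFiltration p) (p - 1) (s + 1) =
              ((gluingLayers p)[s]).principal)) := by
  refine ⟨fun n t hn H lam _ => ?_, fun p hp => exists_orientation_gluing hp⟩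
  have L := isLayering_gadget (H := H) hn
  have hd : Fintype.card (Fin n ×ₗ Bool) = 2 * n - 1 + 1 := by rw [card_positions]; omega
  refine ⟨(Vertex.coreGraph H hn).labelSign, fun σ hσ => ?_,
    L.isUniformOrientedFiltration hd disjComplex_le_gadgetComplex
      (fun A hA => exists_weight_eq hn lam hA),
    length_gadgetLayers_le, layerFiltration_zero _ _, L.essentialSimplices_zero hd,
    fun s hs => L.simplices_succ hd s hs⟩
  unfold PositionedGraph.labelSign
  congr 1
  refine sum_congr rfl fun v hv => ?_
  obtain ⟨i, a, l, rfl⟩ := hσ.1.2.1 hv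
  rfl
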